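/- Setting. Let $\mathcal T^H_0$ be a conforming triangulation of (the closure of) a polygonal domain $\Omega\subset\mathbb R^2$, let $\mathcal T^H$ be the coarse mesh obtained by joining the centroid of every triangle of $\mathcal T_0^H$ to its vertices, and let $\mathcal T^h$ be a conforming refinement of $\mathcal T^H$. Let $\mathcal E_p$ be the set of edges of $\mathcal T^H_0$, $\mathcal E_p^0$ the set of those that are interior, and $\mathcal E^H$ the set of all edges of $\mathcal T^H$, each with a chosen unit normal $n$. Let $\kappa,\rho$ be measurable and bounded between positive constants, $T>0$, $f(t,\cdot)\in L^2(\Omega)$ for $t\in[0,T]$, $\|v\|_V^2=\int_\Omega\kappa|v|^2$, $\|p\|_Q^2=\int_\Omega\rho p^2$. Let $Q_h$ be the piecewise constants on $\mathcal T^h$, and $\widehat V_h$ the lowest order Raviart–Thomas fields on $\mathcal T^h$ whose normal components are continuous across all fine edges except those on $\mathcal E_p^0$. Let $\widetilde Q_{h,0}$ be the functions $q$ that vanish on fine triangles without an edge on $\mathcal E_p$, are affine with zero mean on each fine triangle, and on the fine edges lying on $\mathcal E_p$ are constant, continuous, and zero if the edge is on $\partial\Omega$. For $q\in Q_h+\widetilde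 Q_{h,0}$ let $q^{(I)}\in Q_h$, $q^{(B)}\in\widetilde Q_{h,0}$ be its components. Let $v_h(t)\in\widehat V_h$, $p_h(t)\in Q_h+\widetilde Q_{h,0}$ be differentiable in $t\in[0,T]$, with $v_h(0)=0$, $p_h(0)=0$, and for all $t\in[0,T]$ $$\int_\Omega\kappa\,\dot v_h\cdot w-\int_\Omega p_h^{(I)}\nabla\cdot w+\sum_{e\subset\mathcal E_p^0}\int_e p_h^{(B)}[w\cdot n]=0\quad\forall w\in\widehat V_h,$$ $$\int_\Omega\rho\,\dot p_h\,q+\int_\Omega q^{(I)}\nabla\cdot v_h-\sum_{e\subset\mathcal E_p^0}\int_e q^{(B)}[v_h\cdot n]=\int_\Omega f q\quad\forall q\in Q_h+\widetilde Q_{h,0},$$ where the sums run over the fine edges $e$ lying on $\mathcal E_p^0$. Basis functions. For $K\in\mathcal T^H$ let $V_h(K)$, $Q_h(K)$ be the Raviart–Thomas and piecewise constant spaces on the fine mesh of $K$, and $V_{h,0}(K)\subset V_h(K)$ the fields with zero normal component on $\partial K$. For $E\in\mathcal E^H$ let $\omega_E$ be the union of the $K\in\mathcal T^H$ having the edge $E$.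 Consider fields $\phi$ supported on $\omega_E$ that, on each such $K$, belong to $V_h(K)$, have zero normal component on $\partial K\setminus E$, and satisfy $\int_K\kappa\phi\cdot w=\int_K q\nabla\cdot w$ for all $w\in V_{h,0}(K)$, with some $q\in Q_h(K)$. (1) $\phi_E^{(1)}$ is such a field with $\phi_E^{(1)}\cdot n=1$ on $E$ and $\nabla\cdot\phi_E^{(1)}=\pm|E|/|K|$ on $K$ ($+$ if $n$ points out of $K$, $-$ otherwise). (2) The snapshot space $V_{E,\mathrm{snap}}$ consists of such fields with $\nabla\cdot\phi=0$ on each $K\subset\omega_E$ and $\phi\cdot n$ on $E$ single-valued, constant on each fine edge and of zero mean over $E$. Let $N_E+1$ be the number of fine edges on $E$, and let $(\lambda_{E,j},\phi_{E,j}^{(2)})_{j=1}^{N_E}$, $\lambda_{E,1}\le\dots\le\lambda_{E,N_E}$, be a complete system of eigenpairs in $V_{E,\mathrm{snap}}$ of $$\int_E(\phi\cdot n)(w\cdot n)=\lambda\int_{\omega_E}\kappa\,\phi\cdot w\quad\forall w\in V_{E,\mathrm{snap}},$$ normalized by $\int_E(\phi^{(2)}_{E,i}\cdot n)(\phi^{(2)}_{E,j}\cdot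 n)=\delta_{ij}$. (3) Let $M_K+1=\dim Q_h(K)$, and let $(\mu_{K,j},\phi^{(3)}_{K,j},p^{(3)}_{K,j})_{j=1}^{M_K}$, $\mu_{K,1}\le\dots\le\mu_{K,M_K}$, be a complete system of solutions $(\mu,\phi,p)$ with $\phi\in V_{h,0}(K)$, $p\in Q_h(K)$, $\int_Kp=0$ of $$\int_K\kappa\phi\cdot w=\int_Kp\nabla\cdot w\ \ \forall w\in V_{h,0}(K),\qquad \int_Kq\nabla\cdot\phi=\mu\int_K\rho\,p\,q\ \ \forall q\in Q_h(K),\ \textstyle\int_Kq=0,$$ normalized by $\int_K\rho\,p^{(3)}_{K,i}p^{(3)}_{K,j}=\delta_{ij}$. Theorem. There is an absolute constant $C$ (in particular independent of the meshes) such that in the above setting, for all integers $0\le n_E\le N_E$ and $0\le m_K\le M_K$ and all $t\in[0,T]$, the following holds. With $c_{E,0}$ the average of $v_h\cdot n$ on $E$ and $c_{E,j}=\int_E(v_h\cdot n)(\phi_{E,j}^{(2)}\cdot n)$, there are unique coefficients $d_{K,j}$ with $$v_h=\sum_{E\in\mathcal E^H}\Big(c_{E,0}\phi_E^{(1)}+\sum_{j=1}^{N_E}c_{E,j}\phi_{E,j}^{(2)}\Big)+\sum_{K\in\mathcal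 T^H}\sum_{j=1}^{M_K}d_{K,j}\phi_{K,j}^{(3)},$$ and the interpolant $$\pi(v_h)=\sum_{E\in\mathcal E^H}\Big(c_{E,0}\phi_E^{(1)}+\sum_{j=1}^{n_E}c_{E,j}\phi_{E,j}^{(2)}\Big)+\sum_{K\in\mathcal T^H}\sum_{j=1}^{m_K}d_{K,j}\phi_{K,j}^{(3)}$$ satisfies $$\|v_h-\pi(v_h)\|_V^2\le C\Big[\Big(\max_{E\in\mathcal E^H}\lambda_{E,n_E+1}^{-1}\Big)\sum_{E\in\mathcal E^H}\int_E(v_h\cdot n)^2+\Big(\max_{K\in\mathcal T^H}\mu_{K,m_K+1}^{-1}\Big)\|\rho^{-1}f-\dot p_h\|_Q^2\Big].$$ Here $\lambda_{E,N_E+1}^{-1}=\mu_{K,M_K+1}^{-1}=0$ by convention; on an edge $E\in\mathcal E_p^0$, where $v_h\cdot n$ has two traces, the basis functions of $E$ are decoupled (each is restricted to the two coarse elements of $\omega_E$, with the coefficients of the respective trace), and $\int_E(v_h\cdot n)^2$ means the average of the two one-sided integrals. -/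

import Mathlib

open MeasureTheory Set
open scoped RealInnerProductSpace

noncomputable section

namespace MixedGMsFEM

/-! ### Plane geometry -/

/-- The Euclidean plane. -/
abbrev Plane := EuclideanSpace ℝ (Fin 2)

/-- Rotation by a right angle. -/
def rot (d : Plane) : Plane := !₂[-(d 1), d 0]

/-- The closed triangle with the given vertices. -/
def hull (x : Fin 3 → Plane) : Set Plane := convexHull ℝ (Set.range x)

/-- The edge of a triangle opposite to the vertex `i`, as an unordered pair of endpoints. -/
def side (x : Fin 3 → Plane) (i : Fin 3) : Sym2 Plane := s(x (i + 1), x (i + 2))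

/-- The closed segment spanned by an unordered pair of points. -/
def seg (e : Sym2 Plane) : Set Plane := convexHull ℝ {x | x ∈ e}

/-- The length of an edge. -/
def edgeLength (e : Sym2 Plane) : ℝ := Sym2.lift ⟨fun a b => dist a b, dist_comm⟩ e

/-- The unit normal on the edge opposite to the vertex `i` that points out of the triangle. -/
def outerNormal (x : Fin 3 → Plane) (i : Fin 3) : Plane :=
  (-(SignType.sign ⟪rot (x (i + 2) - x (i + 1)), x i - x (i + 1)⟫ : ℝ) /
    ‖x (i + 2) - x (i + 1)‖) • rot (x (i + 2) - x (i + 1))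

/-- The integral of `g`, with respect to arc length, over the edge opposite to the vertex `i`. -/
def sideIntegral (x : Fin 3 → Plane) (i : Fin 3) (g : Plane → ℝ) : ℝ :=
  dist (x (i + 1)) (x (i + 2)) *
    ∫ s in (0 : ℝ)..1, g (AffineMap.lineMap (x (i + 1)) (x (i + 2)) s)

/-! ### Polynomials on one element -/

/-- The Raviart–Thomas field of lowest order `x ↦ a + b x` with coefficients `(a, b)`. -/
def rt (c : Plane × ℝ) (x : Plane) : Plane := c.1 + c.2 • x

/-- The divergence (a constant) of the field `x ↦ a + b x` in the plane. -/
def rtDiv (c : Plane × ℝ) : ℝ := 2 * c.2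

/-- The affine function `x ↦ α + β · x` with coefficients `(α, β)`. -/
def p1 (c : ℝ × Plane) (x : Plane) : ℝ := c.1 + ⟪c.2, x⟫

/-! ### Meshes -/

/-- A conforming triangulation: finitely many nondegenerate triangles, any two of which
meet exactly in the convex hull of their common vertices. -/
structure Triangulation where
  card : ℕ
  vertex : Fin card → Fin 3 → Plane
  affineIndependent : ∀ τ, AffineIndependent ℝ (vertex τ)
  injective : ∀ τ σ, Set.range (vertex τ) = Set.range (vertex σ) → τ = σ
  conforming : ∀ τ σ, hull (vertex τ) ∩ hull (vertex σ) =
    convexHull ℝ (Set.range (vertex τ) ∩ Set.range (vertex σ))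

/-- The vertices of the coarse element obtained from the triangle `T` by joining its centroid
(vertex `0` of the new triangle) with the edge of `T` opposite to the vertex `i`. -/
def splitVertex (S : Triangulation) (K : Fin S.card × Fin 3) : Fin 3 → Plane :=
  ![(3⁻¹ : ℝ) • ∑ j, S.vertex K.1 j, S.vertex K.1 (K.2 + 1), S.vertex K.1 (K.2 + 2)]

/-- An initial triangulation, whose triangles are each split into three at the centroid to give
the coarse mesh, together with a conforming triangulation that refines the coarse mesh. -/
structure Mesh where
  init : Triangulation
  fine : Triangulation
  fine_subset : ∀ τ, ∃ K, hull (fine.vertex τ) ⊆ hull (splitVertex init K)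
  subset_fine : ∀ K, hull (splitVertex init K) ⊆ ⋃ τ, hull (fine.vertex τ)

namespace Mesh

variable (M : Mesh)

/-- The index set of the coarse mesh: a triangle of the initial mesh and one of its edges. -/
abbrev Cell := Fin M.init.card × Fin 3

/-- The index set of the fine mesh. -/
abbrev Elem := Fin M.fine.card

/-- A coarse element as a set. -/
def cell (K : M.Cell) : Set Plane := hull (splitVertex M.init K)

/-- A fine element as a set. -/
def tri (τ : M.Elem) : Set Plane := hull (M.fine.vertex τ)

/-- The closure of the computational domain. -/
def domain : Set Plane := ⋃ T, hull (M.init.vertex T)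

/-- The edges of a coarse element. -/
def cellSide (K : M.Cell) (i : Fin 3) : Sym2 Plane := side (splitVertex M.init K) i

/-- The edges of a fine element. -/
def elemSide (τ : M.Elem) (i : Fin 3) : Sym2 Plane := side (M.fine.vertex τ) i

open Classical in
/-- The fine elements contained in a coarse element. -/
def elems (K : M.Cell) : Finset M.Elem := Finset.univ.filter fun τ => M.tri τ ⊆ M.cell K

/-- The edges of the initial triangulation. -/
def initEdges : Set (Sym2 Plane) := {e | ∃ T i, e = side (M.init.vertex T) i}

/-- The interior edges of the initial triangulation: those shared by two triangles. -/
def initInteriorEdges : Set (Sym2 Plane) :=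
  {e | ∃ T T' i i', T ≠ T' ∧ e = side (M.init.vertex T) i ∧ e = side (M.init.vertex T') i'}

open Classical in
/-- All edges of the coarse mesh. -/
def coarseEdges : Finset (Sym2 Plane) :=
  Finset.univ.image fun Ki : M.Cell × Fin 3 => M.cellSide Ki.1 Ki.2

open Classical in
/-- The coarse elements that have the edge `E`; their union is the patch of `E`. -/
def patch (E : Sym2 Plane) : Finset M.Cell := Finset.univ.filter fun K => ∃ i, M.cellSide K i = E

open Classical in
/-- The fine elements in the patch of `E`. -/
def patchElems (E : Sym2 Plane) : Finset M.Elem := (M.patch E).biUnion M.elems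

open Classical in
/-- The fine edges that lie on `E`. -/
def fineEdges (E : Sym2 Plane) : Finset (Sym2 Plane) :=
  (Finset.univ.image fun τi : M.Elem × Fin 3 => M.elemSide τi.1 τi.2).filter
    fun e => seg e ⊆ seg E

open Classical in
/-- The edges, lying on `E`, of the fine elements of the coarse element `K`. -/
def sidesOn (K : M.Cell) (E : Sym2 Plane) : Finset (M.Elem × Fin 3) :=
  Finset.univ.filter fun τi => τi.1 ∈ M.elems K ∧ seg (M.elemSide τi.1 τi.2) ⊆ seg E

/-- The fine edge `e` lies on an edge of the initial triangulation. -/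
def OnInit (e : Sym2 Plane) : Prop := ∃ E ∈ M.initEdges, seg e ⊆ seg E

/-- The fine edge `e` lies on an interior edge of the initial triangulation. -/
def OnInitInterior (e : Sym2 Plane) : Prop := ∃ E ∈ M.initInteriorEdges, seg e ⊆ seg E

/-- The dimension of the space of piecewise constant functions of zero mean on `E`. -/
def edgeDim (E : Sym2 Plane) : ℕ := (M.fineEdges E).card - 1

/-- The dimension of the space of piecewise constant functions of zero mean on `K`. -/
def cellDim (K : M.Cell) : ℕ := (M.elems K).card - 1

/-! ### Discrete functions and integrals

A discrete velocity is given by its Raviart–Thomas polynomial on every fine element, without any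
continuity; the continuity requirements are part of the definitions of the spaces. -/

/-- Elementwise Raviart–Thomas fields. -/
abbrev VField := M.Elem → Plane × ℝ

/-- Piecewise constant functions on the fine mesh. -/
abbrev QField := M.Elem → ℝ

/-- Piecewise affine functions on the fine mesh. -/
abbrev BField := M.Elem → ℝ × Plane

variable {M}

/-- `∫ κ v · w` over the union of the fine elements in `A`. -/
def vInner (κ : Plane → ℝ) (A : Finset M.Elem) (v w : M.VField) : ℝ :=
  ∑ τ ∈ A, ∫ x in M.tri τ, κ x * ⟪rt (v τ) x, rt (w τ) x⟫

/-- `∫ q ∇ · w` over the union of the fine elements in `A`. -/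
def divPair (A : Finset M.Elem) (q : M.QField) (w : M.VField) : ℝ :=
  ∑ τ ∈ A, ∫ _x in M.tri τ, q τ * rtDiv (w τ)

/-- `∫ ρ p q` over the union of the fine elements in `A`. -/
def qInner (ρ : Plane → ℝ) (A : Finset M.Elem) (p q : M.QField) : ℝ :=
  ∑ τ ∈ A, ∫ x in M.tri τ, ρ x * (p τ * q τ)

/-- `∫ q` over the union of the fine elements in `A`. -/
def qIntegral (A : Finset M.Elem) (q : M.QField) : ℝ :=
  ∑ τ ∈ A, ∫ _x in M.tri τ, q τ

/-- The component of `v`, on the fine element `τ`, along the outer normal on its `i`-th edge. -/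
def outflow (v : M.VField) (τ : M.Elem) (i : Fin 3) (x : Plane) : ℝ :=
  ⟪rt (v τ) x, outerNormal (M.fine.vertex τ) i⟫

variable (M) in
/-- The integral over `E` of a function given on every fine element, whose trace on `E` is taken
from the coarse element `K`. -/
def edgeIntegral (K : M.Cell) (E : Sym2 Plane) (g : M.Elem → Plane → ℝ) : ℝ :=
  ∑ τi ∈ M.sidesOn K E, sideIntegral (M.fine.vertex τi.1) τi.2 (g τi.1)

variable (M) in
open Classical in
/-- `∑ ∫_e q [w · n]` over all fine edges `e` on interior edges of the initial triangulation. The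
jump `[w · n]` on `e` is the sum of the two outer normal components of `w`, and `q` has a single
value on `e`, so this is a sum over pairs of a fine element and one of its edges. -/
def jumpPair (q : M.BField) (w : M.VField) : ℝ :=
  ∑ τi ∈ Finset.univ.filter fun τi : M.Elem × Fin 3 => M.OnInitInterior (M.elemSide τi.1 τi.2),
    sideIntegral (M.fine.vertex τi.1) τi.2 fun x => p1 (q τi.1) x * outflow w τi.1 τi.2 x

/-! ### Finite element spaces -/

/-- The normal components of `v` are continuous across the common edge of two fine elements
`τ`, `σ`, whenever they have one and `P` holds for the two elements and that edge. -/
def NormalContinuous (P : M.Elem → M.Elem → Sym2 Plane → Prop) (v : M.VField) : Prop :=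
  ∀ τ σ i j, τ ≠ σ → M.elemSide τ i = M.elemSide σ j → P τ σ (M.elemSide τ i) →
    ∀ x ∈ seg (M.elemSide τ i), outflow v τ i x + outflow v σ j x = 0

variable (M) in
/-- The decoupled velocity space: the normal components are continuous across all fine edges
except those on (interior) edges of the initial triangulation. -/
def IsVelocity (v : M.VField) : Prop := NormalContinuous (fun _ _ e => ¬ M.OnInit e) v

/-- The restriction of `v` to the coarse element `K` belongs to the Raviart–Thomas space of the
fine mesh of `K`. -/
def IsLocal (K : M.Cell) (v : M.VField) : Prop :=
  NormalContinuous (fun τ σ _ => τ ∈ M.elems K ∧ σ ∈ M.elems K) v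

/-- The Raviart–Thomas space on `K` with zero normal components on the boundary of `K`
(extended by zero to the other elements). -/
def IsLocalZero (K : M.Cell) (v : M.VField) : Prop :=
  IsLocal K v ∧ (∀ τ ∉ M.elems K, v τ = 0) ∧
    ∀ k, ∀ τi ∈ M.sidesOn K (M.cellSide K k), ∀ x ∈ seg (M.elemSide τi.1 τi.2),
      outflow v τi.1 τi.2 x = 0

/-- The additional pressure space, with zero boundary values: functions, supported on the fine
elements that have an edge on the initial triangulation, that are affine and of zero mean on every
fine element, constant and continuous on the fine edges on the initial triangulation, and zero on
those of them that lie on the boundary of the domain. -/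
structure IsPenalty (q : M.BField) : Prop where
  support : ∀ τ, (∀ i, ¬ M.OnInit (M.elemSide τ i)) → q τ = 0
  mean_zero : ∀ τ, ∫ x in M.tri τ, p1 (q τ) x = 0
  const : ∀ τ i, M.OnInit (M.elemSide τ i) → ∃ c, ∀ x ∈ seg (M.elemSide τ i), p1 (q τ) x = c
  continuous : ∀ τ σ i j, M.elemSide τ i = M.elemSide σ j → M.OnInit (M.elemSide τ i) →
    ∀ x ∈ seg (M.elemSide τ i), p1 (q τ) x = p1 (q σ) x
  boundary : ∀ τ i, M.OnInit (M.elemSide τ i) → ¬ M.OnInitInterior (M.elemSide τ i) →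
    ∀ x ∈ seg (M.elemSide τ i), p1 (q τ) x = 0

/-! ### The reference solution -/

variable (M) in
/-- Measurable coefficients that are bounded above and bounded below by a positive constant. -/
def IsCoefficient (κ : Plane → ℝ) : Prop :=
  AEStronglyMeasurable κ (volume.restrict M.domain) ∧
    ∃ a b : ℝ, 0 < a ∧ ∀ᵐ x ∂volume.restrict M.domain, a ≤ κ x ∧ κ x ≤ b

/-- The value, on the fine element `τ`, of the pressure `p = pI + pB`, the sum of a piecewise
constant function and of a function in the additional pressure space. -/
def pressure (pI : M.QField) (pB : M.BField) (τ : M.Elem) (x : Plane) : ℝ := pI τ + p1 (pB τ) x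

/-- `v` and `p = pI + pB`, with time derivatives `v'` and `p' = pI' + pB'`, solve the modified
Raviart–Thomas scheme on `[0, T]` with zero initial values. As the two pressure spaces intersect
trivially, `pI` and `pB` are the components of `p`. -/
structure IsReferenceSolution (κ ρ : Plane → ℝ) (f : ℝ → Plane → ℝ) (T : ℝ)
    (v v' : ℝ → M.VField) (pI pI' : ℝ → M.QField) (pB pB' : ℝ → M.BField) : Prop where
  velocity : ∀ t ∈ Icc 0 T, M.IsVelocity (v t)
  penalty : ∀ t ∈ Icc 0 T, IsPenalty (pB t)
  hasDeriv_v : ∀ t ∈ Icc 0 T, HasDerivWithinAt v (v' t) (Icc 0 T) t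
  hasDeriv_pI : ∀ t ∈ Icc 0 T, HasDerivWithinAt pI (pI' t) (Icc 0 T) t
  hasDeriv_pB : ∀ t ∈ Icc 0 T, HasDerivWithinAt pB (pB' t) (Icc 0 T) t
  init_v : v 0 = 0
  init_pI : pI 0 = 0
  init_pB : pB 0 = 0
  eq_v : ∀ t ∈ Icc 0 T, ∀ w : M.VField, M.IsVelocity w →
    vInner κ Finset.univ (v' t) w - divPair Finset.univ (pI t) w + M.jumpPair (pB t) w = 0
  eq_p : ∀ t ∈ Icc 0 T, ∀ (qI : M.QField) (qB : M.BField), IsPenalty qB →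
    ∑ τ, (∫ x in M.tri τ, ρ x * (pressure (pI' t) (pB' t) τ x * pressure qI qB τ x)) +
        divPair Finset.univ qI (v t) - M.jumpPair qB (v t) =
      ∑ τ, ∫ x in M.tri τ, f t x * pressure qI qB τ x

/-! ### Multiscale basis functions -/

variable (M) in
/-- A choice of a unit normal on every coarse edge. -/
def IsEdgeNormal (n : Sym2 Plane → Plane) : Prop :=
  ∀ E ∈ M.coarseEdges, ‖n E‖ = 1 ∧ ∀ a ∈ E, ∀ b ∈ E, ⟪n E, b - a⟫ = 0

/-- The component of `v` in the direction `n`, on every fine element. -/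
def normalComp (n : Plane) (v : M.VField) (τ : M.Elem) (x : Plane) : ℝ := ⟪rt (v τ) x, n⟫

/-- On the coarse element `K`, which has the edge `E`, the field `ψ` solves the local problem
with divergence `c`, normal component `δ` (a function of the fine edges) on `E`, with respect to
the normal `n`, and zero normal component on the other two edges of `K`. -/
structure SolvesLocal (κ : Plane → ℝ) (n : Plane) (K : M.Cell) (E : Sym2 Plane) (c : ℝ)
    (δ : Sym2 Plane → ℝ) (ψ : M.VField) : Prop where
  isLocal : IsLocal K ψ
  eq_v : ∃ q : M.QField, ∀ w, IsLocalZero K w →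
    vInner κ (M.elems K) ψ w - divPair (M.elems K) q w = 0
  eq_div : ∀ q : M.QField, divPair (M.elems K) q ψ = qIntegral (M.elems K) fun τ => c * q τ
  normal_on : ∀ τi ∈ M.sidesOn K E, ∀ x ∈ seg (M.elemSide τi.1 τi.2),
    normalComp n ψ τi.1 x = δ (M.elemSide τi.1 τi.2)
  normal_off : ∀ k, M.cellSide K k ≠ E → ∀ τi ∈ M.sidesOn K (M.cellSide K k),
    ∀ x ∈ seg (M.elemSide τi.1 τi.2), outflow ψ τi.1 τi.2 x = 0

/-- The first basis function of the coarse edge `E`: supported on the patch of `E`, with normal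
component `1` on `E`, zero normal components on the other edges, and on every coarse element `K`
with the edge `E` the constant divergence that is compatible with these boundary values, that is
`|E| / |K|` if the normal `n` on `E` points out of `K`, and `- |E| / |K|` if it points into `K`. -/
def IsFirstBasis (κ : Plane → ℝ) (n : Plane) (E : Sym2 Plane) (φ : M.VField) : Prop :=
  (∀ τ ∉ M.patchElems E, φ τ = 0) ∧
    ∀ K k, M.cellSide K k = E →
      SolvesLocal κ n K E
        (⟪n, outerNormal (splitVertex M.init K) k⟫ * (edgeLength E / volume.real (M.cell K)))
        (fun _ => 1) φ

/-- The snapshot space of the coarse edge `E`: fields supported on the patch of `E` whose normal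
component on `E` is piecewise constant with zero mean, and that solve on every coarse element with
the edge `E` the local problem with zero divergence. -/
def IsSnapshot (κ : Plane → ℝ) (n : Plane) (E : Sym2 Plane) (ψ : M.VField) : Prop :=
  (∀ τ ∉ M.patchElems E, ψ τ = 0) ∧
    ∃ δ : Sym2 Plane → ℝ, ∑ e ∈ M.fineEdges E, edgeLength e * δ e = 0 ∧
      ∀ K ∈ M.patch E, SolvesLocal κ n K E 0 δ ψ

/-- A complete system of eigenfunctions `φ j` and eigenvalues `lam j`, `j < edgeDim E`, of the
spectral problem on the snapshot space of `E`, in increasing order of the eigenvalues, whose normal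
components are orthonormal on `E`. (The normal component of a snapshot has a single value on `E`,
so it does not matter from which coarse element `K` the traces are taken.) -/
structure IsEdgeEigenbasis (κ : Plane → ℝ) (n : Plane) (E : Sym2 Plane)
    (lam : ℕ → ℝ) (φ : ℕ → M.VField) : Prop where
  snapshot : ∀ j < M.edgeDim E, IsSnapshot κ n E (φ j)
  eigen : ∀ j < M.edgeDim E, ∀ w, IsSnapshot κ n E w → ∀ K ∈ M.patch E,
    M.edgeIntegral K E (fun τ x => normalComp n (φ j) τ x * normalComp n w τ x) =
      lam j * vInner κ (M.patchElems E) (φ j) w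
  orthonormal : ∀ i < M.edgeDim E, ∀ j < M.edgeDim E, ∀ K ∈ M.patch E,
    M.edgeIntegral K E (fun τ x => normalComp n (φ i) τ x * normalComp n (φ j) τ x) =
      if i = j then 1 else 0
  mono : ∀ i j, i ≤ j → j < M.edgeDim E → lam i ≤ lam j

/-- A complete system of eigenfunctions `(φ j, p j)` and eigenvalues `mu j`, `j < cellDim K`, of
the spectral problem on the coarse element `K` for pressures of zero mean, in increasing order of
the eigenvalues, with pressures orthonormal for the weight `ρ`. -/
structure IsCellEigenbasis (κ ρ : Plane → ℝ) (K : M.Cell)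
    (mu : ℕ → ℝ) (φ : ℕ → M.VField) (p : ℕ → M.QField) : Prop where
  localZero : ∀ j < M.cellDim K, IsLocalZero K (φ j)
  mean_zero : ∀ j < M.cellDim K, qIntegral (M.elems K) (p j) = 0
  eigen_v : ∀ j < M.cellDim K, ∀ w, IsLocalZero K w →
    vInner κ (M.elems K) (φ j) w - divPair (M.elems K) (p j) w = 0
  eigen_p : ∀ j < M.cellDim K, ∀ q : M.QField, qIntegral (M.elems K) q = 0 →
    divPair (M.elems K) q (φ j) = mu j * qInner ρ (M.elems K) (p j) q
  orthonormal : ∀ i < M.cellDim K, ∀ j < M.cellDim K,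
    qInner ρ (M.elems K) (p i) (p j) = if i = j then 1 else 0
  mono : ∀ i j, i ≤ j → j < M.cellDim K → mu i ≤ mu j

/-! ### The expansion and the interpolant -/

/-- The average over `E` of the normal component of `v`, with the trace from `K`. -/
def averageCoeff (n : Plane) (v : M.VField) (K : M.Cell) (E : Sym2 Plane) : ℝ :=
  (edgeLength E)⁻¹ * M.edgeIntegral K E (normalComp n v)

/-- `∫_E (v · n) (φ · n)`, with traces from `K`. -/
def edgeCoeff (n : Plane) (v : M.VField) (K : M.Cell) (E : Sym2 Plane) (φ : M.VField) : ℝ :=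
  M.edgeIntegral K E fun τ x => normalComp n v τ x * normalComp n φ τ x

open Classical in
/-- The expansion with the coefficients `averageCoeff`, `edgeCoeff` and `d` in the first basis
functions, the first `nE E` eigenfunctions of every coarse edge `E` and the first `mK K`
eigenfunctions of every coarse element `K`. The basis functions of an edge are restricted to the
coarse elements `K` of its patch, with a coefficient for every such `K`: this decouples the basis
functions on the interior edges of the initial triangulation; on every other edge the normal
component of a discrete velocity `v` has a single value, and the coefficients do not depend on
`K`. -/
def expansion (n : Sym2 Plane → Plane) (φ₁ : Sym2 Plane → M.VField)
    (φ₂ : Sym2 Plane → ℕ → M.VField) (φ₃ : M.Cell → ℕ → M.VField)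
    (nE : Sym2 Plane → ℕ) (mK : M.Cell → ℕ) (v : M.VField) (d : M.Cell → ℕ → ℝ) : M.VField :=
  fun τ => ∑ K ∈ Finset.univ.filter fun K : M.Cell => τ ∈ M.elems K,
    (∑ E ∈ M.coarseEdges.filter fun E => K ∈ M.patch E,
        (averageCoeff (n E) v K E • φ₁ E τ +
          ∑ j ∈ Finset.range (nE E), edgeCoeff (n E) v K E (φ₂ E j) • φ₂ E j τ) +
      ∑ j ∈ Finset.range (mK K), d K j • φ₃ K j τ)

/-- `∫_E (v · n)²`; if the traces of `v · n` from the two sides of `E` differ, this is the mean of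
the two one-sided integrals. -/
def edgeEnergy (n : Plane) (v : M.VField) (E : Sym2 Plane) : ℝ :=
  ((M.patch E).card : ℝ)⁻¹ *
    ∑ K ∈ M.patch E, M.edgeIntegral K E fun τ x => normalComp n v τ x ^ 2

end Mesh

/-- The inverse of the first eigenvalue that is left out when the first `k` of the eigenvalues
`lam 0, …, lam (N - 1)` are used; it is `0` if none is left out. -/
def invNext (N : ℕ) (lam : ℕ → ℝ) (k : ℕ) : ℝ := if k < N then (lam k)⁻¹ else 0

end MixedGMsFEM

end

open MixedGMsFEM

/-!
The expansion and the estimate are proved on one coarse element `K` at a time; the finite element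
spaces enter only through the following facts.

*Orthogonality in time.* Let `w` be a discrete field on `K` with zero normal component on the
boundary of `K` and zero divergence. Extended by zero, it is a test function of the velocity
equation, in which both pressure terms vanish. So the derivative of `∫ κ v · w` is zero, and `v` is
orthogonal to `w` at all times, as it starts from zero
(`IsReferenceSolution.orthogonal`). The basis functions have the same property by their local
problems.

*Expansion.* On every coarse edge the normal component of `v`, seen from `K`, is its mean plus its
expansion in the traces of the eigenfunctions, by a dimension count
(`IsEdgeEigenbasis.trace_expansion`). Subtracting the edge functions leaves a field with zero normal
component on the boundary of `K`. After subtracting the eigenfunctions of `K` as well, the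
divergence of the rest is constant, hence zero by the divergence theorem, and so the rest is
divergence-free and orthogonal to itself (`IsCellEigenbasis.expansion`, `local_expansion`).
The coefficients are `d j = (mu j)⁻¹ ∫ p j ∇ · v`; they are unique since the eigenfunctions of `K`
are orthogonal with squared norms `mu j > 0`.

*Estimate.* The eigenfunctions of an edge are orthogonal with squared norms `(lam j)⁻¹`, and Bessel's
inequality on the edge bounds the sum of the squares of the coefficients
(`IsEdgeEigenbasis.tail_le`). For the element part, the squared norm of the tail is the sum of
`(mu j)⁻¹ (∫ p j ∇ · v)²`, the pressure equation turns `∇ · v` into `f - ρ p'`, and Bessel's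
inequality applies again (`IsCellEigenbasis.tail_le`).

The geometric input is that the fine mesh restricted to `K` behaves like a triangulation of `K`: a
fine edge in `K` lies on the boundary of `K` or is shared by exactly two fine elements of `K`
(`side_dichotomy`, `not_shared_of_mem_sidesOn`, `elem_unique_of_shared`), the fine edges on an edge
of `K` make up this edge (`sum_sidesOn`, `sum_edgeLength`), and the fine mesh of `K` is connected
through its edges (`eq_of_no_jumps`). The first property gives the divergence theorem on `K`
(`discrete_divergence`), the last one gives `mu j > 0` (`IsCellEigenbasis.mu_pos`).
-/

namespace MixedGMsFEM

/-! ### Barycentric coordinates of a triangle -/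

/-- The vertices of a nondegenerate triangle as an affine basis of the plane. -/
noncomputable def baryBasis {x : Fin 3 → Plane} (hx : AffineIndependent ℝ x) :
    AffineBasis (Fin 3) ℝ Plane :=
  ⟨x, hx, hx.affineSpan_eq_top_iff_card_eq_finrank_add_one.2 (by simp)⟩

/-- The barycentric coordinate of a nondegenerate triangle that vanishes on the edge opposite to
the vertex `i`. -/
noncomputable def bary {x : Fin 3 → Plane} (hx : AffineIndependent ℝ x) (i : Fin 3) :
    Plane →ᵃ[ℝ] ℝ :=
  (baryBasis hx).coord i

section Triangle

variable {x y : Fin 3 → Plane} (hx : AffineIndependent ℝ x) (hy : AffineIndependent ℝ y)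

theorem bary_vertex (i j : Fin 3) : bary hx i (x j) = if i = j then 1 else 0 :=
  (baryBasis hx).coord_apply i j

@[simp] theorem bary_vertex_self (i : Fin 3) : bary hx i (x i) = 1 := by simp [bary_vertex]

theorem bary_vertex_of_ne {i j : Fin 3} (h : i ≠ j) : bary hx i (x j) = 0 := by
  simp [bary_vertex, h]

theorem sum_bary (p : Plane) : ∑ i, bary hx i p = 1 := (baryBasis hx).sum_coord_apply_eq_one p

theorem mem_hull_iff {p : Plane} : p ∈ hull x ↔ ∀ i, 0 ≤ bary hx i p := by
  have := (baryBasis hx).convexHull_eq_nonneg_coord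
  exact Set.ext_iff.1 this p

theorem mem_interior_hull_iff {p : Plane} : p ∈ interior (hull x) ↔ ∀ i, 0 < bary hx i p := by
  have := (baryBasis hx).interior_convexHull
  exact Set.ext_iff.1 this p

theorem eq_of_bary_eq {p q : Plane} (h : ∀ i, bary hx i p = bary hx i q) : p = q :=
  (baryBasis hx).ext_elem h

include hx in
theorem affineMap_ext {f g : Plane →ᵃ[ℝ] ℝ} (h : ∀ i, f (x i) = g (x i)) : f = g := by
  refine AffineMap.ext_on (s := Set.range x) ?_ ?_
  · exact (baryBasis hx).tot
  · rintro _ ⟨i, rfl⟩; exact h i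

theorem fin3_cases (i j : Fin 3) : j = i ∨ j = i + 1 ∨ j = i + 2 := by revert i j; decide

theorem fin3_ne_add_one (i : Fin 3) : i ≠ i + 1 := by revert i; decide

theorem fin3_ne_add_two (i : Fin 3) : i ≠ i + 2 := by revert i; decide

theorem fin3_add_one_ne_add_two (i : Fin 3) : i + 1 ≠ i + 2 := by revert i; decide

/-- An affine function that vanishes on an edge is a multiple of the barycentric coordinate. -/
theorem eq_mul_bary {f : Plane →ᵃ[ℝ] ℝ} {i : Fin 3} (h₁ : f (x (i + 1)) = 0)
    (h₂ : f (x (i + 2)) = 0) (p : Plane) : f p = f (x i) * bary hx i p := by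
  have : f = (f (x i)) • bary hx i := by
    refine affineMap_ext hx fun j => ?_
    rcases fin3_cases i j with rfl | rfl | rfl
    · simp
    · simp [h₁, bary_vertex_of_ne hx (fin3_ne_add_one i)]
    · simp [h₂, bary_vertex_of_ne hx (fin3_ne_add_two i)]
  conv_lhs => rw [this]
  simp

theorem isClosed_hull (x : Fin 3 → Plane) : IsClosed (hull x) :=
  (Set.finite_range x).isClosed_convexHull ℝ

theorem isCompact_hull (x : Fin 3 → Plane) : IsCompact (hull x) :=
  (Set.finite_range x).isCompact_convexHull ℝ

theorem convex_hull (x : Fin 3 → Plane) : Convex ℝ (hull x) := convex_convexHull ℝ _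

theorem vertex_mem_hull (x : Fin 3 → Plane) (i : Fin 3) : x i ∈ hull x :=
  subset_convexHull ℝ _ ⟨i, rfl⟩

theorem seg_mk (a b : Plane) : seg s(a, b) = segment ℝ a b := by
  have : {z | z ∈ s(a, b)} = ({a, b} : Set Plane) := by ext z; simp
  rw [← convexHull_pair, ← this, seg]

theorem seg_side (x : Fin 3 → Plane) (i : Fin 3) :
    seg (side x i) = segment ℝ (x (i + 1)) (x (i + 2)) := seg_mk _ _

theorem bary_nonneg {i : Fin 3} {p : Plane} (hp : p ∈ hull x) : 0 ≤ bary hx i p :=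
  (mem_hull_iff hx).1 hp i

theorem seg_side_subset_hull (x : Fin 3 → Plane) (i : Fin 3) : seg (side x i) ⊆ hull x := by
  rw [seg_side]
  exact (convex_hull x).segment_subset (vertex_mem_hull x _) (vertex_mem_hull x _)

theorem mem_seg_side_iff {i : Fin 3} {p : Plane} :
    p ∈ seg (side x i) ↔ p ∈ hull x ∧ bary hx i p = 0 := by
  constructor
  · intro hp
    refine ⟨seg_side_subset_hull x i hp, ?_⟩
    rw [seg_side, segment_eq_image_lineMap] at hp
    obtain ⟨s, -, rfl⟩ := hp
    rw [AffineMap.apply_lineMap, bary_vertex_of_ne hx (fin3_ne_add_one i),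
      bary_vertex_of_ne hx (fin3_ne_add_two i)]
    simp
  · rintro ⟨hp, h0⟩
    rw [seg_side, segment_eq_image_lineMap]
    have hs := sum_bary hx p
    have hs' : bary hx (i + 1) p + bary hx (i + 2) p = 1 := by
      rw [Fin.sum_univ_three] at hs
      fin_cases i <;> simp at h0 ⊢ <;> linarith
    have h1 := bary_nonneg hx (i := i + 1) hp
    have h2 := bary_nonneg hx (i := i + 2) hp
    refine ⟨bary hx (i + 2) p, ⟨h2, by linarith⟩, eq_of_bary_eq hx fun j => ?_⟩
    rw [AffineMap.apply_lineMap, AffineMap.lineMap_apply_module]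
    rcases fin3_cases i j with rfl | rfl | rfl
    · simp [bary_vertex_of_ne hx (fin3_ne_add_one j), bary_vertex_of_ne hx (fin3_ne_add_two j), h0]
    · simp [bary_vertex_of_ne hx (fin3_add_one_ne_add_two i)]; linarith
    · simp [bary_vertex_of_ne hx (fin3_add_one_ne_add_two i).symm]

/-- The midpoint of the edge opposite to the vertex `i`. -/
noncomputable def mid (x : Fin 3 → Plane) (i : Fin 3) : Plane :=
  midpoint ℝ (x (i + 1)) (x (i + 2))

theorem mid_mem_seg (x : Fin 3 → Plane) (i : Fin 3) : mid x i ∈ seg (side x i) := by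
  rw [seg_side]; exact midpoint_mem_segment _ _

theorem affineMap_mid (f : Plane →ᵃ[ℝ] ℝ) (x : Fin 3 → Plane) (i : Fin 3) :
    f (mid x i) = (f (x (i + 1)) + f (x (i + 2))) / 2 := by
  rw [mid, AffineMap.map_midpoint, midpoint_eq_smul_add]
  simp; ring

/-- Midpoints of equal edges are equal. -/
theorem mid_eq_of_side_eq {i j : Fin 3} (h : side x i = side y j) : mid x i = mid y j := by
  unfold side at h
  rcases Sym2.eq_iff.1 h with ⟨h1, h2⟩ | ⟨h1, h2⟩
  · simp [mid, h1, h2]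
  · rw [mid, mid, h1, h2, midpoint_comm]

theorem affineMap_add_smul (f : Plane →ᵃ[ℝ] ℝ) (p ν : Plane) (ε : ℝ) :
    f (p + ε • ν) = f p + ε * f.linear ν := by
  have := f.map_vadd p (ε • ν)
  rw [vadd_eq_add, vadd_eq_add, add_comm] at this
  rw [this, map_smul, smul_eq_mul, add_comm]

theorem affineMap_add_smul_sub (f : Plane →ᵃ[ℝ] ℝ) (p q : Plane) (ε : ℝ) :
    f (p + ε • (q - p)) = f p + ε * (f q - f p) := by
  rw [affineMap_add_smul]
  congr 2
  have := f.linearMap_vsub q p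
  simpa using this

/-- Points of the hull of some of the vertices have vanishing coordinates at the others. -/
theorem bary_eq_zero_of_mem_convexHull {s : Set Plane} {i : Fin 3} (hs : s ⊆ Set.range x)
    (hi : x i ∉ s) {p : Plane} (hp : p ∈ convexHull ℝ s) : bary hx i p = 0 := by
  have hconv : Convex ℝ {q : Plane | bary hx i q = 0} := by
    have : {q : Plane | bary hx i q = 0} = (bary hx i) ⁻¹' {0} := rfl
    rw [this]
    exact (convex_singleton (0 : ℝ)).affine_preimage (bary hx i)
  refine convexHull_min ?_ hconv hp
  intro q hq
  obtain ⟨j, rfl⟩ := hs hq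
  refine bary_vertex_of_ne hx ?_
  rintro rfl
  exact hi hq

include hx hy in
theorem exists_vertex_not_mem (h : Set.range x ≠ Set.range y) : ∃ i, x i ∉ Set.range y := by
  by_contra! hc
  apply h
  have hsub : Set.range x ⊆ Set.range y := by rintro _ ⟨i, rfl⟩; exact hc i
  refine Set.eq_of_subset_of_ncard_le hsub ?_ (Set.finite_range y)
  rw [← Set.image_univ, ← Set.image_univ, Set.ncard_image_of_injective _ hx.injective,
    Set.ncard_image_of_injective _ hy.injective]

theorem interior_hull_nonempty (hx : AffineIndependent ℝ x) : (interior (hull x)).Nonempty := by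
  refine ⟨_, (baryBasis hx).centroid_mem_interior_convexHull⟩

include hx in
/-- Two triangles with disjoint interiors that share an edge lie on different sides of it. -/
theorem bary_opposite_neg (hd : Disjoint (interior (hull x)) (hull y)) {i j : Fin 3}
    (h : side x i = side y j) : bary hy j (x i) < 0 := by
  have hz : bary hy j (x (i + 1)) = 0 ∧ bary hy j (x (i + 2)) = 0 := by
    unfold side at h
    rcases Sym2.eq_iff.1 h with ⟨h1, h2⟩ | ⟨h1, h2⟩ <;> rw [h1, h2] <;>
    simp [bary_vertex_of_ne hy (fin3_ne_add_one j), bary_vertex_of_ne hy (fin3_ne_add_two j)]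
  have hmul := eq_mul_bary hx hz.1 hz.2
  have hne : bary hy j (x i) ≠ 0 := by
    intro h0
    have := hmul (y j)
    rw [h0] at this
    simp at this
  by_contra! hpos
  have hpos : 0 < bary hy j (x i) := lt_of_le_of_ne hpos hne.symm
  -- points of the median of the first triangle close to the edge belong to both triangles
  have hmid : mid x i = mid y j := mid_eq_of_side_eq h
  have hy1 : ∀ k, k ≠ j → bary hy k (mid x i) = 1 / 2 := by
    intro k hk
    rw [hmid, affineMap_mid]
    rcases fin3_cases j k with rfl | rfl | rfl
    · exact absurd rfl hk
    · simp [bary_vertex_of_ne hy (fin3_add_one_ne_add_two j)]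
    · simp [bary_vertex_of_ne hy (fin3_add_one_ne_add_two j).symm]
  have hyj : bary hy j (mid x i) = 0 := by
    rw [affineMap_mid, hz.1, hz.2]; simp
  have hev : ∀ᶠ ε : ℝ in nhdsWithin 0 (Ioi 0),
      mid x i + ε • (x i - mid x i) ∈ hull y := by
    -- the coordinate `j` grows linearly from `0`, the other ones start at `1 / 2`
    have : ∀ k, ∀ᶠ ε : ℝ in nhdsWithin 0 (Ioi 0),
        0 ≤ bary hy k (mid x i + ε • (x i - mid x i)) := by
      intro k
      by_cases hk : k = j
      · subst hk
        filter_upwards [self_mem_nhdsWithin] with ε hε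
        rw [affineMap_add_smul_sub, hyj]
        have : (0 : ℝ) < ε := hε
        simp only [sub_zero, zero_add]
        positivity
      · have hc : ContinuousAt
            (fun ε : ℝ => bary hy k (mid x i) + ε * (bary hy k (x i) - bary hy k (mid x i))) 0 := by
          fun_prop
        have h0 : (0 : ℝ) < (fun ε : ℝ => bary hy k (mid x i) +
            ε * (bary hy k (x i) - bary hy k (mid x i))) 0 := by
          simp [hy1 k hk]
        have := hc.eventually (lt_mem_nhds h0)
        filter_upwards [nhdsWithin_le_nhds this] with ε hε
        rw [affineMap_add_smul_sub]
        exact hε.le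
    filter_upwards [Filter.eventually_all.2 this] with ε hε
    exact (mem_hull_iff hy).2 hε
  have hev2 : ∀ᶠ ε : ℝ in nhdsWithin 0 (Ioi 0), ε < 1 :=
    nhdsWithin_le_nhds (Iio_mem_nhds one_pos)
  obtain ⟨ε, hε1, hε2, hε3⟩ := (hev.and (hev2.and self_mem_nhdsWithin)).exists
  have hε3 : (0 : ℝ) < ε := hε3
  refine Set.disjoint_left.1 hd ?_ hε1
  rw [mem_interior_hull_iff hx]
  intro k
  rw [affineMap_add_smul_sub, affineMap_mid]
  rcases fin3_cases i k with rfl | rfl | rfl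
  · simp [bary_vertex_of_ne hx (fin3_ne_add_one k), bary_vertex_of_ne hx (fin3_ne_add_two k), hε3]
  · simp [bary_vertex_of_ne hx (fin3_add_one_ne_add_two i),
      bary_vertex_of_ne hx (fin3_ne_add_one i).symm]
    linarith
  · simp [bary_vertex_of_ne hx (fin3_add_one_ne_add_two i).symm,
      bary_vertex_of_ne hx (fin3_ne_add_two i).symm]
    linarith

include hx hy in
/-- An edge cannot belong to three triangles with disjoint interiors. -/
theorem not_three_of_side_eq {z : Fin 3 → Plane} (hz : AffineIndependent ℝ z)
    (hxy : Disjoint (interior (hull x)) (hull y)) (hxz : Disjoint (interior (hull x)) (hull z))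
    (hyz : Disjoint (interior (hull y)) (hull z)) {i j k : Fin 3}
    (h₁ : side x i = side y j) (h₂ : side x i = side z k) : False := by
  have a := bary_opposite_neg hx hy hxy h₁
  have b := bary_opposite_neg hx hz hxz h₂
  have h₃ : side y j = side z k := h₁.symm.trans h₂
  have c := bary_opposite_neg hy hz hyz h₃
  have hzr : bary hz k (y (j + 1)) = 0 ∧ bary hz k (y (j + 2)) = 0 := by
    unfold side at h₃
    rcases Sym2.eq_iff.1 h₃ with ⟨h1, h2⟩ | ⟨h1, h2⟩ <;> rw [h1, h2] <;>
    simp [bary_vertex_of_ne hz (fin3_ne_add_one k), bary_vertex_of_ne hz (fin3_ne_add_two k)]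
  have := eq_mul_bary hy hzr.1 hzr.2 (x i)
  nlinarith

/-- If two vertices of `x` are vertices of `y`, they span a common edge. -/
theorem exists_side_eq (hx : AffineIndependent ℝ x) {i : Fin 3} (h₁ : x (i + 1) ∈ Set.range y)
    (h₂ : x (i + 2) ∈ Set.range y) : ∃ j, side y j = side x i := by
  obtain ⟨a, ha⟩ := h₁
  obtain ⟨b, hb⟩ := h₂
  have hab : a ≠ b := by
    rintro rfl
    exact fin3_add_one_ne_add_two i (hx.injective (ha.symm.trans hb))
  have key : ∀ a b : Fin 3, a ≠ b → ∃ j, s(j + 1, j + 2) = s(a, b) := by decide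
  obtain ⟨j, hj⟩ := key a b hab
  refine ⟨j, ?_⟩
  have := congrArg (Sym2.map y) hj
  simpa [side, ha, hb] using this

theorem side_injective (hx : AffineIndependent ℝ x) {i j : Fin 3} (h : side x i = side x j) :
    i = j := by
  have h' : Sym2.map x s(i + 1, i + 2) = Sym2.map x s(j + 1, j + 2) := by simpa [side] using h
  have key : ∀ i j : Fin 3, s(i + 1, i + 2) = s(j + 1, j + 2) → i = j := by decide
  exact key i j (Sym2.map.injective hx.injective h')

end Triangle

/-! ### The coarse triangulation -/

/-- Points with a dual family of affine functions are affinely independent. -/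
theorem affineIndependent_of_dual {y : Fin 3 → Plane} (f : Fin 3 → Plane →ᵃ[ℝ] ℝ)
    (h : ∀ i j, f i (y j) = if i = j then 1 else 0) : AffineIndependent ℝ y := by
  rw [affineIndependent_iff]
  intro s w hw hwy i hi
  have hf : ∀ p, f i p = (f i).linear p + f i 0 := fun p => by
    have := (f i).map_vadd 0 p
    simpa using this
  have h1 : ∑ j ∈ s, w j * f i (y j) = 0 := by
    have h2 : (f i).linear (∑ j ∈ s, w j • y j) = 0 := by rw [hwy, map_zero]
    rw [map_sum] at h2
    simp only [map_smul, smul_eq_mul] at h2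
    calc ∑ j ∈ s, w j * f i (y j)
        = ∑ j ∈ s, (w j * (f i).linear (y j) + w j * f i 0) := by
          refine Finset.sum_congr rfl fun j _ => ?_
          rw [hf (y j)]; ring
      _ = 0 := by rw [Finset.sum_add_distrib, h2, ← Finset.sum_mul, hw]; ring
  simpa [h, hi] using h1

theorem bary_eq_of_dual {y : Fin 3 → Plane} (hy : AffineIndependent ℝ y)
    (f : Fin 3 → Plane →ᵃ[ℝ] ℝ) (h : ∀ i j, f i (y j) = if i = j then 1 else 0) (i : Fin 3) :
    bary hy i = f i :=
  affineMap_ext hy fun j => by rw [bary_vertex, h]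

namespace Triangulation

variable (S : Triangulation)

/-- The affine functions dual to the vertices of a coarse element. -/
noncomputable def splitDual (K : Fin S.card × Fin 3) : Fin 3 → Plane →ᵃ[ℝ] ℝ :=
  ![(3 : ℝ) • bary (S.affineIndependent K.1) K.2,
    bary (S.affineIndependent K.1) (K.2 + 1) - bary (S.affineIndependent K.1) K.2,
    bary (S.affineIndependent K.1) (K.2 + 2) - bary (S.affineIndependent K.1) K.2]

theorem bary_centroid {x : Fin 3 → Plane} (hx : AffineIndependent ℝ x) (i : Fin 3) :
    bary hx i ((3 : ℝ)⁻¹ • ∑ j, x j) = 3⁻¹ := by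
  have hf : ∀ p, bary hx i p = (bary hx i).linear p + bary hx i 0 := fun p => by
    have := (bary hx i).map_vadd 0 p
    simpa using this
  have hs : ∑ j, bary hx i (x j) = 1 := by simp [bary_vertex]
  rw [Finset.sum_congr rfl fun j _ => hf (x j), Finset.sum_add_distrib] at hs
  rw [hf, map_smul, map_sum, smul_eq_mul]
  simp at hs
  linarith

theorem splitDual_apply (K : Fin S.card × Fin 3) (i j : Fin 3) :
    S.splitDual K i (splitVertex S K j) = if i = j then 1 else 0 := by
  obtain ⟨T, k⟩ := K
  have h1 := bary_vertex_of_ne (S.affineIndependent T) (fin3_ne_add_one k)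
  have h2 := bary_vertex_of_ne (S.affineIndependent T) (fin3_ne_add_two k)
  have h3 := bary_vertex_of_ne (S.affineIndependent T) (fin3_add_one_ne_add_two k)
  have h4 := bary_vertex_of_ne (S.affineIndependent T) (fin3_add_one_ne_add_two k).symm
  have h0 : ∀ i, bary (S.affineIndependent T) i ((3 : ℝ)⁻¹ • ∑ j, S.vertex T j) = 3⁻¹ :=
    bary_centroid _
  fin_cases i <;> fin_cases j <;> simp [splitDual, splitVertex, h0, h1, h2, h3, h4]

theorem affineIndependent_splitVertex (K : Fin S.card × Fin 3) :
    AffineIndependent ℝ (splitVertex S K) :=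
  affineIndependent_of_dual _ (S.splitDual_apply K)

theorem bary_splitVertex (K : Fin S.card × Fin 3) (i : Fin 3) :
    bary (S.affineIndependent_splitVertex K) i = S.splitDual K i :=
  bary_eq_of_dual _ _ (S.splitDual_apply K) i

/-- Different triangles of a triangulation meet only in their boundaries. -/
theorem disjoint_interior_hull {τ σ : Fin S.card} (h : τ ≠ σ) :
    Disjoint (interior (hull (S.vertex τ))) (hull (S.vertex σ)) := by
  rw [Set.disjoint_left]
  intro p hp hq
  have hτ := S.affineIndependent τ
  obtain ⟨i, hi⟩ := exists_vertex_not_mem hτ (S.affineIndependent σ)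
    fun hr => h (S.injective τ σ hr)
  have hmem : p ∈ convexHull ℝ (Set.range (S.vertex τ) ∩ Set.range (S.vertex σ)) := by
    rw [← S.conforming]; exact ⟨interior_subset hp, hq⟩
  have h0 := bary_eq_zero_of_mem_convexHull hτ Set.inter_subset_left (fun hc => hi hc.2) hmem
  have := (mem_interior_hull_iff hτ).1 hp i
  linarith

theorem hull_splitVertex_subset (K : Fin S.card × Fin 3) :
    hull (splitVertex S K) ⊆ hull (S.vertex K.1) := by
  intro p hp
  have h := (mem_hull_iff (S.affineIndependent_splitVertex K)).1 hp
  simp only [bary_splitVertex] at h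
  rw [mem_hull_iff (S.affineIndependent K.1)]
  have h0 := h 0
  have h1 := h 1
  have h2 := h 2
  simp [splitDual] at h0 h1 h2
  intro i
  rcases fin3_cases K.2 i with rfl | rfl | rfl <;> linarith

/-- Different coarse elements meet only in their boundaries. -/
theorem disjoint_interior_split {K K' : Fin S.card × Fin 3} (h : K ≠ K') :
    Disjoint (interior (hull (splitVertex S K))) (hull (splitVertex S K')) := by
  by_cases hT : K.1 = K'.1
  · obtain ⟨T, k⟩ := K
    obtain ⟨T', k'⟩ := K'
    obtain rfl : T = T' := hT
    have hk : k' ≠ k := by rintro rfl; exact h rfl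
    rw [Set.disjoint_left]
    intro p hp hq
    rw [mem_interior_hull_iff (S.affineIndependent_splitVertex _)] at hp
    rw [mem_hull_iff (S.affineIndependent_splitVertex _)] at hq
    simp only [bary_splitVertex] at hp hq
    have a1 := hp 1
    have a2 := hp 2
    have b1 := hq 1
    have b2 := hq 2
    simp [splitDual] at a1 a2 b1 b2
    have ha : bary (S.affineIndependent T) k p < bary (S.affineIndependent T) k' p := by
      rcases fin3_cases k k' with rfl | rfl | rfl
      · exact absurd rfl hk
      · exact a1
      · exact a2
    have hb : bary (S.affineIndependent T) k' p ≤ bary (S.affineIndependent T) k p := by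
      rcases fin3_cases k' k with rfl | rfl | rfl
      · exact absurd rfl hk
      · exact b1
      · exact b2
    linarith
  · exact (S.disjoint_interior_hull hT).mono (interior_mono (S.hull_splitVertex_subset K))
      (S.hull_splitVertex_subset K')

end Triangulation

namespace Mesh

variable {M : Mesh}

/-! ### Incidence of fine elements, coarse elements and edges -/

theorem cellAff (M : Mesh) (K : M.Cell) : AffineIndependent ℝ (splitVertex M.init K) :=
  M.init.affineIndependent_splitVertex K

theorem elemAff (M : Mesh) (τ : M.Elem) : AffineIndependent ℝ (M.fine.vertex τ) :=
  M.fine.affineIndependent τ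

theorem mem_elems {K : M.Cell} {τ : M.Elem} : τ ∈ M.elems K ↔ M.tri τ ⊆ M.cell K := by
  simp [elems]

theorem disjoint_tri {τ σ : M.Elem} (h : τ ≠ σ) : Disjoint (interior (M.tri τ)) (M.tri σ) :=
  M.fine.disjoint_interior_hull h

theorem disjoint_cell {K K' : M.Cell} (h : K ≠ K') :
    Disjoint (interior (M.cell K)) (M.cell K') :=
  M.init.disjoint_interior_split h

theorem cell_subset_domain (K : M.Cell) : M.cell K ⊆ M.domain :=
  (M.init.hull_splitVertex_subset K).trans
    (Set.subset_iUnion (fun T => hull (M.init.vertex T)) K.1)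

theorem exists_mem_elems (τ : M.Elem) : ∃ K, τ ∈ M.elems K := by
  obtain ⟨K, hK⟩ := M.fine_subset τ
  exact ⟨K, mem_elems.2 hK⟩

theorem tri_subset_domain (τ : M.Elem) : M.tri τ ⊆ M.domain := by
  obtain ⟨K, hK⟩ := exists_mem_elems τ
  exact (mem_elems.1 hK).trans (cell_subset_domain K)

theorem tri_interior_nonempty (τ : M.Elem) : (interior (M.tri τ)).Nonempty :=
  interior_hull_nonempty (M.elemAff τ)

/-- A fine element belongs to a single coarse element. -/
theorem cell_unique {τ : M.Elem} {K K' : M.Cell} (h : τ ∈ M.elems K) (h' : τ ∈ M.elems K') :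
    K = K' := by
  by_contra hne
  obtain ⟨p, hp⟩ := tri_interior_nonempty τ
  exact Set.disjoint_left.1 (disjoint_cell hne) (interior_mono (mem_elems.1 h) hp)
    (mem_elems.1 h' (interior_subset hp))

/-- A fine element that meets the interior of a coarse element is contained in it. -/
theorem mem_elems_of_mem_interior {K : M.Cell} {τ : M.Elem} {p : Plane}
    (hp : p ∈ interior (M.cell K)) (hτ : p ∈ M.tri τ) : τ ∈ M.elems K := by
  obtain ⟨K', hK'⟩ := exists_mem_elems τ
  by_cases h : K = K'
  · rwa [h]
  · exact absurd (mem_elems.1 hK' hτ) (Set.disjoint_left.1 (disjoint_cell h) hp)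

theorem exists_tri_of_mem_interior {K : M.Cell} {p : Plane} (hp : p ∈ interior (M.cell K)) :
    ∃ τ ∈ M.elems K, p ∈ M.tri τ := by
  obtain ⟨τ, hτ⟩ := Set.mem_iUnion.1 (M.subset_fine K (interior_subset hp))
  exact ⟨τ, mem_elems_of_mem_interior hp hτ, hτ⟩

/-- The edges of the initial triangulation do not meet the interior of a coarse element. -/
theorem not_mem_interior_of_mem_initEdge {K : M.Cell} {p : Plane} {E : Sym2 Plane}
    (hE : E ∈ M.initEdges) (hp : p ∈ seg E) : p ∉ interior (M.cell K) := by
  intro hK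
  obtain ⟨T, i, rfl⟩ := hE
  have hpT := (mem_seg_side_iff (M.init.affineIndependent T)).1 hp
  have hKT := interior_mono (M.init.hull_splitVertex_subset K) hK
  by_cases h : K.1 = T
  · rw [h] at hKT
    have := (mem_interior_hull_iff (M.init.affineIndependent T)).1 hKT i
    linarith [hpT.2]
  · exact Set.disjoint_left.1 (M.init.disjoint_interior_hull h) hKT hpT.1

theorem bary_mid_of_ne {x : Fin 3 → Plane} (hx : AffineIndependent ℝ x) {i k : Fin 3}
    (hk : k ≠ i) : bary hx k (mid x i) = 1 / 2 := by
  rw [affineMap_mid]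
  rcases fin3_cases i k with rfl | rfl | rfl
  · exact absurd rfl hk
  · simp [bary_vertex_of_ne hx (fin3_add_one_ne_add_two i)]
  · simp [bary_vertex_of_ne hx (fin3_add_one_ne_add_two i).symm]

theorem bary_mid_self {x : Fin 3 → Plane} (hx : AffineIndependent ℝ x) (i : Fin 3) :
    bary hx i (mid x i) = 0 :=
  ((mem_seg_side_iff hx).1 (mid_mem_seg x i)).2

/-- If a triangle of a conforming triangulation contains the midpoint of an edge of another
one, it has this edge. -/
theorem exists_side_eq_of_mid_mem {σ τ : M.Elem} {i : Fin 3}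
    (h : mid (M.fine.vertex σ) i ∈ M.tri τ) : ∃ j, M.elemSide τ j = M.elemSide σ i := by
  have hmem : mid (M.fine.vertex σ) i ∈
      convexHull ℝ (Set.range (M.fine.vertex σ) ∩ Set.range (M.fine.vertex τ)) := by
    rw [← M.fine.conforming]
    exact ⟨seg_side_subset_hull _ i (mid_mem_seg _ i), h⟩
  have key : ∀ k, k ≠ i → M.fine.vertex σ k ∈ Set.range (M.fine.vertex τ) := by
    intro k hk
    by_contra hc
    have := bary_eq_zero_of_mem_convexHull (M.elemAff σ) Set.inter_subset_left
      (fun hc' => hc hc'.2) hmem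
    rw [bary_mid_of_ne (M.elemAff σ) hk] at this
    norm_num at this
  exact exists_side_eq (M.elemAff σ) (key _ (fin3_ne_add_one i).symm)
    (key _ (fin3_ne_add_two i).symm)

/-- If the direction `ν` points from the midpoint of a fine edge into the interior of a coarse
element `K`, then this edge belongs to a fine element in `K` that contains points in this
direction. -/
theorem exists_elem_in_direction {K : M.Cell} {σ : M.Elem} {i : Fin 3} {ν : Plane}
    (h : ∀ᶠ ε : ℝ in nhdsWithin 0 (Ioi 0),
      mid (M.fine.vertex σ) i + ε • ν ∈ interior (M.cell K)) :
    ∃ τ ∈ M.elems K, (∃ j, M.elemSide τ j = M.elemSide σ i) ∧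
      ∃ ε : ℝ, 0 < ε ∧ mid (M.fine.vertex σ) i + ε • ν ∈ M.tri τ := by
  set m := mid (M.fine.vertex σ) i
  -- as there are finitely many fine elements, one of them contains such points arbitrarily close
  -- to the midpoint
  have hex : ∃ τ : M.Elem, ∃ᶠ ε : ℝ in nhdsWithin 0 (Ioi 0),
      m + ε • ν ∈ interior (M.cell K) ∧ m + ε • ν ∈ M.tri τ ∧ 0 < ε := by
    by_contra! hc
    have hall : ∀ᶠ ε : ℝ in nhdsWithin 0 (Ioi 0), ∀ τ : M.Elem,
        ¬ (m + ε • ν ∈ interior (M.cell K) ∧ m + ε • ν ∈ M.tri τ ∧ 0 < ε) :=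
      Filter.eventually_all.2 fun τ => by simpa using hc τ
    obtain ⟨ε, h1, h2, h3⟩ := (h.and (hall.and self_mem_nhdsWithin)).exists
    obtain ⟨τ, -, hτ⟩ := exists_tri_of_mem_interior h1
    exact h2 τ ⟨h1, hτ, h3⟩
  obtain ⟨τ, hτ⟩ := hex
  obtain ⟨ε, h1, h2, h3⟩ := hτ.exists
  have hm : m ∈ M.tri τ := by
    have ht : Filter.Tendsto (fun ε : ℝ => m + ε • ν) (nhdsWithin 0 (Ioi 0)) (nhds m) := by
      have : ContinuousAt (fun ε : ℝ => m + ε • ν) 0 := by fun_prop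
      have h0 := this.tendsto
      simp only [zero_smul, add_zero] at h0
      exact h0.mono_left nhdsWithin_le_nhds
    exact (isClosed_hull _).mem_of_frequently_of_tendsto (hτ.mono fun _ hx => hx.2.1) ht
  exact ⟨τ, mem_elems_of_mem_interior h1 h2, exists_side_eq_of_mid_mem hm, ε, h3, h2⟩

/-- A fine edge lies on an edge of `K` if it is in `K` and the corresponding barycentric coordinate
of `K` vanishes at its endpoints. -/
theorem seg_subset_cellSide_iff {K : M.Cell} {k : Fin 3} {σ : M.Elem} {i : Fin 3} :
    seg (M.elemSide σ i) ⊆ seg (M.cellSide K k) ↔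
      seg (M.elemSide σ i) ⊆ M.cell K ∧
        bary (M.cellAff K) k (M.fine.vertex σ (i + 1)) = 0 ∧
        bary (M.cellAff K) k (M.fine.vertex σ (i + 2)) = 0 := by
  constructor
  · intro h
    have h1 : M.fine.vertex σ (i + 1) ∈ seg (M.elemSide σ i) := by
      rw [elemSide, seg_side]; exact left_mem_segment _ _ _
    have h2 : M.fine.vertex σ (i + 2) ∈ seg (M.elemSide σ i) := by
      rw [elemSide, seg_side]; exact right_mem_segment _ _ _
    exact ⟨h.trans (seg_side_subset_hull _ k),
      ((mem_seg_side_iff (M.cellAff K)).1 (h h1)).2, ((mem_seg_side_iff (M.cellAff K)).1 (h h2)).2⟩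
  · rintro ⟨h, h1, h2⟩ p hp
    refine (mem_seg_side_iff (M.cellAff K)).2 ⟨h hp, ?_⟩
    rw [elemSide, seg_side, segment_eq_image_lineMap] at hp
    obtain ⟨s, -, rfl⟩ := hp
    rw [AffineMap.apply_lineMap, h1, h2]
    simp

theorem mem_sidesOn {K : M.Cell} {E : Sym2 Plane} {τi : M.Elem × Fin 3} :
    τi ∈ M.sidesOn K E ↔ τi.1 ∈ M.elems K ∧ seg (M.elemSide τi.1 τi.2) ⊆ seg E := by
  simp [sidesOn]

theorem vertex_mem_cell {K : M.Cell} {τ : M.Elem} (h : τ ∈ M.elems K) (i : Fin 3) :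
    M.fine.vertex τ i ∈ M.cell K :=
  mem_elems.1 h (vertex_mem_hull _ i)

/-- An edge of a fine element of `K` lies on an edge of `K`, or its midpoint is in the interior
of `K` and it is shared by another fine element of `K`. -/
theorem side_dichotomy {K : M.Cell} {τ : M.Elem} (hτ : τ ∈ M.elems K) (i : Fin 3) :
    (∃ k, (τ, i) ∈ M.sidesOn K (M.cellSide K k)) ∨
      (mid (M.fine.vertex τ) i ∈ interior (M.cell K) ∧
        ∃ σ ∈ M.elems K, σ ≠ τ ∧ ∃ j, M.elemSide σ j = M.elemSide τ i) := by
  have hsub : seg (M.elemSide τ i) ⊆ M.cell K :=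
    (seg_side_subset_hull _ i).trans (mem_elems.1 hτ)
  by_cases hm : mid (M.fine.vertex τ) i ∈ interior (M.cell K)
  · right
    refine ⟨hm, ?_⟩
    set m := mid (M.fine.vertex τ) i
    have hev : ∀ᶠ ε : ℝ in nhdsWithin 0 (Ioi 0),
        m + ε • (m - M.fine.vertex τ i) ∈ interior (M.cell K) := by
      have hc : ContinuousAt (fun ε : ℝ => m + ε • (m - M.fine.vertex τ i)) 0 := by fun_prop
      have h0 : (fun ε : ℝ => m + ε • (m - M.fine.vertex τ i)) 0 ∈ interior (M.cell K) := by
        simpa using hm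
      exact nhdsWithin_le_nhds (hc.preimage_mem_nhds (isOpen_interior.mem_nhds h0))
    obtain ⟨σ, hσ, hj, ε, hε, hmem⟩ := exists_elem_in_direction hev
    refine ⟨σ, hσ, ?_, hj⟩
    -- the direction points out of `τ`
    rintro rfl
    have h1 := bary_nonneg (M.elemAff σ) (i := i) hmem
    have h2 : m + ε • (m - M.fine.vertex σ i) = m + (-ε) • (M.fine.vertex σ i - m) := by
      rw [neg_smul, ← smul_neg, neg_sub]
    rw [h2, affineMap_add_smul_sub, bary_mid_self, bary_vertex_self] at h1
    linarith
  · left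
    rw [cell, mem_interior_hull_iff (M.cellAff K)] at hm
    push Not at hm
    obtain ⟨k, hk⟩ := hm
    refine ⟨k, mem_sidesOn.2 ⟨hτ, seg_subset_cellSide_iff.2 ⟨hsub, ?_⟩⟩⟩
    have h1 := bary_nonneg (M.cellAff K) (i := k) (vertex_mem_cell hτ (i + 1))
    have h2 := bary_nonneg (M.cellAff K) (i := k) (vertex_mem_cell hτ (i + 2))
    rw [affineMap_mid] at hk
    constructor <;> linarith

/-- An edge of a fine element of `K` that lies on an edge of `K` is not shared by another fine
element of `K`. -/
theorem not_shared_of_mem_sidesOn {K : M.Cell} {k : Fin 3} {τ σ : M.Elem} {i j : Fin 3}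
    (h : (τ, i) ∈ M.sidesOn K (M.cellSide K k)) (hσ : σ ∈ M.elems K)
    (he : M.elemSide τ i = M.elemSide σ j) : τ = σ := by
  by_contra hne
  obtain ⟨hτ, hs⟩ := mem_sidesOn.1 h
  obtain ⟨-, h1, h2⟩ := seg_subset_cellSide_iff.1 hs
  have hf := eq_mul_bary (M.elemAff τ) h1 h2
  have a := bary_nonneg (M.cellAff K) (i := k) (vertex_mem_cell hτ i)
  have b := bary_nonneg (M.cellAff K) (i := k) (vertex_mem_cell hσ j)
  have c := bary_opposite_neg (M.elemAff σ) (M.elemAff τ) (disjoint_tri (Ne.symm hne)) he.symm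
  have hpos : bary (M.cellAff K) k (M.fine.vertex τ i) = 0 := by
    have := hf (M.fine.vertex σ j)
    by_contra h0
    have : 0 < bary (M.cellAff K) k (M.fine.vertex τ i) := lt_of_le_of_ne a (Ne.symm h0)
    nlinarith
  have := hf (splitVertex M.init K k)
  rw [hpos, bary_vertex_self] at this
  simp at this

/-- A fine edge lies on at most one edge of a coarse element. -/
theorem sidesOn_unique {K : M.Cell} {k l : Fin 3} {τi : M.Elem × Fin 3}
    (h : τi ∈ M.sidesOn K (M.cellSide K k)) (h' : τi ∈ M.sidesOn K (M.cellSide K l)) : k = l := by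
  by_contra hne
  obtain ⟨-, h1, h2⟩ := seg_subset_cellSide_iff.1 (mem_sidesOn.1 h).2
  obtain ⟨-, h3, h4⟩ := seg_subset_cellSide_iff.1 (mem_sidesOn.1 h').2
  have key : ∀ p q : Plane, bary (M.cellAff K) k p = 0 → bary (M.cellAff K) k q = 0 →
      bary (M.cellAff K) l p = 0 → bary (M.cellAff K) l q = 0 → p = q := by
    intro p q a b c d
    have hp := sum_bary (M.cellAff K) p
    have hq := sum_bary (M.cellAff K) q
    rw [Fin.sum_univ_three] at hp hq
    refine eq_of_bary_eq (M.cellAff K) fun i => ?_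
    fin_cases k <;> fin_cases l <;> fin_cases i <;> simp_all
  have := key _ _ h1 h2 h3 h4
  exact fin3_add_one_ne_add_two _ ((M.elemAff τi.1).injective this)

/-- Every fine edge on an edge of `K` is an edge of a fine element of `K`. -/
theorem exists_mem_sidesOn {K : M.Cell} {k : Fin 3} {σ : M.Elem} {i : Fin 3}
    (h : seg (M.elemSide σ i) ⊆ seg (M.cellSide K k)) :
    ∃ τj ∈ M.sidesOn K (M.cellSide K k), M.elemSide τj.1 τj.2 = M.elemSide σ i := by
  set m := mid (M.fine.vertex σ) i
  -- the direction from the midpoint to an interior point of `K`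
  have hm : m ∈ M.cell K := (seg_subset_cellSide_iff.1 h).1 (mid_mem_seg _ i)
  obtain ⟨c, hc⟩ : (interior (M.cell K)).Nonempty := interior_hull_nonempty (M.cellAff K)
  have hev : ∀ᶠ ε : ℝ in nhdsWithin 0 (Ioi 0), m + ε • (c - m) ∈ interior (M.cell K) := by
    have h1 : ∀ᶠ ε : ℝ in nhdsWithin 0 (Ioi 0), ε < 1 :=
      nhdsWithin_le_nhds (Iio_mem_nhds one_pos)
    filter_upwards [h1, self_mem_nhdsWithin] with ε hε1 hε0
    have hε0 : (0 : ℝ) < ε := hε0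
    rw [cell, mem_interior_hull_iff (M.cellAff K)] at hc ⊢
    intro l
    have a := hc l
    have b := bary_nonneg (M.cellAff K) (i := l) hm
    rw [affineMap_add_smul_sub]
    nlinarith
  obtain ⟨τ, hτ, ⟨j, hj⟩, -⟩ := exists_elem_in_direction hev
  exact ⟨(τ, j), mem_sidesOn.2 ⟨hτ, by rw [hj]; exact h⟩, hj⟩

theorem elemSide_injOn_sidesOn {K : M.Cell} {k : Fin 3} {τi σj : M.Elem × Fin 3}
    (h : τi ∈ M.sidesOn K (M.cellSide K k)) (h' : σj ∈ M.sidesOn K (M.cellSide K k))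
    (he : M.elemSide τi.1 τi.2 = M.elemSide σj.1 σj.2) : τi = σj := by
  obtain ⟨τ, i⟩ := τi
  obtain ⟨σ, j⟩ := σj
  obtain rfl := not_shared_of_mem_sidesOn h (mem_sidesOn.1 h').1 he
  have hij : i = j := side_injective (M.elemAff τ) he
  rw [hij]

/-- Sums over the fine sides on an edge of `K`, seen from `K`, are sums over the fine edges. -/
theorem sum_sidesOn {K : M.Cell} {k : Fin 3} (g : Sym2 Plane → ℝ) :
    ∑ τi ∈ M.sidesOn K (M.cellSide K k), g (M.elemSide τi.1 τi.2) =
      ∑ e ∈ M.fineEdges (M.cellSide K k), g e := by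
  classical
  refine Finset.sum_bij (fun τi _ => M.elemSide τi.1 τi.2) ?_ ?_ ?_ fun _ _ => rfl
  · intro τi h
    simp only [fineEdges, Finset.mem_filter, Finset.mem_image, Finset.mem_univ, true_and]
    exact ⟨⟨τi, rfl⟩, (mem_sidesOn.1 h).2⟩
  · intro a ha b hb h
    exact elemSide_injOn_sidesOn ha hb h
  · intro e he
    simp only [fineEdges, Finset.mem_filter, Finset.mem_image, Finset.mem_univ, true_and] at he
    obtain ⟨⟨σi, rfl⟩, he⟩ := he
    obtain ⟨τj, h1, h2⟩ := exists_mem_sidesOn he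
    exact ⟨τj, h1, h2⟩

/-- A fine edge belongs to at most two fine elements. -/
theorem elem_unique_of_shared {τ σ σ' : M.Elem} {i j j' : Fin 3} (h : τ ≠ σ) (h' : τ ≠ σ')
    (he : M.elemSide τ i = M.elemSide σ j) (he' : M.elemSide τ i = M.elemSide σ' j') :
    σ = σ' := by
  by_contra hne
  exact not_three_of_side_eq (M.elemAff τ) (M.elemAff σ) (M.elemAff σ') (disjoint_tri h)
    (disjoint_tri h') (disjoint_tri hne) he he'

theorem mem_patch {K : M.Cell} {E : Sym2 Plane} : K ∈ M.patch E ↔ ∃ i, M.cellSide K i = E := by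
  simp [patch]

/-- A coarse edge belongs to at most two coarse elements. -/
theorem card_patch_le (E : Sym2 Plane) : (M.patch E).card ≤ 2 := by
  by_contra! hc
  obtain ⟨a, ha, b, hb, c, hc, hab, hac, hbc⟩ := Finset.two_lt_card.1 hc
  obtain ⟨i, hi⟩ := mem_patch.1 ha
  obtain ⟨j, hj⟩ := mem_patch.1 hb
  obtain ⟨k, hk⟩ := mem_patch.1 hc
  exact not_three_of_side_eq (M.cellAff a) (M.cellAff b) (M.cellAff c) (disjoint_cell hab)
    (disjoint_cell hac) (disjoint_cell hbc) (hi.trans hj.symm) (hi.trans hk.symm)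

theorem cellSide_mem_coarseEdges (K : M.Cell) (k : Fin 3) : M.cellSide K k ∈ M.coarseEdges := by
  simp only [coarseEdges, Finset.mem_image, Finset.mem_univ, true_and]
  exact ⟨(K, k), rfl⟩

/-- An edge shared by two fine elements of a coarse element is not on an initial edge. -/
theorem not_onInit_of_shared {K : M.Cell} {τ σ : M.Elem} {i j : Fin 3} (hτ : τ ∈ M.elems K)
    (hσ : σ ∈ M.elems K) (hne : τ ≠ σ) (he : M.elemSide τ i = M.elemSide σ j) :
    ¬ M.OnInit (M.elemSide τ i) := by
  rintro ⟨E, hE, hs⟩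
  rcases side_dichotomy hτ i with ⟨k, hk⟩ | ⟨hm, -⟩
  · exact hne (not_shared_of_mem_sidesOn hk hσ he)
  · exact not_mem_interior_of_mem_initEdge hE (hs (mid_mem_seg _ i)) hm

theorem mem_initEdges_of_interior {E : Sym2 Plane} (h : E ∈ M.initInteriorEdges) :
    E ∈ M.initEdges := by
  obtain ⟨T, T', i, i', -, h, -⟩ := h
  exact ⟨T, i, h⟩

/-- An edge, on an initial edge, of a fine element of `K` lies on the boundary of `K`. -/
theorem exists_mem_sidesOn_of_onInit {K : M.Cell} {τ : M.Elem} {i : Fin 3} (hτ : τ ∈ M.elems K)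
    (h : M.OnInit (M.elemSide τ i)) : ∃ k, (τ, i) ∈ M.sidesOn K (M.cellSide K k) := by
  rcases side_dichotomy hτ i with hk | ⟨hm, -⟩
  · exact hk
  · obtain ⟨E, hE, hs⟩ := h
    exact absurd hm (not_mem_interior_of_mem_initEdge hE (hs (mid_mem_seg _ i)))

end Mesh

/-! ### Area, lengths and normals of a triangle -/

theorem inner_plane (u w : Plane) : ⟪u, w⟫ = u 0 * w 0 + u 1 * w 1 := by
  simp [PiLp.inner_apply, Fin.sum_univ_two, mul_comm]

/-- Twice the signed area of a triangle. -/
noncomputable def signedArea (x : Fin 3 → Plane) : ℝ := ⟪rot (x 2 - x 1), x 0 - x 1⟫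

theorem inner_rot_side (x : Fin 3 → Plane) (i : Fin 3) :
    ⟪rot (x (i + 2) - x (i + 1)), x i - x (i + 1)⟫ = signedArea x := by
  fin_cases i <;> simp [signedArea, inner_plane, rot] <;> ring

theorem inner_rot_self (d : Plane) : ⟪rot d, d⟫ = 0 := by simp [inner_plane, rot]; ring

theorem norm_rot (d : Plane) : ‖rot d‖ = ‖d‖ := by
  rw [← sq_eq_sq₀ (norm_nonneg _) (norm_nonneg _), ← real_inner_self_eq_norm_sq,
    ← real_inner_self_eq_norm_sq, inner_plane, inner_plane]
  simp [rot]; ring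

/-- The affine function `p ↦ ⟪ν, p - a⟫`. -/
noncomputable def innerSub (ν a : Plane) : Plane →ᵃ[ℝ] ℝ :=
  (innerSL ℝ ν).toLinearMap.toAffineMap - AffineMap.const ℝ Plane ⟪ν, a⟫

@[simp] theorem innerSub_apply (ν a p : Plane) : innerSub ν a p = ⟪ν, p - a⟫ := by
  simp [innerSub, inner_sub_right]

theorem edgeLength_side (x : Fin 3 → Plane) (i : Fin 3) :
    edgeLength (side x i) = ‖x (i + 2) - x (i + 1)‖ := by
  simp [edgeLength, side, dist_eq_norm, norm_sub_rev]

section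

variable {x y : Fin 3 → Plane} (hx : AffineIndependent ℝ x) (hy : AffineIndependent ℝ y)

include hx in
theorem edgeLength_side_pos (i : Fin 3) : 0 < edgeLength (side x i) := by
  rw [edgeLength_side, norm_pos_iff, sub_ne_zero]
  exact fun h => fin3_add_one_ne_add_two i (hx.injective h.symm)

include hx in
theorem signedArea_ne_zero : signedArea x ≠ 0 := by
  intro h0
  have h : ∀ p, innerSub (rot (x 2 - x 1)) (x 1) p = 0 := by
    have : innerSub (rot (x 2 - x 1)) (x 1) = 0 := by
      refine affineMap_ext hx fun j => ?_
      fin_cases j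
      · simpa [signedArea] using h0
      · simp
      · simpa using inner_rot_self (x 2 - x 1)
    intro p; rw [this]; rfl
  have h1 := h (rot (x 2 - x 1) + x 1)
  rw [innerSub_apply, add_sub_cancel_right, real_inner_self_eq_norm_sq, norm_rot] at h1
  have h2 : x 2 - x 1 = 0 := by simpa using h1
  have := hx.injective (sub_eq_zero.1 h2)
  exact absurd this (by decide)

/-- The height of a triangle over the edge opposite to the vertex `i`. -/
noncomputable def height (x : Fin 3 → Plane) (i : Fin 3) : ℝ :=
  |signedArea x| / edgeLength (side x i)

include hx in
theorem height_pos (i : Fin 3) : 0 < height x i :=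
  div_pos (abs_pos.2 (signedArea_ne_zero hx)) (edgeLength_side_pos hx i)

include hx in
theorem edgeLength_mul_height (i : Fin 3) : edgeLength (side x i) * height x i = |signedArea x| :=
  mul_div_cancel₀ _ (edgeLength_side_pos hx i).ne'

theorem outerNormal_eq (x : Fin 3 → Plane) (i : Fin 3) :
    outerNormal x i = (-(SignType.sign (signedArea x) : ℝ) / edgeLength (side x i)) •
      rot (x (i + 2) - x (i + 1)) := by
  rw [outerNormal, inner_rot_side, edgeLength_side]

/-- The signed distance to an edge is a multiple of the barycentric coordinate. -/
theorem inner_outerNormal (i : Fin 3) (p : Plane) :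
    ⟪outerNormal x i, p - x (i + 1)⟫ = -height x i * bary hx i p := by
  have h1 : innerSub (outerNormal x i) (x (i + 1)) (x (i + 1)) = 0 := by simp
  have h2 : innerSub (outerNormal x i) (x (i + 1)) (x (i + 2)) = 0 := by
    rw [innerSub_apply, outerNormal_eq, inner_smul_left, inner_rot_self, mul_zero]
  have := eq_mul_bary hx h1 h2 p
  rw [innerSub_apply] at this
  rw [this, innerSub_apply, outerNormal_eq, inner_smul_left, inner_rot_side, height,
    ← sign_mul_self (signedArea x)]
  simp only [conj_trivial]
  ring

theorem inner_outerNormal_sub (i : Fin 3) (p q : Plane) :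
    ⟪p - q, outerNormal x i⟫ = height x i * (bary hx i q - bary hx i p) := by
  have : p - q = (p - x (i + 1)) - (q - x (i + 1)) := by abel
  rw [this, inner_sub_left, real_inner_comm, inner_outerNormal hx, real_inner_comm,
    inner_outerNormal hx]
  ring

include hx in
theorem norm_outerNormal (i : Fin 3) : ‖outerNormal x i‖ = 1 := by
  have h := edgeLength_side_pos hx i
  rw [outerNormal_eq, norm_smul, norm_rot, ← edgeLength_side, norm_div, Real.norm_of_nonneg h.le,
    div_mul_cancel₀ _ h.ne', norm_neg, Real.norm_eq_abs]
  rcases lt_or_gt_of_ne (signedArea_ne_zero hx) with h | h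
  · rw [sign_neg h]; simp
  · rw [sign_pos h]; simp

/-- Two unit vectors orthogonal to the same nonzero vector of the plane agree up to the sign. -/
theorem eq_or_eq_neg_of_orthogonal {ν m d : Plane} (hd : d ≠ 0) (hν : ‖ν‖ = 1) (hm : ‖m‖ = 1)
    (h₁ : ⟪ν, d⟫ = 0) (h₂ : ⟪m, d⟫ = 0) : m = ν ∨ m = -ν := by
  have hν2 : ν 0 * ν 0 + ν 1 * ν 1 = 1 := by
    rw [← inner_plane, real_inner_self_eq_norm_sq, hν]; norm_num
  have hm2 : m 0 * m 0 + m 1 * m 1 = 1 := by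
    rw [← inner_plane, real_inner_self_eq_norm_sq, hm]; norm_num
  rw [inner_plane] at h₁ h₂
  have hcr : ν 0 * m 1 - ν 1 * m 0 = 0 := by
    by_contra hne
    apply hd
    have a : d 0 * (ν 0 * m 1 - ν 1 * m 0) = 0 := by linear_combination m 1 * h₁ - ν 1 * h₂
    have b : d 1 * (ν 0 * m 1 - ν 1 * m 0) = 0 := by linear_combination ν 0 * h₂ - m 0 * h₁
    ext i
    fin_cases i
    · simpa [hne] using a
    · simpa [hne] using b
  have hsq : (⟪m, ν⟫ - 1) * (⟪m, ν⟫ + 1) = 0 := by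
    rw [inner_plane]
    linear_combination (m 0 * m 0 + m 1 * m 1) * hν2 + hm2 - (ν 0 * m 1 - ν 1 * m 0) * hcr
  rcases mul_eq_zero.1 hsq with h | h
  · left
    exact (inner_eq_one_iff_of_norm_eq_one (𝕜 := ℝ) hm hν).1 (by linarith)
  · right
    refine (inner_eq_one_iff_of_norm_eq_one (𝕜 := ℝ) hm (by rw [norm_neg, hν])).1 ?_
    rw [inner_neg_right]; linarith

include hx in
theorem outerNormal_eq_or_neg (i : Fin 3) {ν : Plane} (hν : ‖ν‖ = 1)
    (h : ⟪ν, x (i + 2) - x (i + 1)⟫ = 0) : outerNormal x i = ν ∨ outerNormal x i = -ν := by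
  refine eq_or_eq_neg_of_orthogonal (d := x (i + 2) - x (i + 1)) ?_ hν (norm_outerNormal hx i) h ?_
  · have := edgeLength_side_pos hx i
    rwa [edgeLength_side, norm_pos_iff] at this
  · rw [inner_outerNormal hx, bary_vertex_of_ne hx (fin3_ne_add_two i), mul_zero]

include hx in
/-- The outer normal is the unit normal that has a negative product with the inward direction. -/
theorem outerNormal_eq_of_inner_neg (i : Fin 3) {ν : Plane} (hν : ‖ν‖ = 1)
    (h : ⟪ν, x (i + 2) - x (i + 1)⟫ = 0) (hneg : ⟪ν, x i - x (i + 1)⟫ < 0) :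
    outerNormal x i = ν := by
  rcases outerNormal_eq_or_neg hx i hν h with h' | h'
  · exact h'
  · exfalso
    have h1 := inner_outerNormal hx i (x i)
    have h2 := height_pos hx i
    rw [h', inner_neg_left, bary_vertex_self] at h1
    linarith

include hx hy in
/-- Triangles with disjoint interiors have opposite outer normals on a common edge. -/
theorem outerNormal_eq_neg (hd : Disjoint (interior (hull y)) (hull x)) {i j : Fin 3}
    (h : side x i = side y j) : outerNormal y j = -outerNormal x i := by
  have hneg := bary_opposite_neg hy hx hd h.symm
  have hz : bary hx i (y (j + 1)) = 0 ∧ bary hx i (y (j + 2)) = 0 := by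
    unfold side at h
    rcases Sym2.eq_iff.1 h with ⟨h1, h2⟩ | ⟨h1, h2⟩ <;> rw [← h1, ← h2] <;>
    simp [bary_vertex_of_ne hx (fin3_ne_add_one i), bary_vertex_of_ne hx (fin3_ne_add_two i)]
  have hh := height_pos hx i
  refine outerNormal_eq_of_inner_neg hy j (by rw [norm_neg, norm_outerNormal hx]) ?_ ?_
  · rw [inner_neg_left, real_inner_comm, inner_outerNormal_sub hx, hz.1, hz.2]; simp
  · rw [inner_neg_left, real_inner_comm, inner_outerNormal_sub hx, hz.1]
    nlinarith

theorem edgeLength_mul_inner_outerNormal (hx : AffineIndependent ℝ x) (i : Fin 3) (u : Plane) :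
    edgeLength (side x i) * ⟪u, outerNormal x i⟫ =
      -(SignType.sign (signedArea x) : ℝ) * ⟪u, rot (x (i + 2) - x (i + 1))⟫ := by
  rw [outerNormal_eq, inner_smul_right]
  field_simp [(edgeLength_side_pos hx i).ne']

include hx in
/-- The divergence theorem for Raviart–Thomas fields on a triangle. -/
theorem sum_flux (c : Plane × ℝ) :
    ∑ i, edgeLength (side x i) * ⟪rt c (mid x i), outerNormal x i⟫ =
      rtDiv c * |signedArea x| / 2 := by
  simp only [edgeLength_mul_inner_outerNormal hx]
  rw [← Finset.mul_sum, ← sign_mul_self (signedArea x)]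
  have : ∑ i, ⟪rt c (mid x i), rot (x (i + 2) - x (i + 1))⟫ = -(signedArea x * c.2) := by
    simp [Fin.sum_univ_three, signedArea, inner_plane, rot, rt, mid, midpoint_eq_smul_add]
    ring
  rw [this, rtDiv]
  ring

/-- The normal component of a Raviart–Thomas field is constant along an edge. -/
theorem inner_rt_const (hx : AffineIndependent ℝ x) (c : Plane × ℝ) {i : Fin 3} {p q : Plane}
    (hp : p ∈ seg (side x i)) (hq : q ∈ seg (side x i)) :
    ⟪rt c p, outerNormal x i⟫ = ⟪rt c q, outerNormal x i⟫ := by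
  have h : rt c p - rt c q = c.2 • (p - q) := by simp [rt, smul_sub]
  rw [← sub_eq_zero, ← inner_sub_left, h, inner_smul_left, inner_outerNormal_sub hx,
    ((mem_seg_side_iff hx).1 hp).2, ((mem_seg_side_iff hx).1 hq).2]
  simp

theorem sideIntegral_of_const {i : Fin 3} {g : Plane → ℝ} {c : ℝ}
    (h : ∀ p ∈ seg (side x i), g p = c) : sideIntegral x i g = edgeLength (side x i) * c := by
  have : ∫ s in (0 : ℝ)..1, g (AffineMap.lineMap (x (i + 1)) (x (i + 2)) s) =
      ∫ _ in (0 : ℝ)..1, c := by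
    refine intervalIntegral.integral_congr fun s hs => h _ ?_
    rw [seg_side, segment_eq_image_lineMap]
    rw [Set.uIcc_of_le zero_le_one] at hs
    exact ⟨s, hs, rfl⟩
  rw [sideIntegral, this]
  simp [edgeLength, side]

/-- The area of the reference triangle, whose `signedArea` is `±1`. Its value `1 / 2` is never
needed, only its positivity. -/
noncomputable def refArea : ℝ := volume.real (hull ![0, !₂[1, 0], !₂[0, 1]])

/-- Every triangle is an affine image of the reference triangle. -/
theorem volume_hull_eq (x : Fin 3 → Plane) :
    volume.real (hull x) = refArea * |signedArea x| := by
  let L : Plane →ₗ[ℝ] Plane :=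
    (EuclideanSpace.basisFun (Fin 2) ℝ).toBasis.constr ℝ ![x 1 - x 0, x 2 - x 0]
  have hL : ∀ p : Plane, L p = p 0 • (x 1 - x 0) + p 1 • (x 2 - x 0) := by
    intro p
    rw [Module.Basis.constr_apply_fintype]
    simp [Fin.sum_univ_two]
  have hdet : |LinearMap.det L| = |signedArea x| := by
    rw [← LinearMap.det_toMatrix (EuclideanSpace.basisFun (Fin 2) ℝ).toBasis, Matrix.det_fin_two]
    simp only [LinearMap.toMatrix_apply, hL]
    simp [signedArea, inner_plane, rot]
    congr 1
    ring
  have himg : hull x = (fun p => x 0 + p) '' (L '' hull ![0, !₂[1, 0], !₂[0, 1]]) := by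
    let f : Plane →ᵃ[ℝ] Plane := AffineMap.const ℝ Plane (x 0) + L.toAffineMap
    have h1 : f '' hull ![0, !₂[1, 0], !₂[0, 1]] =
        convexHull ℝ (f '' Set.range ![0, !₂[1, 0], !₂[0, 1]]) := f.image_convexHull _
    rw [Set.image_image]
    change _ = f '' _
    rw [h1, hull]
    congr 1
    ext q
    simp only [Set.mem_range, Set.mem_image, Fin.exists_fin_succ]
    simp [f, hL]
  rw [himg, image_add_left, Measure.real, measure_preimage_add,
    Measure.addHaar_image_linearMap, ENNReal.toReal_mul, hdet, refArea, mul_comm]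
  simp [Measure.real]

include hx in
theorem volume_hull_pos : 0 < volume.real (hull x) := by
  refine ENNReal.toReal_pos ?_ (isCompact_hull x).measure_lt_top.ne
  have := isOpen_interior.measure_pos (volume : Measure Plane) (interior_hull_nonempty hx)
  exact (this.trans_le (measure_mono interior_subset)).ne'

theorem refArea_pos : 0 < refArea := by
  have h : AffineIndependent ℝ (![0, !₂[1, 0], !₂[0, 1]] : Fin 3 → Plane) := by
    refine affineIndependent_of_dual ![innerSub (-!₂[1, 1]) (!₂[1, 0]),
      innerSub (!₂[1, 0]) 0, innerSub (!₂[0, 1]) 0] fun i j => ?_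
    fin_cases i <;> fin_cases j <;>
    simp [inner_plane, -inner_self_eq_norm_sq_to_K]
  exact volume_hull_pos h

end

namespace Mesh

variable {M : Mesh}

/-! ### The discrete divergence theorem -/

/-- The (constant) value of the outflow on an edge of a fine element. -/
noncomputable def flow (v : M.VField) (τi : M.Elem × Fin 3) : ℝ :=
  outflow v τi.1 τi.2 (mid (M.fine.vertex τi.1) τi.2)

theorem outflow_eq_flow (v : M.VField) {τ : M.Elem} {i : Fin 3} {x : Plane}
    (hx : x ∈ seg (M.elemSide τ i)) : outflow v τ i x = flow v (τ, i) :=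
  inner_rt_const (M.elemAff τ) _ hx (mid_mem_seg _ _)

/-- Continuity of the normal components in terms of the values of the outflow. -/
theorem isLocal_iff {K : M.Cell} {v : M.VField} : IsLocal K v ↔
    ∀ τ σ i j, τ ≠ σ → τ ∈ M.elems K → σ ∈ M.elems K → M.elemSide τ i = M.elemSide σ j →
      flow v (τ, i) + flow v (σ, j) = 0 := by
  constructor
  · intro h τ σ i j hne hτ hσ he
    have := h τ σ i j hne he ⟨hτ, hσ⟩ _ (mid_mem_seg _ _)
    rwa [outflow_eq_flow v (mid_mem_seg _ _), outflow_eq_flow v (by rw [← he]; exact mid_mem_seg _ _)]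
      at this
  · intro h τ σ i j hne he hK x hx
    rw [outflow_eq_flow v hx, outflow_eq_flow v (by rwa [← he])]
    exact h τ σ i j hne hK.1 hK.2 he

/-- A fine side of `K` that lies on the boundary of `K`. -/
def OnBoundary (K : M.Cell) (τi : M.Elem × Fin 3) : Prop :=
  ∃ k, τi ∈ M.sidesOn K (M.cellSide K k)

/-- The divergence theorem on a coarse element: the fluxes through the interior fine edges
cancel. -/
theorem discrete_divergence {K : M.Cell} {v : M.VField} (hv : IsLocal K v) :
    ∑ τ ∈ M.elems K, rtDiv (v τ) * |signedArea (M.fine.vertex τ)| / 2 =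
      ∑ k, ∑ τi ∈ M.sidesOn K (M.cellSide K k),
        edgeLength (M.elemSide τi.1 τi.2) * flow v τi := by
  classical
  set F : M.Elem × Fin 3 → ℝ := fun τi => edgeLength (M.elemSide τi.1 τi.2) * flow v τi with hF
  have h1 : ∑ τ ∈ M.elems K, rtDiv (v τ) * |signedArea (M.fine.vertex τ)| / 2 =
      ∑ τi ∈ M.elems K ×ˢ Finset.univ, F τi := by
    rw [Finset.sum_product]
    exact Finset.sum_congr rfl fun τ _ => (sum_flux (M.elemAff τ) (v τ)).symm
  rw [h1, ← Finset.sum_filter_add_sum_filter_not _ (OnBoundary K)]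
  have h2 : ∑ τi ∈ (M.elems K ×ˢ Finset.univ).filter fun τi => ¬ OnBoundary K τi, F τi = 0 := by
    -- the other fine element of `K` with the same edge provides an involution
    have hex : ∀ τi ∈ (M.elems K ×ˢ Finset.univ).filter fun τi => ¬ OnBoundary K τi,
        ∃ σj : M.Elem × Fin 3, σj.1 ∈ M.elems K ∧ σj.1 ≠ τi.1 ∧
          M.elemSide σj.1 σj.2 = M.elemSide τi.1 τi.2 := by
      rintro ⟨τ, i⟩ h
      simp only [Finset.mem_filter, Finset.mem_product, Finset.mem_univ, and_true] at h
      rcases side_dichotomy h.1 i with hk | ⟨-, σ, hσ, hne, j, hj⟩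
      · exact absurd hk h.2
      · exact ⟨(σ, j), hσ, hne, hj⟩
    choose! g hg using hex
    have hmem : ∀ τi ∈ (M.elems K ×ˢ Finset.univ).filter fun τi => ¬ OnBoundary K τi,
        g τi ∈ (M.elems K ×ˢ Finset.univ).filter fun τi => ¬ OnBoundary K τi := by
      intro τi h
      obtain ⟨a, b, c⟩ := hg τi h
      simp only [Finset.mem_filter, Finset.mem_product, Finset.mem_univ, and_true] at h ⊢
      refine ⟨a, ?_⟩
      rintro ⟨k, hk⟩
      exact b (not_shared_of_mem_sidesOn hk h.1 c)
    refine Finset.sum_involution (fun τi _ => g τi) ?_ ?_ hmem ?_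
    · intro τi h
      obtain ⟨a, b, c⟩ := hg τi h
      simp only [Finset.mem_filter, Finset.mem_product, Finset.mem_univ, and_true] at h
      have := isLocal_iff.1 hv _ _ _ _ b a h.1 c
      simp only [hF]
      rw [c, ← mul_add, add_comm, this, mul_zero]
    · intro τi h _ he
      exact (hg τi h).2.1 (by rw [he])
    · intro τi h
      obtain ⟨a, b, c⟩ := hg τi h
      obtain ⟨a', b', c'⟩ := hg _ (hmem τi h)
      have h3 : (g (g τi)).1 = τi.1 := elem_unique_of_shared b'.symm b c'.symm c
      have h4 := c'.trans c
      rw [h3] at h4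
      exact Prod.ext h3 (side_injective (M.elemAff τi.1) h4)
  rw [h2, add_zero]
  have h3 : (M.elems K ×ˢ Finset.univ).filter (OnBoundary K) =
      Finset.univ.biUnion fun k => M.sidesOn K (M.cellSide K k) := by
    ext τi
    simp only [Finset.mem_filter, Finset.mem_product, Finset.mem_univ, and_true,
      Finset.mem_biUnion, true_and]
    exact ⟨fun h => h.2, fun ⟨k, hk⟩ => ⟨(mem_sidesOn.1 hk).1, k, hk⟩⟩
  rw [h3, Finset.sum_biUnion]
  intro k _ l _ hkl
  exact Finset.disjoint_left.2 fun τi hk hl => hkl (sidesOn_unique hk hl)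

/-! ### Area and lengths under refinement -/

theorem volume_tri (τ : M.Elem) :
    volume.real (M.tri τ) = refArea * |signedArea (M.fine.vertex τ)| :=
  volume_hull_eq _

theorem volume_tri_pos (τ : M.Elem) : 0 < volume.real (M.tri τ) := volume_hull_pos (M.elemAff τ)

/-- The fine elements of a coarse element overlap, and leave out, only null sets. -/
theorem sum_volume_tri (K : M.Cell) :
    ∑ τ ∈ M.elems K, volume.real (M.tri τ) = volume.real (M.cell K) := by
  have hm : ∀ τ, MeasurableSet (M.tri τ) := fun τ => (isClosed_hull _).measurableSet
  have hfin : ∀ τ, volume (M.tri τ) ≠ ⊤ := fun τ => (isCompact_hull _).measure_lt_top.ne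
  have hnull : volume (M.cell K \ interior (M.cell K)) = 0 := by
    refine measure_mono_null ?_ ((convex_hull (splitVertex M.init K)).addHaar_frontier volume)
    exact Set.sdiff_subset_sdiff_left subset_closure
  have h1 : volume (⋃ τ ∈ M.elems K, M.tri τ) = ∑ τ ∈ M.elems K, volume (M.tri τ) := by
    refine measure_biUnion_finset₀ ?_ fun τ _ => (hm τ).nullMeasurableSet
    intro τ _ σ _ hne
    refine measure_mono_null ?_ ((convex_hull (M.fine.vertex τ)).addHaar_frontier volume)
    intro p hp
    exact ⟨subset_closure hp.1, fun hi => Set.disjoint_left.1 (disjoint_tri hne) hi hp.2⟩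
  have h2 : volume (⋃ τ ∈ M.elems K, M.tri τ) = volume (M.cell K) := by
    refine le_antisymm (measure_mono (Set.iUnion₂_subset fun τ hτ => mem_elems.1 hτ)) ?_
    calc volume (M.cell K)
        ≤ volume (interior (M.cell K) ∪ (M.cell K \ interior (M.cell K))) :=
          measure_mono (by rw [Set.union_sdiff_self]; exact Set.subset_union_right)
      _ ≤ volume (interior (M.cell K)) + volume (M.cell K \ interior (M.cell K)) :=
          measure_union_le _ _
      _ = volume (interior (M.cell K)) := by rw [hnull, add_zero]
      _ ≤ _ := measure_mono fun p hp => by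
          obtain ⟨τ, hτ, h⟩ := exists_tri_of_mem_interior hp
          exact Set.mem_biUnion hτ h
  rw [Measure.real, ← h2, h1, ENNReal.toReal_sum fun τ _ => hfin τ]
  rfl

theorem sum_signedArea (K : M.Cell) :
    ∑ τ ∈ M.elems K, |signedArea (M.fine.vertex τ)| = |signedArea (splitVertex M.init K)| := by
  have h := sum_volume_tri K
  rw [cell, volume_hull_eq, Finset.sum_congr rfl fun τ _ => volume_tri τ, ← Finset.mul_sum] at h
  exact mul_left_cancel₀ refArea_pos.ne' h

theorem outerNormal_of_mem_sidesOn {K : M.Cell} {k : Fin 3} {τi : M.Elem × Fin 3}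
    (h : τi ∈ M.sidesOn K (M.cellSide K k)) :
    outerNormal (M.fine.vertex τi.1) τi.2 = outerNormal (splitVertex M.init K) k := by
  obtain ⟨hτ, hs⟩ := mem_sidesOn.1 h
  obtain ⟨-, h1, h2⟩ := seg_subset_cellSide_iff.1 hs
  have hh := height_pos (M.cellAff K) k
  refine outerNormal_eq_of_inner_neg (M.elemAff τi.1) τi.2 (norm_outerNormal (M.cellAff K) k) ?_ ?_
  · rw [real_inner_comm, inner_outerNormal_sub (M.cellAff K), h1, h2]; simp
  · rw [real_inner_comm, inner_outerNormal_sub (M.cellAff K), h1]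
    have a := bary_nonneg (M.cellAff K) (i := k) (vertex_mem_cell hτ τi.2)
    have hne : bary (M.cellAff K) k (M.fine.vertex τi.1 τi.2) ≠ 0 := by
      intro h0
      have := eq_mul_bary (M.elemAff τi.1) h1 h2 (splitVertex M.init K k)
      rw [h0, bary_vertex_self] at this
      simp at this
    have : 0 < bary (M.cellAff K) k (M.fine.vertex τi.1 τi.2) := lt_of_le_of_ne a hne.symm
    nlinarith

/-- The fine edges on a coarse edge make up its length. The divergence theorem is applied to the
field `x - a`, where `a` is the opposite vertex of the coarse element. -/
theorem sum_edgeLength (K : M.Cell) (k : Fin 3) :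
    ∑ e ∈ M.fineEdges (M.cellSide K k), edgeLength e = edgeLength (M.cellSide K k) := by
  set y := splitVertex M.init K
  let w : M.VField := fun _ => (-y k, 1)
  have hrt : ∀ τ i x, outflow w τ i x = ⟪x - y k, outerNormal (M.fine.vertex τ) i⟫ :=
    fun τ i x => by rw [outflow]; congr 1; simp [w, rt]; abel
  have hloc : IsLocal K w := by
    intro τ σ i j hne he _ x _
    rw [hrt, hrt,
      outerNormal_eq_neg (M.elemAff τ) (M.elemAff σ) (disjoint_tri hne.symm) he, inner_neg_right]
    ring
  have hdiv := discrete_divergence hloc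
  have hL : ∑ τ ∈ M.elems K, rtDiv (w τ) * |signedArea (M.fine.vertex τ)| / 2 =
      |signedArea y| := by
    rw [← sum_signedArea]
    refine Finset.sum_congr rfl fun τ _ => ?_
    simp [rtDiv, w]
  have hflow : ∀ l, ∀ τi ∈ M.sidesOn K (M.cellSide K l),
      flow w τi = if l = k then height y k else 0 := by
    intro l τi h
    have hm := ((mem_seg_side_iff (M.cellAff K)).1 ((mem_sidesOn.1 h).2 (mid_mem_seg _ _))).2
    rw [flow, hrt, outerNormal_of_mem_sidesOn h, inner_outerNormal_sub (M.cellAff K), hm,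
      bary_vertex]
    split_ifs with hlk
    · rw [hlk]; simp [y]
    · simp
  rw [hL, Finset.sum_eq_single k] at hdiv
  · rw [Finset.sum_congr rfl fun τi h => by rw [hflow k τi h, if_pos rfl], ← Finset.sum_mul,
      ← edgeLength_mul_height (M.cellAff K) k, sum_sidesOn] at hdiv
    exact (mul_right_cancel₀ (height_pos (M.cellAff K) k).ne' hdiv).symm
  · intro l _ hl
    exact Finset.sum_eq_zero fun τi h => by rw [hflow l τi h, if_neg hl, mul_zero]
  · simp

/-! ### Connectedness of the fine mesh of a coarse element -/

theorem volume_line_eq_zero (p f : Plane) : volume (line[ℝ, p, f] : Set Plane) = 0 := by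
  refine Measure.addHaar_affineSubspace volume _ fun h => ?_
  have h1 := (collinear_iff_finrank_le_one (k := ℝ)).1 (collinear_pair ℝ p f)
  rw [← direction_affineSpan, h, AffineSubspace.direction_top, finrank_top] at h1
  simp at h1

/-- A piecewise constant function on a coarse element without jumps across the interior fine edges
is constant. A generic segment between two fine elements avoids the vertices of the fine mesh. -/
theorem eq_of_no_jumps {K : M.Cell} {p : M.QField}
    (h : ∀ τ ∈ M.elems K, ∀ σ ∈ M.elems K, ∀ i j, τ ≠ σ → M.elemSide τ i = M.elemSide σ j →
      p τ = p σ) {τ σ : M.Elem} (hτ : τ ∈ M.elems K) (hσ : σ ∈ M.elems K) : p τ = p σ := by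
  classical
  by_contra hne
  obtain ⟨a, ha⟩ := tri_interior_nonempty τ
  let V : Set Plane := ⋃ ρ : M.Elem, Set.range (M.fine.vertex ρ)
  have hV : V.Finite := Set.finite_iUnion fun ρ => Set.finite_range _
  have haV : a ∉ V := by
    intro hc
    obtain ⟨ρ, i, rfl⟩ := Set.mem_iUnion.1 hc
    by_cases hρ : τ = ρ
    · subst hρ
      have := (mem_interior_hull_iff (M.elemAff τ)).1 ha (i + 1)
      rw [bary_vertex_of_ne _ (fin3_ne_add_one i).symm] at this
      exact lt_irrefl _ this
    · exact Set.disjoint_left.1 (disjoint_tri hρ) ha (vertex_mem_hull _ i)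
  have hnull : volume (⋃ f ∈ V, (line[ℝ, a, f] : Set Plane)) = 0 :=
    (measure_biUnion_null_iff hV.countable).2 fun f _ => volume_line_eq_zero a f
  have hpos := isOpen_interior.measure_pos (volume : Measure Plane) (tri_interior_nonempty σ)
  obtain ⟨b, hb, hbV⟩ : ∃ b ∈ interior (M.tri σ), b ∉ ⋃ f ∈ V, (line[ℝ, a, f] : Set Plane) := by
    by_contra! hc
    exact hpos.ne' (measure_mono_null hc hnull)
  have hseg : ∀ z ∈ segment ℝ a b, z ∉ V := by
    intro z hz hzV
    refine hbV (Set.mem_biUnion hzV ?_)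
    have hza : z ≠ a := by rintro rfl; exact haV hzV
    rw [segment_eq_image_lineMap] at hz
    obtain ⟨s, -, rfl⟩ := hz
    have hs : s ≠ 0 := by rintro rfl; simp at hza
    have : b = AffineMap.lineMap a (AffineMap.lineMap a b s) s⁻¹ := by
      rw [AffineMap.lineMap_apply, AffineMap.lineMap_apply]
      simp [smul_smul, hs]
    have hmem := AffineMap.lineMap_mem_affineSpan_pair (k := ℝ) s⁻¹ a (AffineMap.lineMap a b s)
    rwa [← this] at hmem
  have hKint : segment ℝ a b ⊆ interior (M.cell K) :=
    (convex_hull (splitVertex M.init K)).interior.segment_subset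
      (interior_mono (mem_elems.1 hτ) ha) (interior_mono (mem_elems.1 hσ) hb)
  let U : Set Plane := ⋃ ρ ∈ (M.elems K).filter fun ρ => p ρ = p τ, M.tri ρ
  let W : Set Plane := ⋃ ρ ∈ (M.elems K).filter fun ρ => p ρ ≠ p τ, M.tri ρ
  have hU : IsClosed U := isClosed_biUnion_finset fun ρ _ => isClosed_hull _
  have hW : IsClosed W := isClosed_biUnion_finset fun ρ _ => isClosed_hull _
  obtain ⟨z, hz, hzU, hzW⟩ := isPreconnected_closed_iff.1 (convex_segment a b).isPreconnected U W
    hU hW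
    (fun z hz => by
      obtain ⟨ρ, hρ, hzρ⟩ := exists_tri_of_mem_interior (hKint hz)
      by_cases hpρ : p ρ = p τ
      · exact Or.inl (Set.mem_biUnion (Finset.mem_filter.2 ⟨hρ, hpρ⟩) hzρ)
      · exact Or.inr (Set.mem_biUnion (Finset.mem_filter.2 ⟨hρ, hpρ⟩) hzρ))
    ⟨a, left_mem_segment _ _ _, Set.mem_biUnion (Finset.mem_filter.2 ⟨hτ, rfl⟩)
      (interior_subset ha)⟩
    ⟨b, right_mem_segment _ _ _, Set.mem_biUnion (Finset.mem_filter.2 ⟨hσ, Ne.symm hne⟩)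
      (interior_subset hb)⟩
  simp only [U, W, Set.mem_iUnion, Finset.mem_filter, exists_prop] at hzU hzW
  obtain ⟨ρ, ⟨hρ, hpρ⟩, hzρ⟩ := hzU
  obtain ⟨ρ', ⟨hρ', hpρ'⟩, hzρ'⟩ := hzW
  have hne' : ρ ≠ ρ' := by rintro rfl; exact hpρ' hpρ
  have hcom : z ∈ convexHull ℝ (Set.range (M.fine.vertex ρ) ∩ Set.range (M.fine.vertex ρ')) := by
    rw [← M.fine.conforming]; exact ⟨hzρ, hzρ'⟩
  -- the two elements have a single vertex in common, as they would share an edge otherwise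
  have hsing : (Set.range (M.fine.vertex ρ) ∩ Set.range (M.fine.vertex ρ')).Subsingleton := by
    rintro _ ⟨⟨i, rfl⟩, hi⟩ _ ⟨⟨j, rfl⟩, hj⟩
    by_contra hij
    have hij : i ≠ j := by rintro rfl; exact hij rfl
    have key : ∀ i j : Fin 3, i ≠ j → ∃ k, (k + 1 = i ∧ k + 2 = j) ∨ (k + 1 = j ∧ k + 2 = i) := by
      decide
    obtain ⟨k, hk⟩ := key i j hij
    obtain ⟨l, hl⟩ : ∃ l, M.elemSide ρ' l = M.elemSide ρ k := by
      rcases hk with ⟨rfl, rfl⟩ | ⟨rfl, rfl⟩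
      · exact exists_side_eq (M.elemAff ρ) hi hj
      · exact exists_side_eq (M.elemAff ρ) hj hi
    exact hpρ' ((h ρ hρ ρ' hρ' k l hne' hl.symm).symm.trans hpρ)
  have hzmem := convexHull_min Set.Subset.rfl hsing.convex hcom
  exact hseg z hz (Set.mem_iUnion.2 ⟨ρ, hzmem.1⟩)

end Mesh

/-! ### Quadratic forms and orthogonal expansions -/

section Abstract

variable {V : Type*} [AddCommGroup V] [Module ℝ V] {B : V →ₗ[ℝ] V →ₗ[ℝ] ℝ}

theorem form_sum_orthogonal {s : Finset ℕ} {e : ℕ → V} {g : ℕ → ℝ}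
    (he : ∀ i ∈ s, ∀ j ∈ s, B (e i) (e j) = if i = j then g i else 0) (a : ℕ → ℝ) :
    B (∑ i ∈ s, a i • e i) (∑ i ∈ s, a i • e i) = ∑ i ∈ s, a i ^ 2 * g i := by
  simp only [map_sum, LinearMap.sum_apply, map_smul, LinearMap.smul_apply, smul_eq_mul]
  refine Finset.sum_congr rfl fun i hi => ?_
  rw [Finset.sum_congr rfl fun j hj => by rw [he j hj i hi], Finset.sum_eq_single i]
  · simp; ring
  · intro j _ hj; simp [hj]
  · intro h; exact absurd hi h

/-- Bessel's inequality for a positive semidefinite form. -/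
theorem form_bessel (hsymm : ∀ x y, B x y = B y x) (hpos : ∀ x, 0 ≤ B x x) {s : Finset ℕ}
    {e : ℕ → V} (he : ∀ i ∈ s, ∀ j ∈ s, B (e i) (e j) = if i = j then 1 else 0) (x : V) :
    ∑ j ∈ s, B x (e j) ^ 2 ≤ B x x := by
  have h := hpos (x - ∑ j ∈ s, B x (e j) • e j)
  have h1 := form_sum_orthogonal (g := fun _ => 1) he fun j => B x (e j)
  have h2 : B x (∑ j ∈ s, B x (e j) • e j) = ∑ j ∈ s, B x (e j) ^ 2 := by
    simp [map_sum, sq]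
  simp only [mul_one] at h1
  generalize ∑ j ∈ s, B x (e j) • e j = y at h h1 h2
  simp only [map_sub, LinearMap.sub_apply] at h
  rw [hsymm y x, h1, h2] at h
  linarith

theorem form_add_le (hsymm : ∀ x y, B x y = B y x) (hpos : ∀ x, 0 ≤ B x x) (x y : V) :
    B (x + y) (x + y) ≤ 2 * B x x + 2 * B y y := by
  have h := hpos (x - y)
  simp only [map_sub, map_add, LinearMap.sub_apply, LinearMap.add_apply] at h ⊢
  rw [hsymm y x] at *
  linarith

theorem form_sum_le {ι : Type*} (hsymm : ∀ x y, B x y = B y x) (hpos : ∀ x, 0 ≤ B x x)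
    (s : Finset ι) (x : ι → V) :
    B (∑ i ∈ s, x i) (∑ i ∈ s, x i) ≤ s.card * ∑ i ∈ s, B (x i) (x i) := by
  have key : ∀ u w, B u w ≤ (B u u + B w w) / 2 := by
    intro u w
    have h := hpos (u - w)
    simp only [map_sub, LinearMap.sub_apply] at h
    rw [hsymm w u] at h
    linarith
  calc B (∑ i ∈ s, x i) (∑ i ∈ s, x i) = ∑ i ∈ s, ∑ j ∈ s, B (x j) (x i) := by
        simp only [map_sum, LinearMap.sum_apply]
    _ ≤ ∑ i ∈ s, ∑ j ∈ s, (B (x j) (x j) + B (x i) (x i)) / 2 :=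
        Finset.sum_le_sum fun i _ => Finset.sum_le_sum fun j _ => key _ _
    _ = _ := by
        simp only [add_div, Finset.sum_add_distrib, Finset.sum_const, nsmul_eq_mul,
          ← Finset.mul_sum, ← Finset.sum_div]
        ring

theorem le_invNext {N k j : ℕ} {lam : ℕ → ℝ} (hmono : ∀ i j, i ≤ j → j < N → lam i ≤ lam j)
    (hpos : ∀ j < N, 0 < lam j) (hj : j ∈ Finset.Ico k N) : (lam j)⁻¹ ≤ invNext N lam k := by
  obtain ⟨h1, h2⟩ := Finset.mem_Ico.1 hj
  rw [invNext, if_pos (by omega)]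
  exact inv_anti₀ (hpos k (by omega)) (hmono k j h1 h2)

theorem invNext_nonneg {N k : ℕ} {lam : ℕ → ℝ} (hpos : ∀ j < N, 0 < lam j) :
    0 ≤ invNext N lam k := by
  unfold invNext
  split_ifs with h
  · exact (inv_pos.2 (hpos k h)).le
  · exact le_rfl

/-- A function that is orthogonal to `card S - 1` linearly independent functions of zero mean is
constant. -/
theorem exists_const_of_orthogonal {ι : Type*} {S : Finset ι} {a : ι → ℝ} (ha : ∀ s ∈ S, 0 < a s)
    {p : ℕ → ι → ℝ} (hmean : ∀ j < S.card - 1, ∑ s ∈ S, a s * p j s = 0)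
    (hind : ∀ c : ℕ → ℝ, (∀ s ∈ S, ∑ j ∈ Finset.range (S.card - 1), c j * p j s = 0) →
      ∀ j < S.card - 1, c j = 0)
    {g : ι → ℝ} (hg : ∀ j < S.card - 1, ∑ s ∈ S, a s * (g s * p j s) = 0) :
    ∃ γ, ∀ s ∈ S, g s = γ := by
  classical
  rcases S.eq_empty_or_nonempty with rfl | hS
  · exact ⟨0, by simp⟩
  set N := S.card - 1 with hN
  let T : (Fin N → ℝ) × ℝ →ₗ[ℝ] (S → ℝ) :=
    { toFun := fun c s => ∑ j, c.1 j * p j s + c.2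
      map_add' := fun c d => by
        ext s; simp [add_mul, Finset.sum_add_distrib]; ring
      map_smul' := fun r c => by
        ext s; simp [mul_add, Finset.mul_sum, mul_assoc] }
  have hT : Function.Injective T := by
    rw [← LinearMap.ker_eq_bot, LinearMap.ker_eq_bot']
    rintro ⟨c, c0⟩ h
    have h1 : ∀ s ∈ S, ∑ j, c j * p j s + c0 = 0 := fun s hs => congrFun h ⟨s, hs⟩
    have h2 : c0 * ∑ s ∈ S, a s = 0 := by
      have : ∑ s ∈ S, a s * (∑ j, c j * p j s + c0) = 0 :=
        Finset.sum_eq_zero fun s hs => by rw [h1 s hs, mul_zero]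
      simp only [mul_add, Finset.sum_add_distrib, Finset.mul_sum] at this
      rw [Finset.sum_comm, Finset.sum_eq_zero, zero_add] at this
      · rw [Finset.mul_sum, ← this]
        exact Finset.sum_congr rfl fun _ _ => mul_comm _ _
      · intro j _
        rw [← mul_zero (c j), ← hmean j j.2, Finset.mul_sum]
        exact Finset.sum_congr rfl fun _ _ => by ring
    have hc0 : c0 = 0 := by
      rcases mul_eq_zero.1 h2 with h | h
      · exact h
      · exact absurd h (Finset.sum_pos ha hS).ne'
    subst hc0
    have hc := hind (fun j => if hj : j < N then c ⟨j, hj⟩ else 0) fun s hs => by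
      rw [Finset.sum_range, ← h1 s hs, add_zero]
      simp
    refine Prod.ext (funext fun j => ?_) rfl
    have := hc j j.2
    simpa using this
  have hdim : Module.finrank ℝ ((Fin N → ℝ) × ℝ) = Module.finrank ℝ (S → ℝ) := by
    have : 0 < S.card := hS.card_pos
    simp
    omega
  obtain ⟨⟨c, c0⟩, hc⟩ :=
    (LinearMap.injective_iff_surjective_of_finrank_eq_finrank hdim).1 hT fun s => g s
  have h1 : ∀ s ∈ S, ∑ j, c j * p j s + c0 = g s := fun s hs => congrFun hc ⟨s, hs⟩
  have h2 : ∑ s ∈ S, a s * (g s - c0) ^ 2 = 0 := by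
    calc ∑ s ∈ S, a s * (g s - c0) ^ 2
        = ∑ s ∈ S, ∑ j : Fin N, c j * (a s * (g s * p j s) - c0 * (a s * p j s)) := by
          refine Finset.sum_congr rfl fun s hs => ?_
          have : (g s - c0) ^ 2 = (g s - c0) * ∑ j, c j * p j s := by rw [← h1 s hs]; ring
          rw [this, Finset.mul_sum, Finset.mul_sum]
          exact Finset.sum_congr rfl fun j _ => by ring
      _ = 0 := by
          rw [Finset.sum_comm]
          refine Finset.sum_eq_zero fun j _ => ?_
          rw [← Finset.mul_sum, Finset.sum_sub_distrib, hg j j.2, ← Finset.mul_sum, hmean j j.2]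
          ring
  refine ⟨c0, fun s hs => ?_⟩
  have h3 := (Finset.sum_eq_zero_iff_of_nonneg fun s hs =>
    mul_nonneg (ha s hs).le (sq_nonneg _)).1 h2 s hs
  rcases mul_eq_zero.1 h3 with h | h
  · exact absurd h (ha s hs).ne'
  · have := pow_eq_zero_iff (two_ne_zero) |>.1 h
    linarith

end Abstract

namespace Mesh

variable {M : Mesh}

/-! ### The bilinear forms -/

theorem rt_add (c d : Plane × ℝ) (x : Plane) : rt (c + d) x = rt c x + rt d x := by
  simp [rt, add_smul]; abel

theorem rt_smul (a : ℝ) (c : Plane × ℝ) (x : Plane) : rt (a • c) x = a • rt c x := by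
  simp [rt, smul_smul]

theorem continuous_rt (c : Plane × ℝ) : Continuous (rt c) := by unfold rt; fun_prop

theorem IsCoefficient.tri {κ : Plane → ℝ} (hκ : M.IsCoefficient κ) (τ : M.Elem) :
    AEStronglyMeasurable κ (volume.restrict (M.tri τ)) ∧
      ∃ a b : ℝ, 0 < a ∧ ∀ᵐ x ∂volume.restrict (M.tri τ), a ≤ κ x ∧ κ x ≤ b := by
  have hle : volume.restrict (M.tri τ) ≤ volume.restrict M.domain :=
    Measure.restrict_mono (tri_subset_domain τ) le_rfl
  obtain ⟨h1, a, b, ha, h2⟩ := hκ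
  exact ⟨h1.mono_measure hle, a, b, ha, ae_mono hle h2⟩

theorem IsCoefficient.integrableOn_mul {κ : Plane → ℝ} (hκ : M.IsCoefficient κ) {τ : M.Elem}
    {g : Plane → ℝ} (hg : IntegrableOn g (M.tri τ)) :
    IntegrableOn (fun x => κ x * g x) (M.tri τ) := by
  obtain ⟨h1, a, b, ha, h2⟩ := hκ.tri τ
  refine Integrable.bdd_mul (c := b) hg h1 ?_
  filter_upwards [h2] with x hx
  rw [Real.norm_of_nonneg (ha.le.trans hx.1)]
  exact hx.2

theorem integrableOn_of_continuous {g : Plane → ℝ} (hg : Continuous g) (τ : M.Elem) :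
    IntegrableOn g (M.tri τ) :=
  hg.continuousOn.integrableOn_compact (isCompact_hull _)

theorem integrableOn_inner_rt {κ : Plane → ℝ} (hκ : M.IsCoefficient κ) (τ : M.Elem)
    (c d : Plane × ℝ) : IntegrableOn (fun x => κ x * ⟪rt c x, rt d x⟫) (M.tri τ) :=
  hκ.integrableOn_mul
    (integrableOn_of_continuous ((continuous_rt c).inner (continuous_rt d)) τ)

theorem vInner_comm (κ : Plane → ℝ) (A : Finset M.Elem) (v w : M.VField) :
    vInner κ A v w = vInner κ A w v := by
  simp only [vInner, real_inner_comm]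

/-- The weighted inner product of velocities as a bilinear form. -/
noncomputable def vForm {κ : Plane → ℝ} (hκ : M.IsCoefficient κ) (A : Finset M.Elem) :
    M.VField →ₗ[ℝ] M.VField →ₗ[ℝ] ℝ :=
  have hadd : ∀ u v w : M.VField, vInner κ A (u + v) w = vInner κ A u w + vInner κ A v w := by
    intro u v w
    rw [vInner, vInner, vInner, ← Finset.sum_add_distrib]
    refine Finset.sum_congr rfl fun τ _ => ?_
    rw [← integral_add (integrableOn_inner_rt hκ τ _ _) (integrableOn_inner_rt hκ τ _ _)]
    simp only [Pi.add_apply, rt_add, inner_add_left, mul_add]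
  have hsmul : ∀ (a : ℝ) (v w : M.VField), vInner κ A (a • v) w = a * vInner κ A v w := by
    intro a v w
    rw [vInner, vInner, Finset.mul_sum]
    refine Finset.sum_congr rfl fun τ _ => ?_
    rw [← integral_const_mul]
    simp only [Pi.smul_apply, rt_smul, inner_smul_left, conj_trivial]
    congr 1; ext x; ring
  LinearMap.mk₂ ℝ (vInner κ A) hadd hsmul
    (fun u v w => by
      rw [vInner_comm, hadd, vInner_comm κ A v, vInner_comm κ A w])
    (fun a v w => by rw [vInner_comm, hsmul, vInner_comm, smul_eq_mul])

theorem vForm_apply {κ : Plane → ℝ} (hκ : M.IsCoefficient κ) (A : Finset M.Elem)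
    (v w : M.VField) : vForm hκ A v w = vInner κ A v w := rfl

theorem vForm_comm {κ : Plane → ℝ} (hκ : M.IsCoefficient κ) (A : Finset M.Elem)
    (v w : M.VField) : vForm hκ A v w = vForm hκ A w v := vInner_comm κ A v w

theorem integral_rt_nonneg {κ : Plane → ℝ} (hκ : M.IsCoefficient κ) (τ : M.Elem)
    (c : Plane × ℝ) : 0 ≤ ∫ x in M.tri τ, κ x * ⟪rt c x, rt c x⟫ := by
  obtain ⟨-, a, b, ha, h2⟩ := hκ.tri τ
  refine integral_nonneg_of_ae ?_
  filter_upwards [h2] with x hx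
  exact mul_nonneg (ha.le.trans hx.1) real_inner_self_nonneg

theorem vInner_nonneg {κ : Plane → ℝ} (hκ : M.IsCoefficient κ) (A : Finset M.Elem)
    (v : M.VField) : 0 ≤ vInner κ A v v :=
  Finset.sum_nonneg fun τ _ => integral_rt_nonneg hκ τ _

theorem vInner_mono {κ : Plane → ℝ} (hκ : M.IsCoefficient κ) {A A' : Finset M.Elem}
    (h : A ⊆ A') (v : M.VField) : vInner κ A v v ≤ vInner κ A' v v :=
  Finset.sum_le_sum_of_subset_of_nonneg h fun τ _ _ => integral_rt_nonneg hκ τ _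

theorem vInner_congr {κ : Plane → ℝ} {A : Finset M.Elem} {v v' w w' : M.VField}
    (h : ∀ τ ∈ A, v τ = v' τ) (h' : ∀ τ ∈ A, w τ = w' τ) :
    vInner κ A v w = vInner κ A v' w' :=
  Finset.sum_congr rfl fun τ hτ => by rw [h τ hτ, h' τ hτ]

/-- The velocity form is definite. -/
theorem eq_zero_of_vInner_eq_zero {κ : Plane → ℝ} (hκ : M.IsCoefficient κ) {A : Finset M.Elem}
    {v : M.VField} (h : vInner κ A v v = 0) : ∀ τ ∈ A, v τ = 0 := by
  intro τ hτ
  have h0 := (Finset.sum_eq_zero_iff_of_nonneg fun τ _ => integral_rt_nonneg hκ τ (v τ)).1 h τ hτ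
  obtain ⟨-, a, b, ha, h2⟩ := hκ.tri τ
  rw [integral_eq_zero_iff_of_nonneg_ae] at h0
  · have h3 : ∀ᵐ x ∂volume.restrict (M.tri τ), rt (v τ) x = 0 := by
      filter_upwards [h0, h2] with x hx hx2
      have hx : κ x * ⟪rt (v τ) x, rt (v τ) x⟫ = 0 := hx
      rcases mul_eq_zero.1 hx with h | h
      · linarith [hx2.1]
      · exact inner_self_eq_zero.1 h
    have h4 : ∀ᵐ x ∂volume.restrict (interior (M.tri τ)), rt (v τ) x = 0 :=
      ae_restrict_of_ae_restrict_of_subset interior_subset h3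
    have h5 : Set.EqOn (rt (v τ)) (fun _ => 0) (interior (M.tri τ)) :=
      Measure.eqOn_open_of_ae_eq h4 isOpen_interior (continuous_rt _).continuousOn
        continuousOn_const
    obtain ⟨p, hp⟩ := tri_interior_nonempty τ
    have hev : ∀ᶠ ε : ℝ in nhdsWithin 0 (Ioi 0),
        p + ε • (!₂[1, 0] : Plane) ∈ interior (M.tri τ) := by
      have hc : ContinuousAt (fun ε : ℝ => p + ε • (!₂[1, 0] : Plane)) 0 := by fun_prop
      exact nhdsWithin_le_nhds (hc.preimage_mem_nhds (isOpen_interior.mem_nhds (by simpa using hp)))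
    obtain ⟨ε, h6, hε⟩ := (hev.and self_mem_nhdsWithin).exists
    have e1 : (v τ).1 + (v τ).2 • p = 0 := h5 hp
    have e2 : (v τ).1 + (v τ).2 • (p + ε • (!₂[1, 0] : Plane)) = 0 := h5 h6
    rw [smul_add, ← add_assoc, e1, zero_add] at e2
    have e3 := congrArg (fun q : Plane => q 0) e2
    have hε : (0 : ℝ) < ε := hε
    have e4 : (v τ).2 = 0 := by simpa [hε.ne'] using e3
    refine Prod.ext ?_ e4
    simpa [e4] using e1
  · filter_upwards [h2] with x hx
    exact mul_nonneg (ha.le.trans hx.1) real_inner_self_nonneg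
  · exact integrableOn_inner_rt hκ τ _ _

theorem divPair_eq (A : Finset M.Elem) (q : M.QField) (w : M.VField) :
    divPair A q w = ∑ τ ∈ A, volume.real (M.tri τ) * (q τ * rtDiv (w τ)) := by
  simp [divPair]

theorem qIntegral_eq (A : Finset M.Elem) (q : M.QField) :
    qIntegral A q = ∑ τ ∈ A, volume.real (M.tri τ) * q τ := by
  simp [qIntegral]

theorem qInner_eq (ρ : Plane → ℝ) (A : Finset M.Elem) (p q : M.QField) :
    qInner ρ A p q = ∑ τ ∈ A, (∫ x in M.tri τ, ρ x) * (p τ * q τ) := by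
  simp only [qInner, integral_mul_const]

/-- The divergence pairing as a bilinear form. -/
noncomputable def divForm (A : Finset M.Elem) : M.QField →ₗ[ℝ] M.VField →ₗ[ℝ] ℝ :=
  LinearMap.mk₂ ℝ (divPair A)
    (fun p q w => by
      simp only [divPair_eq, ← Finset.sum_add_distrib, Pi.add_apply]
      exact Finset.sum_congr rfl fun τ _ => by ring)
    (fun a q w => by
      simp only [divPair_eq, smul_eq_mul, Finset.mul_sum, Pi.smul_apply]
      exact Finset.sum_congr rfl fun τ _ => by ring)
    (fun q v w => by
      simp only [divPair_eq, ← Finset.sum_add_distrib, Pi.add_apply, rtDiv, Prod.snd_add]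
      exact Finset.sum_congr rfl fun τ _ => by ring)
    (fun a q w => by
      simp only [divPair_eq, smul_eq_mul, Finset.mul_sum, Pi.smul_apply, rtDiv, Prod.smul_snd]
      exact Finset.sum_congr rfl fun τ _ => by ring)

theorem divForm_apply (A : Finset M.Elem) (q : M.QField) (w : M.VField) :
    divForm A q w = divPair A q w := rfl

/-- The weighted inner product of piecewise constant pressures as a bilinear form. -/
noncomputable def qForm (ρ : Plane → ℝ) (A : Finset M.Elem) : M.QField →ₗ[ℝ] M.QField →ₗ[ℝ] ℝ :=
  LinearMap.mk₂ ℝ (qInner ρ A)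
    (fun p q w => by
      simp only [qInner_eq, ← Finset.sum_add_distrib, Pi.add_apply]
      exact Finset.sum_congr rfl fun τ _ => by ring)
    (fun a q w => by
      simp only [qInner_eq, smul_eq_mul, Finset.mul_sum, Pi.smul_apply]
      exact Finset.sum_congr rfl fun τ _ => by ring)
    (fun q v w => by
      simp only [qInner_eq, ← Finset.sum_add_distrib, Pi.add_apply]
      exact Finset.sum_congr rfl fun τ _ => by ring)
    (fun a q w => by
      simp only [qInner_eq, smul_eq_mul, Finset.mul_sum, Pi.smul_apply]
      exact Finset.sum_congr rfl fun τ _ => by ring)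

theorem qForm_apply (ρ : Plane → ℝ) (A : Finset M.Elem) (p q : M.QField) :
    qForm ρ A p q = qInner ρ A p q := rfl

theorem qForm_comm (ρ : Plane → ℝ) (A : Finset M.Elem) (p q : M.QField) :
    qForm ρ A p q = qForm ρ A q p := by
  simp only [qForm_apply, qInner_eq, mul_comm (p _)]

theorem integral_coeff_pos {ρ : Plane → ℝ} (hρ : M.IsCoefficient ρ) (τ : M.Elem) :
    0 < ∫ x in M.tri τ, ρ x := by
  obtain ⟨h1, a, b, ha, h2⟩ := hρ.tri τ
  have hint : IntegrableOn ρ (M.tri τ) := by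
    have := hρ.integrableOn_mul (integrableOn_of_continuous (continuous_const (y := (1 : ℝ))) τ)
    simpa using this
  have h3 : ∫ x in M.tri τ, a ≤ ∫ x in M.tri τ, ρ x :=
    integral_mono_ae (integrableOn_of_continuous continuous_const τ) hint (h2.mono fun x hx => hx.1)
  refine lt_of_lt_of_le ?_ h3
  have := volume_tri_pos τ
  simp only [integral_const, measureReal_restrict_apply_univ, smul_eq_mul]
  positivity

theorem qForm_nonneg {ρ : Plane → ℝ} (hρ : M.IsCoefficient ρ) (A : Finset M.Elem)
    (p : M.QField) : 0 ≤ qForm ρ A p p := by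
  rw [qForm_apply, qInner_eq]
  exact Finset.sum_nonneg fun τ _ =>
    mul_nonneg (integral_coeff_pos hρ τ).le (mul_self_nonneg _)

/-- The length-weighted inner product of piecewise constant functions on a coarse edge. -/
noncomputable def edgeForm (S : Finset (Sym2 Plane)) :
    (Sym2 Plane → ℝ) →ₗ[ℝ] (Sym2 Plane → ℝ) →ₗ[ℝ] ℝ :=
  LinearMap.mk₂ ℝ (fun a b => ∑ e ∈ S, edgeLength e * (a e * b e))
    (fun p q w => by
      simp only [← Finset.sum_add_distrib, Pi.add_apply]
      exact Finset.sum_congr rfl fun τ _ => by ring)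
    (fun a q w => by
      simp only [smul_eq_mul, Finset.mul_sum, Pi.smul_apply]
      exact Finset.sum_congr rfl fun τ _ => by ring)
    (fun q v w => by
      simp only [← Finset.sum_add_distrib, Pi.add_apply]
      exact Finset.sum_congr rfl fun τ _ => by ring)
    (fun a q w => by
      simp only [smul_eq_mul, Finset.mul_sum, Pi.smul_apply]
      exact Finset.sum_congr rfl fun τ _ => by ring)

theorem edgeForm_apply (S : Finset (Sym2 Plane)) (a b : Sym2 Plane → ℝ) :
    edgeForm S a b = ∑ e ∈ S, edgeLength e * (a e * b e) := rfl

theorem edgeForm_comm (S : Finset (Sym2 Plane)) (a b : Sym2 Plane → ℝ) :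
    edgeForm S a b = edgeForm S b a := by
  simp only [edgeForm_apply, mul_comm (a _)]

theorem edgeLength_nonneg (e : Sym2 Plane) : 0 ≤ edgeLength e := by
  induction e with
  | _ a b => exact (dist_nonneg : 0 ≤ dist a b)

theorem edgeForm_nonneg (S : Finset (Sym2 Plane)) (a : Sym2 Plane → ℝ) : 0 ≤ edgeForm S a a :=
  Finset.sum_nonneg fun _ _ => mul_nonneg (edgeLength_nonneg _) (mul_self_nonneg _)

/-! ### Raviart–Thomas fields with zero normal component on the boundary of a coarse element -/

theorem outflow_add (v w : M.VField) (τ : M.Elem) (i : Fin 3) (x : Plane) :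
    outflow (v + w) τ i x = outflow v τ i x + outflow w τ i x := by
  simp [outflow, rt_add, inner_add_left]

theorem outflow_smul (a : ℝ) (v : M.VField) (τ : M.Elem) (i : Fin 3) (x : Plane) :
    outflow (a • v) τ i x = a * outflow v τ i x := by
  simp [outflow, rt_smul, inner_smul_left]

theorem outflow_eq_zero {v : M.VField} {τ : M.Elem} (h : v τ = 0) (i : Fin 3) (x : Plane) :
    outflow v τ i x = 0 := by
  simp [outflow, rt, h]

theorem outflow_congr {v w : M.VField} {τ : M.Elem} (h : v τ = w τ) (i : Fin 3) (x : Plane) :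
    outflow v τ i x = outflow w τ i x := by
  simp [outflow, h]

/-- The flow through a fine side, as a linear functional. -/
noncomputable def flowL (τi : M.Elem × Fin 3) : M.VField →ₗ[ℝ] ℝ where
  toFun v := flow v τi
  map_add' v w := outflow_add v w _ _ _
  map_smul' a v := outflow_smul a v _ _ _

theorem flowL_apply (τi : M.Elem × Fin 3) (v : M.VField) : flowL τi v = flow v τi := rfl

theorem flow_congr {v w : M.VField} {τi : M.Elem × Fin 3} (h : v τi.1 = w τi.1) :
    flow v τi = flow w τi := outflow_congr h _ _

theorem isLocal_congr {K : M.Cell} {v w : M.VField} (h : ∀ τ ∈ M.elems K, v τ = w τ)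
    (hv : IsLocal K v) : IsLocal K w := by
  rw [isLocal_iff] at hv ⊢
  intro τ σ i j hne hτ hσ he
  rw [← flow_congr (τi := (τ, i)) (h τ hτ), ← flow_congr (τi := (σ, j)) (h σ hσ)]
  exact hv τ σ i j hne hτ hσ he

variable (M) in
/-- The Raviart–Thomas space of a coarse element as a submodule. -/
def localSubmodule (K : M.Cell) : Submodule ℝ M.VField where
  carrier := {v | IsLocal K v}
  add_mem' {v w} hv hw τ σ i j hne he hP x hx := by
    rw [outflow_add, outflow_add]
    linarith [hv τ σ i j hne he hP x hx, hw τ σ i j hne he hP x hx]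
  zero_mem' τ σ i j _ _ _ x _ := by
    rw [outflow_eq_zero rfl, outflow_eq_zero rfl, add_zero]
  smul_mem' a v hv τ σ i j hne he hP x hx := by
    rw [outflow_smul, outflow_smul, ← mul_add, hv τ σ i j hne he hP x hx, mul_zero]

theorem isLocalZero_iff {K : M.Cell} {v : M.VField} : IsLocalZero K v ↔
    IsLocal K v ∧ (∀ τ ∉ M.elems K, v τ = 0) ∧
      ∀ k, ∀ τi ∈ M.sidesOn K (M.cellSide K k), flow v τi = 0 := by
  refine and_congr_right fun _ => and_congr_right fun _ => forall_congr' fun k =>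
    forall₂_congr fun τi _ => ⟨fun h => h _ (mid_mem_seg _ _), fun h x hx => ?_⟩
  rw [outflow_eq_flow v hx]
  exact h

variable (M) in
/-- The fields with zero normal component on the boundary of a coarse element, as a submodule. -/
def localZeroSubmodule (K : M.Cell) : Submodule ℝ M.VField where
  carrier := {v | IsLocalZero K v}
  add_mem' {v w} hv hw := by
    refine ⟨(M.localSubmodule K).add_mem hv.1 hw.1, fun τ hτ => ?_, fun k τi h x hx => ?_⟩
    · rw [Pi.add_apply, hv.2.1 τ hτ, hw.2.1 τ hτ, add_zero]
    · rw [outflow_add, hv.2.2 k τi h x hx, hw.2.2 k τi h x hx, add_zero]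
  zero_mem' := ⟨(M.localSubmodule K).zero_mem, fun _ _ => rfl, fun _ _ _ _ _ =>
    outflow_eq_zero rfl _ _⟩
  smul_mem' a v hv := by
    refine ⟨(M.localSubmodule K).smul_mem a hv.1, fun τ hτ => ?_, fun k τi h x hx => ?_⟩
    · rw [Pi.smul_apply, hv.2.1 τ hτ, smul_zero]
    · rw [outflow_smul, hv.2.2 k τi h x hx, mul_zero]

/-- Fields without flow through the boundary have a divergence of zero mean. -/
theorem sum_rtDiv_eq_zero {K : M.Cell} {v : M.VField} (hv : IsLocalZero K v) :
    ∑ τ ∈ M.elems K, volume.real (M.tri τ) * rtDiv (v τ) = 0 := by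
  obtain ⟨h1, -, h2⟩ := isLocalZero_iff.1 hv
  have h := discrete_divergence h1
  rw [Finset.sum_eq_zero fun k _ => Finset.sum_eq_zero fun τi hτi => by
    rw [h2 k τi hτi, mul_zero]] at h
  have h3 : ∀ τ ∈ M.elems K, volume.real (M.tri τ) * rtDiv (v τ) =
      2 * refArea * (rtDiv (v τ) * |signedArea (M.fine.vertex τ)| / 2) := fun τ _ => by
    rw [volume_tri]; ring
  rw [Finset.sum_congr rfl h3, ← Finset.mul_sum, h, mul_zero]

/-- The field `a (x - y)`, where `y` is a vertex, only flows through the opposite edge. -/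
theorem inner_rt_vertex {x : Fin 3 → Plane} (hx : AffineIndependent ℝ x) (a : ℝ) (i l : Fin 3) :
    ⟪rt (a • (-x i, 1)) (mid x l), outerNormal x l⟫ = if l = i then a * height x i else 0 := by
  have : rt (a • (-x i, 1)) (mid x l) = a • (mid x l - x i) := by
    rw [rt_smul]; congr 1; simp [rt]; abel
  rw [this, inner_smul_left, inner_outerNormal_sub hx, bary_mid_self, bary_vertex]
  split_ifs with h
  · rw [h]; simp
  · simp

/-- The Raviart–Thomas basis function of the common edge of two fine elements tests the jump of a
pressure across this edge. -/
theorem exists_test_field {K : M.Cell} {τ σ : M.Elem} {i j : Fin 3} (hτ : τ ∈ M.elems K)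
    (hσ : σ ∈ M.elems K) (hne : τ ≠ σ) (he : M.elemSide τ i = M.elemSide σ j) :
    ∃ w, IsLocalZero K w ∧ ∀ p : M.QField,
      divPair (M.elems K) p w = 2 * refArea * (p τ - p σ) := by
  classical
  set w : M.VField := fun ρ =>
    if ρ = τ then |signedArea (M.fine.vertex τ)|⁻¹ • (-M.fine.vertex τ i, 1)
    else if ρ = σ then (-|signedArea (M.fine.vertex σ)|⁻¹) • (-M.fine.vertex σ j, 1) else 0 with hw
  have hwτ : w τ = |signedArea (M.fine.vertex τ)|⁻¹ • (-M.fine.vertex τ i, 1) := by simp [hw]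
  have hwσ : w σ = (-|signedArea (M.fine.vertex σ)|⁻¹) • (-M.fine.vertex σ j, 1) := by
    simp [hw, hne.symm]
  have hwρ : ∀ ρ, ρ ≠ τ → ρ ≠ σ → w ρ = 0 := fun ρ h1 h2 => by simp [hw, h1, h2]
  have harea : ∀ ρ : M.Elem, |signedArea (M.fine.vertex ρ)| ≠ 0 := fun ρ =>
    abs_ne_zero.2 (signedArea_ne_zero (M.elemAff ρ))
  have hlen : ∀ (ρ : M.Elem) l, |signedArea (M.fine.vertex ρ)|⁻¹ * height (M.fine.vertex ρ) l =
      (edgeLength (M.elemSide ρ l))⁻¹ := fun ρ l => by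
    have h' := edgeLength_mul_height (M.elemAff ρ) l
    refine eq_inv_of_mul_eq_one_left ?_
    rw [mul_assoc, mul_comm (height _ _), elemSide, h', inv_mul_cancel₀ (harea ρ)]
  have hfτ : ∀ l, flow w (τ, l) = if l = i then (edgeLength (M.elemSide τ i))⁻¹ else 0 := by
    intro l
    rw [flow, outflow, hwτ, inner_rt_vertex (M.elemAff τ), hlen]
  have hfσ : ∀ l, flow w (σ, l) = if l = j then -(edgeLength (M.elemSide τ i))⁻¹ else 0 := by
    intro l
    rw [flow, outflow, hwσ, inner_rt_vertex (M.elemAff σ), neg_mul, hlen, he]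
  have hfρ : ∀ ρ l, ρ ≠ τ → ρ ≠ σ → flow w (ρ, l) = 0 := fun ρ l h1 h2 =>
    outflow_eq_zero (hwρ ρ h1 h2) _ _
  have hij : ∀ l l', M.elemSide τ l = M.elemSide σ l' → (l = i ↔ l' = j) := by
    intro l l' h
    constructor
    · rintro rfl
      exact side_injective (M.elemAff σ) (h.symm.trans he)
    · rintro rfl
      exact side_injective (M.elemAff τ) (h.trans he.symm)
  refine ⟨w, isLocalZero_iff.2 ⟨isLocal_iff.2 ?_, ?_, ?_⟩, ?_⟩
  · intro a b l l' hab _ _ hl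
    by_cases haτ : a = τ
    · subst haτ
      by_cases hbσ : b = σ
      · subst hbσ
        rw [hfτ, hfσ]
        by_cases h : l = i
        · rw [if_pos h, if_pos ((hij l l' hl).1 h), add_neg_cancel]
        · rw [if_neg h, if_neg fun h' => h ((hij l l' hl).2 h'), add_zero]
      · rw [hfρ b l' hab.symm hbσ, hfτ, if_neg, add_zero]
        rintro rfl
        exact hbσ (elem_unique_of_shared hab hne hl he)
    · by_cases haσ : a = σ
      · subst haσ
        by_cases hbτ : b = τ
        · subst hbτ
          rw [hfτ, hfσ]
          by_cases h : l' = i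
          · rw [if_pos h, if_pos ((hij l' l hl.symm).1 h), neg_add_cancel]
          · rw [if_neg h, if_neg fun h' => h ((hij l' l hl.symm).2 h'), add_zero]
        · rw [hfρ b l' hbτ hab.symm, hfσ, if_neg, add_zero]
          rintro rfl
          exact hbτ (elem_unique_of_shared hab hne.symm hl he.symm)
      · rw [hfρ a l haτ haσ, zero_add]
        by_cases hbτ : b = τ
        · subst hbτ
          rw [hfτ, if_neg]
          rintro rfl
          exact haσ (elem_unique_of_shared hab.symm hne hl.symm he)
        · by_cases hbσ : b = σ
          · subst hbσ
            rw [hfσ, if_neg]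
            rintro rfl
            exact haτ (elem_unique_of_shared hab.symm hne.symm hl.symm he.symm)
          · exact hfρ b l' hbτ hbσ
  · intro ρ hρ
    exact hwρ ρ (fun h => hρ (h ▸ hτ)) fun h => hρ (h ▸ hσ)
  · rintro k ⟨ρ, l⟩ h
    by_cases hρτ : ρ = τ
    · subst hρτ
      rw [hfτ, if_neg]
      rintro rfl
      exact hne (not_shared_of_mem_sidesOn h hσ he)
    · by_cases hρσ : ρ = σ
      · subst hρσ
        rw [hfσ, if_neg]
        rintro rfl
        exact hne (not_shared_of_mem_sidesOn h hτ he.symm).symm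
      · exact hfρ ρ l hρτ hρσ
  · intro p
    rw [divPair_eq, Finset.sum_eq_add_of_mem τ σ hτ hσ hne]
    · rw [hwτ, hwσ, volume_tri, volume_tri]
      have h1 := harea τ
      have h2 := harea σ
      simp only [rtDiv, Prod.smul_snd, smul_eq_mul]
      field_simp
      ring
    · rintro ρ _ ⟨h1, h2⟩
      rw [hwρ ρ h1 h2]; simp [rtDiv]

/-- Fields with zero normal component on the boundary of a coarse element are test functions. -/
theorem IsLocalZero.isVelocity {K : M.Cell} {w : M.VField} (hw : IsLocalZero K w) :
    M.IsVelocity w := by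
  intro τ σ i j hne he _ x hx
  have hx' : x ∈ seg (M.elemSide σ j) := by rwa [← he]
  by_cases hτ : τ ∈ M.elems K
  · by_cases hσ : σ ∈ M.elems K
    · exact hw.1 τ σ i j hne he ⟨hτ, hσ⟩ x hx
    · rw [outflow_eq_zero (hw.2.1 σ hσ), add_zero]
      rcases side_dichotomy hτ i with ⟨k, hk⟩ | ⟨-, σ', hσ', hne', j', hj'⟩
      · exact hw.2.2 k _ hk x hx
      · exact absurd (elem_unique_of_shared hne hne'.symm he hj'.symm ▸ hσ') hσ
  · rw [outflow_eq_zero (hw.2.1 τ hτ), zero_add]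
    by_cases hσ : σ ∈ M.elems K
    · rcases side_dichotomy hσ j with ⟨k, hk⟩ | ⟨-, τ', hτ', hne', i', hi'⟩
      · exact hw.2.2 k _ hk x hx'
      · exact absurd (elem_unique_of_shared hne.symm hne'.symm he.symm hi'.symm ▸ hτ') hτ
    · exact outflow_eq_zero (hw.2.1 σ hσ) _ _

theorem sideIntegral_eq_zero {x : Fin 3 → Plane} {i : Fin 3} {g : Plane → ℝ}
    (h : ∀ p ∈ seg (side x i), g p = 0) : sideIntegral x i g = 0 := by
  rw [sideIntegral_of_const h, mul_zero]

theorem IsLocalZero.jumpPair_eq_zero {K : M.Cell} {w : M.VField} (hw : IsLocalZero K w)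
    (q : M.BField) : M.jumpPair q w = 0 := by
  classical
  refine Finset.sum_eq_zero fun τi hτi => sideIntegral_eq_zero fun x hx => ?_
  simp only [Finset.mem_filter, Finset.mem_univ, true_and] at hτi
  obtain ⟨E, hE, hs⟩ := hτi
  by_cases hτ : τi.1 ∈ M.elems K
  · obtain ⟨k, hk⟩ := exists_mem_sidesOn_of_onInit hτ ⟨E, mem_initEdges_of_interior hE, hs⟩
    rw [hw.2.2 k τi hk x hx, mul_zero]
  · rw [outflow_eq_zero (hw.2.1 _ hτ), mul_zero]

/-- A discrete velocity restricts to a Raviart–Thomas field on every coarse element. -/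
theorem IsVelocity.isLocal {v : M.VField} (hv : M.IsVelocity v) (K : M.Cell) : IsLocal K v :=
  fun τ σ i j hne he hK x hx => hv τ σ i j hne he (not_onInit_of_shared hK.1 hK.2 hne he) x hx

/-! ### The spectral problem on a coarse element -/

theorem exists_elem_of_card {K : M.Cell} {j : ℕ} (hj : j < M.cellDim K) :
    (M.elems K).Nonempty := by
  unfold cellDim at hj
  exact Finset.card_pos.1 (by omega)

theorem sum_volume_tri_pos {K : M.Cell} (h : (M.elems K).Nonempty) :
    0 < ∑ τ ∈ M.elems K, volume.real (M.tri τ) :=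
  Finset.sum_pos (fun τ _ => volume_tri_pos τ) h

section CellBasis

variable {κ ρ : Plane → ℝ} {K : M.Cell} {mu : ℕ → ℝ} {φ : ℕ → M.VField} {p : ℕ → M.QField}

theorem IsCellEigenbasis.divPair_eq (h : IsCellEigenbasis κ ρ K mu φ p) {i j : ℕ}
    (hi : i < M.cellDim K) (hj : j < M.cellDim K) :
    divPair (M.elems K) (p i) (φ j) = if i = j then mu i else 0 := by
  rw [h.eigen_p j hj (p i) (h.mean_zero i hi), h.orthonormal j hj i hi]
  by_cases hij : i = j
  · simp [hij]
  · simp [hij, Ne.symm hij]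

theorem IsCellEigenbasis.vInner_eq (h : IsCellEigenbasis κ ρ K mu φ p) {i j : ℕ}
    (hi : i < M.cellDim K) (hj : j < M.cellDim K) :
    vInner κ (M.elems K) (φ i) (φ j) = if i = j then mu i else 0 := by
  rw [← h.divPair_eq hi hj]
  exact sub_eq_zero.1 (h.eigen_v i hi _ (h.localZero j hj))

/-- The eigenvalues of the spectral problem on a coarse element are positive, as the divergence
maps onto the functions of zero mean. -/
theorem IsCellEigenbasis.mu_pos (hκ : M.IsCoefficient κ) (h : IsCellEigenbasis κ ρ K mu φ p) {j : ℕ}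
    (hj : j < M.cellDim K) : 0 < mu j := by
  have h1 := h.vInner_eq hj hj
  rw [if_pos rfl] at h1
  have h2 := vInner_nonneg hκ (M.elems K) (φ j)
  refine lt_of_le_of_ne (h1 ▸ h2) fun h0 => ?_
  -- otherwise the eigenfunction vanishes, and the pressure has no jumps inside `K`
  have hφ := eq_zero_of_vInner_eq_zero hκ (h1.trans h0.symm)
  have hdiv : ∀ w, IsLocalZero K w → divPair (M.elems K) (p j) w = 0 := by
    intro w hw
    have := h.eigen_v j hj w hw
    rw [vInner_congr (v' := 0) (w' := w) hφ fun _ _ => rfl, ← vForm_apply hκ, map_zero,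
      LinearMap.zero_apply] at this
    linarith
  have hconst : ∀ τ ∈ M.elems K, ∀ σ ∈ M.elems K, p j τ = p j σ := by
    intro τ hτ σ hσ
    refine eq_of_no_jumps (K := K) (fun a ha b hb i l hne he => ?_) hτ hσ
    obtain ⟨w, hw, hpw⟩ := exists_test_field ha hb hne he
    have h3 := hpw (p j)
    rw [hdiv w hw] at h3
    have := refArea_pos
    have h4 : p j a - p j b = 0 := by
      rcases mul_eq_zero.1 h3.symm with h | h
      · linarith
      · exact h
    linarith
  obtain ⟨τ, hτ⟩ := exists_elem_of_card hj
  have h3 := h.mean_zero j hj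
  rw [qIntegral_eq, Finset.sum_congr rfl fun σ hσ => by rw [hconst σ hσ τ hτ],
    ← Finset.sum_mul] at h3
  have h4 : p j τ = 0 := by
    rcases mul_eq_zero.1 h3 with h | h
    · exact absurd h (sum_volume_tri_pos ⟨τ, hτ⟩).ne'
    · exact h
  have h5 := h.orthonormal j hj j hj
  rw [qInner_eq, Finset.sum_eq_zero fun σ hσ => by rw [hconst σ hσ τ hτ, h4]; simp] at h5
  simp at h5

/-- A field with zero normal component on the boundary of `K` that is orthogonal to the
divergence-free ones is a combination of the eigenfunctions of `K`. -/
theorem IsCellEigenbasis.expansion (hκ : M.IsCoefficient κ) (h : IsCellEigenbasis κ ρ K mu φ p)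
    {r : M.VField} (hr : IsLocalZero K r)
    (horth : ∀ w, IsLocalZero K w → (∀ τ ∈ M.elems K, rtDiv (w τ) = 0) →
      vInner κ (M.elems K) r w = 0) :
    ∀ τ ∈ M.elems K, r τ = ∑ j ∈ Finset.range (M.cellDim K),
      ((mu j)⁻¹ * divPair (M.elems K) (p j) r) • φ j τ := by
  set d : ℕ → ℝ := fun j => (mu j)⁻¹ * divPair (M.elems K) (p j) r with hd
  set s : M.VField := r - ∑ j ∈ Finset.range (M.cellDim K), d j • φ j with hs
  have hs0 : IsLocalZero K s := by
    refine (M.localZeroSubmodule K).sub_mem hr (Submodule.sum_mem _ fun j hj => ?_)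
    exact Submodule.smul_mem _ _ (h.localZero j (Finset.mem_range.1 hj))
  have hdivs : ∀ i < M.cellDim K, divPair (M.elems K) (p i) s = 0 := by
    intro i hi
    rw [← divForm_apply, hs, map_sub, map_sum, Finset.sum_eq_single i]
    · rw [map_smul, divForm_apply, divForm_apply, h.divPair_eq hi hi, if_pos rfl, smul_eq_mul, hd]
      have := (h.mu_pos hκ hi).ne'
      field_simp
      ring
    · intro j hj hji
      rw [map_smul, divForm_apply, h.divPair_eq hi (Finset.mem_range.1 hj), if_neg hji.symm,
        smul_zero]
    · intro hi'
      exact absurd (Finset.mem_range.2 hi) hi'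
  -- the remainder has constant divergence, hence none; it is then orthogonal to itself
  obtain ⟨γ, hγ⟩ : ∃ γ, ∀ τ ∈ M.elems K, rtDiv (s τ) = γ := by
    refine exists_const_of_orthogonal (S := M.elems K) (a := fun τ => volume.real (M.tri τ))
      (p := p) (fun τ _ => volume_tri_pos τ) (fun j hj => ?_) (fun c hc j hj => ?_) fun j hj => ?_
    · rw [← qIntegral_eq]; exact h.mean_zero j hj
    · have h1 : qForm ρ (M.elems K) (∑ i ∈ Finset.range (M.cellDim K), c i • p i) (p j) = c j := by
        rw [map_sum, LinearMap.sum_apply, Finset.sum_eq_single j]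
        · rw [map_smul, LinearMap.smul_apply, qForm_apply, h.orthonormal j hj j hj]; simp
        · intro i hi hij
          rw [map_smul, LinearMap.smul_apply, qForm_apply,
            h.orthonormal i (Finset.mem_range.1 hi) j hj, if_neg hij, smul_zero]
        · intro hj'
          exact absurd (Finset.mem_range.2 hj) hj'
      rw [← h1, qForm_apply, qInner_eq]
      refine Finset.sum_eq_zero fun τ hτ => ?_
      have h2 := hc τ hτ
      have h3 : (∑ i ∈ Finset.range (M.cellDim K), c i • p i) τ = 0 := by
        rw [Finset.sum_apply]; exact h2
      rw [h3]; ring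
    · rw [← hdivs j hj, Mesh.divPair_eq]
      exact Finset.sum_congr rfl fun τ _ => by ring
  have hdiv0 : ∀ τ ∈ M.elems K, rtDiv (s τ) = 0 := by
    intro τ hτ
    have h1 := sum_rtDiv_eq_zero hs0
    rw [Finset.sum_congr rfl fun σ hσ => by rw [hγ σ hσ], ← Finset.sum_mul] at h1
    rw [hγ τ hτ]
    exact (mul_eq_zero.1 h1).resolve_left (sum_volume_tri_pos ⟨τ, hτ⟩).ne'
  have hss : vInner κ (M.elems K) s s = 0 := by
    have hs' : vForm hκ (M.elems K) s s = vForm hκ (M.elems K) r s -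
        vForm hκ (M.elems K) (∑ j ∈ Finset.range (M.cellDim K), d j • φ j) s := by
      rw [← LinearMap.sub_apply, ← map_sub]
    rw [← vForm_apply hκ, hs', map_sum, LinearMap.sum_apply, vForm_apply,
      horth s hs0 hdiv0, zero_sub, neg_eq_zero]
    refine Finset.sum_eq_zero fun j hj => ?_
    have hj := Finset.mem_range.1 hj
    have := h.eigen_v j hj s hs0
    rw [hdivs j hj, sub_zero] at this
    rw [map_smul, LinearMap.smul_apply, vForm_apply, this, smul_zero]
  intro τ hτ
  have h0 := eq_zero_of_vInner_eq_zero hκ hss τ hτ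
  rw [hs, Pi.sub_apply, sub_eq_zero, Finset.sum_apply] at h0
  exact h0

end CellBasis

/-! ### Traces on coarse edges -/

/-- The normal component of `v` on `E`, seen from `K`, has the values `t` on the fine edges. -/
def HasTrace (n : Plane) (v : M.VField) (K : M.Cell) (E : Sym2 Plane) (t : Sym2 Plane → ℝ) :
    Prop :=
  ∀ τi ∈ M.sidesOn K E, ∀ x ∈ seg (M.elemSide τi.1 τi.2),
    normalComp n v τi.1 x = t (M.elemSide τi.1 τi.2)

theorem exists_normalComp_eq {K : M.Cell} {k : Fin 3} {n : Plane} (hn : ‖n‖ = 1)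
    (hn' : ∀ a ∈ M.cellSide K k, ∀ b ∈ M.cellSide K k, ⟪n, b - a⟫ = 0) :
    ∃ s : ℝ, s ≠ 0 ∧ ∀ (v : M.VField), ∀ τi ∈ M.sidesOn K (M.cellSide K k), ∀ x,
      outflow v τi.1 τi.2 x = s * normalComp n v τi.1 x := by
  have h : ⟪n, splitVertex M.init K (k + 2) - splitVertex M.init K (k + 1)⟫ = 0 :=
    hn' _ (by simp [cellSide, side]) _ (by simp [cellSide, side])
  rcases outerNormal_eq_or_neg (M.cellAff K) k hn h with h | h
  · exact ⟨1, one_ne_zero, fun v τi hτi x => by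
      rw [outflow, outerNormal_of_mem_sidesOn hτi, h, normalComp, one_mul]⟩
  · exact ⟨-1, by norm_num, fun v τi hτi x => by
      rw [outflow, outerNormal_of_mem_sidesOn hτi, h, normalComp, inner_neg_right, neg_one_mul]⟩

theorem exists_hasTrace {K : M.Cell} {k : Fin 3} {n : Plane} (hn : ‖n‖ = 1)
    (hn' : ∀ a ∈ M.cellSide K k, ∀ b ∈ M.cellSide K k, ⟪n, b - a⟫ = 0) (v : M.VField) :
    ∃ t, HasTrace n v K (M.cellSide K k) t := by
  classical
  obtain ⟨s, hs, hout⟩ := exists_normalComp_eq hn hn'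
  refine ⟨fun e => ∑ τi ∈ (M.sidesOn K (M.cellSide K k)).filter
    (fun τi => M.elemSide τi.1 τi.2 = e), s⁻¹ * flow v τi, fun τi hτi x hx => ?_⟩
  have hfil : (M.sidesOn K (M.cellSide K k)).filter
      (fun σj => M.elemSide σj.1 σj.2 = M.elemSide τi.1 τi.2) = {τi} := by
    ext σj
    simp only [Finset.mem_filter, Finset.mem_singleton]
    constructor
    · rintro ⟨h1, h2⟩
      exact elemSide_injOn_sidesOn h1 hτi h2
    · rintro rfl
      exact ⟨hτi, rfl⟩
  dsimp only
  rw [hfil, Finset.sum_singleton]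
  have h1 := hout v τi hτi x
  rw [outflow_eq_flow v hx] at h1
  rw [show flow v τi = _ from h1, inv_mul_cancel_left₀ hs]

theorem edgeIntegral_eq {K : M.Cell} {k : Fin 3} {g : M.Elem → Plane → ℝ} {t : Sym2 Plane → ℝ}
    (h : ∀ τi ∈ M.sidesOn K (M.cellSide K k), ∀ x ∈ seg (M.elemSide τi.1 τi.2),
      g τi.1 x = t (M.elemSide τi.1 τi.2)) :
    M.edgeIntegral K (M.cellSide K k) g =
      ∑ e ∈ M.fineEdges (M.cellSide K k), edgeLength e * t e := by
  rw [← sum_sidesOn fun e => edgeLength e * t e]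
  exact Finset.sum_congr rfl fun τi hτi => sideIntegral_of_const (h τi hτi)

theorem edgeIntegral_mul {K : M.Cell} {k : Fin 3} {n : Plane} {v w : M.VField}
    {t u : Sym2 Plane → ℝ} (hv : HasTrace n v K (M.cellSide K k) t)
    (hw : HasTrace n w K (M.cellSide K k) u) :
    M.edgeIntegral K (M.cellSide K k) (fun τ x => normalComp n v τ x * normalComp n w τ x) =
      edgeForm (M.fineEdges (M.cellSide K k)) t u := by
  rw [edgeForm_apply, edgeIntegral_eq (t := fun e => t e * u e)]
  intro τi hτi x hx
  rw [hv τi hτi x hx, hw τi hτi x hx]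

theorem edgeLength_pos_of_mem {E e : Sym2 Plane} (he : e ∈ M.fineEdges E) : 0 < edgeLength e := by
  classical
  simp only [fineEdges, Finset.mem_filter, Finset.mem_image, Finset.mem_univ, true_and] at he
  obtain ⟨⟨τi, rfl⟩, -⟩ := he
  exact edgeLength_side_pos (M.elemAff _) _

theorem mem_patch_cellSide (K : M.Cell) (k : Fin 3) : K ∈ M.patch (M.cellSide K k) :=
  mem_patch.2 ⟨k, rfl⟩

theorem elems_subset_patchElems {K : M.Cell} {E : Sym2 Plane} (h : K ∈ M.patch E) :
    M.elems K ⊆ M.patchElems E := by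
  classical
  intro τ hτ
  simp only [patchElems, Finset.mem_biUnion]
  exact ⟨K, h, hτ⟩

/-! ### The spectral problem on a coarse edge -/

section EdgeBasis

variable {κ : Plane → ℝ} {n : Plane} {K : M.Cell} {k : Fin 3} {lam : ℕ → ℝ} {φ : ℕ → M.VField}

theorem IsEdgeEigenbasis.lam_pos (hκ : M.IsCoefficient κ)
    (h : IsEdgeEigenbasis κ n (M.cellSide K k) lam φ) {j : ℕ}
    (hj : j < M.edgeDim (M.cellSide K k)) : 0 < lam j := by
  have h1 := h.eigen j hj _ (h.snapshot j hj) K (mem_patch_cellSide K k)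
  rw [h.orthonormal j hj j hj K (mem_patch_cellSide K k), if_pos rfl] at h1
  have h2 := vInner_nonneg hκ (M.patchElems (M.cellSide K k)) (φ j)
  by_contra! hc
  nlinarith

theorem IsEdgeEigenbasis.vInner_eq (hκ : M.IsCoefficient κ)
    (h : IsEdgeEigenbasis κ n (M.cellSide K k) lam φ) {i j : ℕ}
    (hi : i < M.edgeDim (M.cellSide K k)) (hj : j < M.edgeDim (M.cellSide K k)) :
    vInner κ (M.patchElems (M.cellSide K k)) (φ i) (φ j) = if i = j then (lam i)⁻¹ else 0 := by
  have h1 := h.eigen i hi _ (h.snapshot j hj) K (mem_patch_cellSide K k)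
  rw [h.orthonormal i hi j hj K (mem_patch_cellSide K k)] at h1
  have h2 := (h.lam_pos hκ hi).ne'
  split_ifs with hij
  · rw [if_pos hij] at h1
    exact (eq_inv_of_mul_eq_one_right h1.symm)
  · rw [if_neg hij] at h1
    exact (mul_eq_zero.1 h1.symm).resolve_left h2

/-- The traces of the eigenfunctions. -/
theorem IsEdgeEigenbasis.exists_trace (h : IsEdgeEigenbasis κ n (M.cellSide K k) lam φ) :
    ∃ δ : ℕ → Sym2 Plane → ℝ, ∀ j < M.edgeDim (M.cellSide K k),
      ∑ e ∈ M.fineEdges (M.cellSide K k), edgeLength e * δ j e = 0 ∧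
        ∀ K' ∈ M.patch (M.cellSide K k),
          SolvesLocal κ n K' (M.cellSide K k) 0 (δ j) (φ j) := by
  have : ∀ j, ∃ δ : Sym2 Plane → ℝ, j < M.edgeDim (M.cellSide K k) →
      ∑ e ∈ M.fineEdges (M.cellSide K k), edgeLength e * δ e = 0 ∧
        ∀ K' ∈ M.patch (M.cellSide K k), SolvesLocal κ n K' (M.cellSide K k) 0 δ (φ j) := by
    intro j
    by_cases hj : j < M.edgeDim (M.cellSide K k)
    · obtain ⟨-, δ, h1, h2⟩ := h.snapshot j hj
      exact ⟨δ, fun _ => ⟨h1, h2⟩⟩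
    · exact ⟨0, fun hj' => absurd hj' hj⟩
  choose δ hδ using this
  exact ⟨δ, hδ⟩

theorem IsEdgeEigenbasis.edgeForm_eq (h : IsEdgeEigenbasis κ n (M.cellSide K k) lam φ)
    {δ : ℕ → Sym2 Plane → ℝ}
    (hδ : ∀ j < M.edgeDim (M.cellSide K k), HasTrace n (φ j) K (M.cellSide K k) (δ j)) {i j : ℕ}
    (hi : i < M.edgeDim (M.cellSide K k)) (hj : j < M.edgeDim (M.cellSide K k)) :
    edgeForm (M.fineEdges (M.cellSide K k)) (δ i) (δ j) = if i = j then 1 else 0 := by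
  rw [← edgeIntegral_mul (hδ i hi) (hδ j hj)]
  exact h.orthonormal i hi j hj K (mem_patch_cellSide K k)

/-- The trace of a field on a coarse edge is its mean plus its expansion in the eigenfunctions. -/
theorem IsEdgeEigenbasis.trace_expansion (h : IsEdgeEigenbasis κ n (M.cellSide K k) lam φ)
    {δ : ℕ → Sym2 Plane → ℝ}
    (hmean : ∀ j < M.edgeDim (M.cellSide K k),
      ∑ e ∈ M.fineEdges (M.cellSide K k), edgeLength e * δ j e = 0)
    (hδ : ∀ j < M.edgeDim (M.cellSide K k), HasTrace n (φ j) K (M.cellSide K k) (δ j))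
    {v : M.VField} {t : Sym2 Plane → ℝ} (ht : HasTrace n v K (M.cellSide K k) t) :
    ∀ e ∈ M.fineEdges (M.cellSide K k), t e = averageCoeff n v K (M.cellSide K k) +
      ∑ j ∈ Finset.range (M.edgeDim (M.cellSide K k)),
        edgeCoeff n v K (M.cellSide K k) (φ j) * δ j e := by
  set E := M.cellSide K k with hE
  set N := M.edgeDim E with hN
  set c : ℕ → ℝ := fun j => edgeCoeff n v K E (φ j) with hc
  have hcj : ∀ j < N, c j = edgeForm (M.fineEdges E) t (δ j) := fun j hj =>
    edgeIntegral_mul ht (hδ j hj)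
  set g : Sym2 Plane → ℝ := t - ∑ j ∈ Finset.range N, c j • δ j with hg
  have hge : ∀ e, g e = t e - ∑ j ∈ Finset.range N, c j * δ j e := fun e => by
    simp [hg, Finset.sum_apply]
  have hsum : ∀ (a : ℕ → ℝ), ∀ j < N,
      edgeForm (M.fineEdges E) (∑ i ∈ Finset.range N, a i • δ i) (δ j) = a j := by
    intro a j hj
    rw [map_sum, LinearMap.sum_apply, Finset.sum_eq_single j]
    · rw [map_smul, LinearMap.smul_apply, h.edgeForm_eq hδ hj hj]; simp
    · intro i hi hij
      rw [map_smul, LinearMap.smul_apply, h.edgeForm_eq hδ (Finset.mem_range.1 hi) hj, if_neg hij,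
        smul_zero]
    · intro hj'
      exact absurd (Finset.mem_range.2 hj) hj'
  have hgδ : ∀ j < N, edgeForm (M.fineEdges E) g (δ j) = 0 := by
    intro j hj
    rw [hg, map_sub, LinearMap.sub_apply, hsum c j hj, hcj j hj, sub_self]
  obtain ⟨γ, hγ⟩ : ∃ γ, ∀ e ∈ M.fineEdges E, g e = γ := by
    refine exists_const_of_orthogonal (p := δ) (fun e he => edgeLength_pos_of_mem he) hmean
      (fun a ha j hj => ?_) fun j hj => hgδ j hj
    rw [← hsum a j hj, edgeForm_apply]
    refine Finset.sum_eq_zero fun e he => ?_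
    have : (∑ i ∈ Finset.range N, a i • δ i) e = 0 := by
      rw [Finset.sum_apply]; exact ha e he
    rw [this]; ring
  have hpos : edgeLength E ≠ 0 := (edgeLength_side_pos (M.cellAff K) k).ne'
  have hγ' : γ = averageCoeff n v K E := by
    have h1 : ∑ e ∈ M.fineEdges E, edgeLength e * g e = edgeLength E * γ := by
      rw [hE, ← sum_edgeLength, Finset.sum_mul]
      exact Finset.sum_congr rfl fun e he => by rw [hγ e he]
    have h2 : ∑ e ∈ M.fineEdges E, edgeLength e * g e =
        ∑ e ∈ M.fineEdges E, edgeLength e * t e := by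
      simp only [hge, mul_sub, Finset.sum_sub_distrib, Finset.mul_sum]
      rw [Finset.sum_comm, sub_eq_self]
      refine Finset.sum_eq_zero fun j hj => ?_
      rw [← mul_zero (c j), ← hmean j (Finset.mem_range.1 hj), Finset.mul_sum]
      exact Finset.sum_congr rfl fun _ _ => by ring
    rw [averageCoeff, edgeIntegral_eq ht, ← h2, h1, inv_mul_cancel_left₀ hpos]
  intro e he
  have := hγ e he
  rw [hge, hγ'] at this
  linarith

/-- The part of the expansion on a coarse edge that is left out is controlled by the first
eigenvalue left out. -/
theorem IsEdgeEigenbasis.tail_le (hκ : M.IsCoefficient κ) (hn : ‖n‖ = 1)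
    (hn' : ∀ a ∈ M.cellSide K k, ∀ b ∈ M.cellSide K k, ⟪n, b - a⟫ = 0)
    (h : IsEdgeEigenbasis κ n (M.cellSide K k) lam φ) (v : M.VField) (m : ℕ) :
    vInner κ (M.elems K)
        (∑ j ∈ Finset.Ico m (M.edgeDim (M.cellSide K k)),
          edgeCoeff n v K (M.cellSide K k) (φ j) • φ j)
        (∑ j ∈ Finset.Ico m (M.edgeDim (M.cellSide K k)),
          edgeCoeff n v K (M.cellSide K k) (φ j) • φ j) ≤
      invNext (M.edgeDim (M.cellSide K k)) lam m *
        M.edgeIntegral K (M.cellSide K k) fun τ x => normalComp n v τ x ^ 2 := by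
  obtain ⟨δ, hδ⟩ := h.exists_trace
  obtain ⟨t, ht⟩ := exists_hasTrace hn hn' v
  set E := M.cellSide K k with hE
  set N := M.edgeDim E with hN
  have htr : ∀ j < N, HasTrace n (φ j) K E (δ j) := fun j hj =>
    ((hδ j hj).2 K (mem_patch_cellSide K k)).normal_on
  have hIco : ∀ j ∈ Finset.Ico m N, j < N := fun j hj => (Finset.mem_Ico.1 hj).2
  refine (vInner_mono hκ (elems_subset_patchElems (mem_patch_cellSide K k)) _).trans ?_
  rw [← vForm_apply hκ, form_sum_orthogonal (g := fun j => (lam j)⁻¹) fun i hi j hj =>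
    h.vInner_eq hκ (hIco i hi) (hIco j hj)]
  have hbes := form_bessel (edgeForm_comm (M.fineEdges E)) (edgeForm_nonneg _)
    (s := Finset.Ico m N) (e := δ) (fun i hi j hj => h.edgeForm_eq htr (hIco i hi) (hIco j hj)) t
  have hen : M.edgeIntegral K E (fun τ x => normalComp n v τ x ^ 2) =
      edgeForm (M.fineEdges E) t t := by
    simp only [sq]
    exact edgeIntegral_mul ht ht
  rw [hen]
  calc ∑ j ∈ Finset.Ico m N, edgeCoeff n v K E (φ j) ^ 2 * (lam j)⁻¹
      ≤ ∑ j ∈ Finset.Ico m N, invNext N lam m * edgeForm (M.fineEdges E) t (δ j) ^ 2 := by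
        refine Finset.sum_le_sum fun j hj => ?_
        rw [show edgeCoeff n v K E (φ j) = _ from edgeIntegral_mul ht (htr j (hIco j hj)), mul_comm]
        exact mul_le_mul_of_nonneg_right (le_invNext h.mono (fun j hj => h.lam_pos hκ hj) hj)
          (sq_nonneg _)
    _ ≤ _ := by
        rw [← Finset.mul_sum]
        exact mul_le_mul_of_nonneg_left hbes (invNext_nonneg fun j hj => h.lam_pos hκ hj)

end EdgeBasis

/-! ### Consequences of the equations of the reference solution -/

theorem vInner_univ_of_localZero {κ : Plane → ℝ} {K : M.Cell} (v : M.VField) {w : M.VField}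
    (hw : IsLocalZero K w) : vInner κ Finset.univ v w = vInner κ (M.elems K) v w := by
  refine (Finset.sum_subset (Finset.subset_univ _) fun τ _ hτ => ?_).symm
  simp [hw.2.1 τ hτ, rt]

theorem divPair_eq_zero {A : Finset M.Elem} {w : M.VField} (h : ∀ τ ∈ A, rtDiv (w τ) = 0)
    (q : M.QField) : divPair A q w = 0 := by
  rw [divPair_eq]
  exact Finset.sum_eq_zero fun τ hτ => by rw [h τ hτ]; ring

section Reference

variable {κ ρ : Plane → ℝ} {f : ℝ → Plane → ℝ} {T : ℝ} {v v' : ℝ → M.VField}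
  {pI pI' : ℝ → M.QField} {pB pB' : ℝ → M.BField}

/-- The velocity remains orthogonal to the local divergence-free fields, as its time derivative
is. -/
theorem IsReferenceSolution.orthogonal (hκ : M.IsCoefficient κ) (hT : 0 < T)
    (h : IsReferenceSolution κ ρ f T v v' pI pI' pB pB') {K : M.Cell} {w : M.VField}
    (hw : IsLocalZero K w) (hdiv : ∀ τ ∈ M.elems K, rtDiv (w τ) = 0) {t : ℝ} (ht : t ∈ Icc 0 T) :
    vInner κ (M.elems K) (v t) w = 0 := by
  have hdiv' : ∀ τ ∈ Finset.univ, rtDiv (w τ) = 0 := by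
    intro τ _
    by_cases hτ : τ ∈ M.elems K
    · exact hdiv τ hτ
    · simp [hw.2.1 τ hτ, rtDiv]
  let l : M.VField →L[ℝ] ℝ := ((vForm hκ Finset.univ).flip w).toContinuousLinearMap
  have hl : ∀ u, l u = vInner κ Finset.univ u w := fun u => rfl
  have hd : ∀ s ∈ Icc 0 T, HasDerivWithinAt (fun s => l (v s)) 0 (Icc 0 T) s := by
    intro s hs
    have h1 := l.hasFDerivAt.comp_hasDerivWithinAt s (h.hasDeriv_v s hs)
    have h2 : l (v' s) = 0 := by
      have := h.eq_v s hs w hw.isVelocity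
      rw [hw.jumpPair_eq_zero, divPair_eq_zero hdiv'] at this
      rw [hl]; linarith
    rwa [h2] at h1
  have hconst := constant_of_derivWithin_zero (fun s hs => (hd s hs).differentiableWithinAt)
    (fun s hs => (hd s ⟨hs.1, hs.2.le⟩).derivWithin
      (uniqueDiffOn_Icc hT s ⟨hs.1, hs.2.le⟩)) t ht
  simp only [h.init_v, map_zero] at hconst
  rw [← vInner_univ_of_localZero _ hw, ← hl, hconst]

theorem p1_zero (x : Plane) : p1 0 x = 0 := by simp [p1]

theorem isPenalty_zero : IsPenalty (0 : M.BField) where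
  support _ _ := rfl
  mean_zero _ := by simp [p1_zero]
  const _ _ _ := ⟨0, by simp [p1_zero]⟩
  continuous _ _ _ _ _ _ _ _ := rfl
  boundary _ _ _ _ _ _ := p1_zero _

theorem jumpPair_zero (w : M.VField) : M.jumpPair 0 w = 0 :=
  Finset.sum_eq_zero fun τi _ => sideIntegral_eq_zero fun x _ => by
    rw [Pi.zero_apply, p1_zero, zero_mul]

/-- The equation for the divergence on one fine element. -/
theorem IsReferenceSolution.divergence (hρ : M.IsCoefficient ρ)
    (h : IsReferenceSolution κ ρ f T v v' pI pI' pB pB') {t : ℝ} (ht : t ∈ Icc 0 T)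
    (hf : MemLp (f t) 2 (volume.restrict M.domain)) (τ : M.Elem) :
    volume.real (M.tri τ) * rtDiv (v t τ) =
      ∫ x in M.tri τ, (f t x - ρ x * pressure (pI' t) (pB' t) τ x) := by
  classical
  -- the pressure equation is tested with the indicator function of `τ`
  have h1 := h.eq_p t ht (Pi.single τ 1) 0 isPenalty_zero
  have hP : ∀ σ x, pressure (Pi.single τ (1 : ℝ) : M.QField) 0 σ x = if σ = τ then 1 else 0 := by
    intro σ x
    simp [pressure, p1_zero, Pi.single_apply]
  simp only [hP] at h1
  rw [jumpPair_zero, divPair_eq, Finset.sum_eq_single τ, Finset.sum_eq_single τ,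
    Finset.sum_eq_single τ] at h1
  · simp only [if_true, mul_one, Pi.single_eq_same, one_mul, sub_zero] at h1
    rw [integral_sub, ← h1]
    · ring
    · have hf' : MemLp (f t) 2 (volume.restrict (M.tri τ)) :=
        hf.mono_measure (Measure.restrict_mono (tri_subset_domain τ) le_rfl)
      have : IsFiniteMeasure (volume.restrict (M.tri τ)) :=
        ⟨by rw [Measure.restrict_apply_univ]; exact (isCompact_hull _).measure_lt_top⟩
      exact hf'.integrable one_le_two
    · refine hρ.integrableOn_mul (integrableOn_of_continuous ?_ τ)
      unfold pressure p1
      fun_prop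
  all_goals simp +contextual

/-- The Cauchy–Schwarz inequality on one fine element. -/
theorem sq_integral_div_le (hρ : M.IsCoefficient ρ) {g : Plane → ℝ} {P : Plane → ℝ}
    (hg : MemLp g 2 (volume.restrict M.domain)) (hP : Continuous P) (τ : M.Elem) :
    (∫ x in M.tri τ, (g x - ρ x * P x)) ^ 2 / (∫ x in M.tri τ, ρ x) ≤
      ∫ x in M.tri τ, ρ x * ((ρ x)⁻¹ * g x - P x) ^ 2 := by
  obtain ⟨hm, a, b, ha, hab⟩ := hρ.tri τ
  have : IsFiniteMeasure (volume.restrict (M.tri τ)) :=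
    ⟨by rw [Measure.restrict_apply_univ]; exact (isCompact_hull _).measure_lt_top⟩
  set R := ∫ x in M.tri τ, ρ x with hR
  have hRpos : 0 < R := integral_coeff_pos hρ τ
  set F : Plane → ℝ := fun x => (ρ x)⁻¹ * g x - P x with hF
  have hg' : MemLp g 2 (volume.restrict (M.tri τ)) :=
    hg.mono_measure (Measure.restrict_mono (tri_subset_domain τ) le_rfl)
  have hP' : MemLp P 2 (volume.restrict (M.tri τ)) := by
    obtain ⟨c, hc⟩ := (isCompact_hull (M.fine.vertex τ)).exists_bound_of_continuousOn hP.continuousOn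
    exact MemLp.of_bound hP.aestronglyMeasurable c
      ((ae_restrict_iff' (isClosed_hull _).measurableSet).2 (.of_forall hc))
  have hinv : MemLp (fun x => (ρ x)⁻¹ * g x) 2 (volume.restrict (M.tri τ)) := by
    refine hg'.of_le_mul (c := a⁻¹)
      (hm.aemeasurable.inv.aestronglyMeasurable.mul hg'.aestronglyMeasurable) ?_
    filter_upwards [hab] with x hx
    rw [norm_mul]
    refine mul_le_mul_of_nonneg_right ?_ (norm_nonneg _)
    rw [norm_inv, Real.norm_of_nonneg (ha.le.trans hx.1)]
    exact inv_anti₀ ha hx.1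
  have hFL : MemLp F 2 (volume.restrict (M.tri τ)) := hinv.sub hP'
  have hF1 : IntegrableOn F (M.tri τ) := hFL.integrable one_le_two
  have hF2 : IntegrableOn (fun x => F x ^ 2) (M.tri τ) := hFL.integrable_sq
  have h1 := hρ.integrableOn_mul hF1
  have h2 := hρ.integrableOn_mul hF2
  have h3 : IntegrableOn ρ (M.tri τ) := by
    have := hρ.integrableOn_mul (integrableOn_of_continuous (continuous_const (y := (1 : ℝ))) τ)
    simpa using this
  have hG : ∫ x in M.tri τ, (g x - ρ x * P x) = ∫ x in M.tri τ, ρ x * F x := by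
    refine integral_congr_ae ?_
    filter_upwards [hab] with x hx
    have : ρ x ≠ 0 := (ha.trans_le hx.1).ne'
    simp only [hF]
    field_simp
  rw [hG]
  set G := ∫ x in M.tri τ, ρ x * F x with hGdef
  -- `G / R` is the weighted mean of `F`
  have h4 : 0 ≤ ∫ x in M.tri τ, ρ x * (F x - G / R) ^ 2 := by
    refine integral_nonneg_of_ae ?_
    filter_upwards [hab] with x hx
    exact mul_nonneg (ha.le.trans hx.1) (sq_nonneg _)
  have h5 : ∫ x in M.tri τ, ρ x * (F x - G / R) ^ 2 =
      (∫ x in M.tri τ, ρ x * F x ^ 2) - 2 * (G / R) * G + (G / R) ^ 2 * R := by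
    have : ∀ x, ρ x * (F x - G / R) ^ 2 =
        (ρ x * F x ^ 2 - 2 * (G / R) * (ρ x * F x)) + (G / R) ^ 2 * ρ x := fun x => by ring
    simp only [this]
    have h2' : IntegrableOn (fun x => ρ x * F x ^ 2 - 2 * (G / R) * (ρ x * F x)) (M.tri τ) :=
      h2.sub (h1.const_mul _)
    rw [integral_add h2' (h3.const_mul _), integral_sub h2 (h1.const_mul _), integral_const_mul,
      integral_const_mul]
  rw [h5] at h4
  have h6 : 2 * (G / R) * G - (G / R) ^ 2 * R = G ^ 2 / R := by
    field_simp; ring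
  linarith

theorem continuous_pressure (pI : M.QField) (pB : M.BField) (τ : M.Elem) :
    Continuous (pressure pI pB τ) := by
  unfold pressure p1
  fun_prop

/-- The part of the expansion on a coarse element that is left out is controlled by the first
eigenvalue left out and the residual of the pressure equation. -/
theorem IsCellEigenbasis.tail_le {K : M.Cell} {mu : ℕ → ℝ} {φ : ℕ → M.VField} {p : ℕ → M.QField}
    (hκ : M.IsCoefficient κ) (hρ : M.IsCoefficient ρ) (hb : IsCellEigenbasis κ ρ K mu φ p)
    (h : IsReferenceSolution κ ρ f T v v' pI pI' pB pB') {t : ℝ} (ht : t ∈ Icc 0 T)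
    (hf : MemLp (f t) 2 (volume.restrict M.domain)) (m : ℕ) :
    vInner κ (M.elems K)
        (∑ j ∈ Finset.Ico m (M.cellDim K), ((mu j)⁻¹ * divPair (M.elems K) (p j) (v t)) • φ j)
        (∑ j ∈ Finset.Ico m (M.cellDim K), ((mu j)⁻¹ * divPair (M.elems K) (p j) (v t)) • φ j) ≤
      invNext (M.cellDim K) mu m * ∑ τ ∈ M.elems K, ∫ x in M.tri τ,
        ρ x * ((ρ x)⁻¹ * f t x - pressure (pI' t) (pB' t) τ x) ^ 2 := by
  have hIco : ∀ j ∈ Finset.Ico m (M.cellDim K), j < M.cellDim K := fun j hj =>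
    (Finset.mem_Ico.1 hj).2
  set G : M.Elem → ℝ := fun τ => ∫ x in M.tri τ, (f t x - ρ x * pressure (pI' t) (pB' t) τ x)
    with hG
  -- the Riesz representation of the residual for the weighted inner product
  set b : M.QField := fun τ => G τ / ∫ x in M.tri τ, ρ x with hbdef
  have hR : ∀ τ : M.Elem, (∫ x in M.tri τ, ρ x) ≠ 0 := fun τ => (integral_coeff_pos hρ τ).ne'
  have hdiv : ∀ q : M.QField, divPair (M.elems K) q (v t) = qForm ρ (M.elems K) b q := by
    intro q
    rw [qForm_apply, qInner_eq, Mesh.divPair_eq]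
    refine Finset.sum_congr rfl fun τ _ => ?_
    have h1 := h.divergence hρ ht hf τ
    have h2 : (∫ x in M.tri τ, ρ x) * b τ = G τ := mul_div_cancel₀ _ (hR τ)
    calc volume.real (M.tri τ) * (q τ * rtDiv (v t τ))
        = (volume.real (M.tri τ) * rtDiv (v t τ)) * q τ := by ring
      _ = ((∫ x in M.tri τ, ρ x) * b τ) * q τ := by rw [h1, h2]
      _ = _ := by ring
  rw [← vForm_apply hκ, form_sum_orthogonal (g := mu) fun i hi j hj =>
    hb.vInner_eq (hIco i hi) (hIco j hj)]
  have hbes := form_bessel (qForm_comm ρ (M.elems K)) (qForm_nonneg hρ _)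
    (s := Finset.Ico m (M.cellDim K)) (e := p)
    (fun i hi j hj => hb.orthonormal i (hIco i hi) j (hIco j hj)) b
  have hnn : 0 ≤ invNext (M.cellDim K) mu m := invNext_nonneg fun j hj => hb.mu_pos hκ hj
  calc ∑ j ∈ Finset.Ico m (M.cellDim K),
        ((mu j)⁻¹ * divPair (M.elems K) (p j) (v t)) ^ 2 * mu j
      ≤ ∑ j ∈ Finset.Ico m (M.cellDim K),
          invNext (M.cellDim K) mu m * qForm ρ (M.elems K) b (p j) ^ 2 := by
        refine Finset.sum_le_sum fun j hj => ?_
        have hmu := (hb.mu_pos hκ (hIco j hj)).ne'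
        have : ((mu j)⁻¹ * divPair (M.elems K) (p j) (v t)) ^ 2 * mu j =
            (mu j)⁻¹ * qForm ρ (M.elems K) b (p j) ^ 2 := by
          rw [hdiv]; field_simp
        rw [this]
        exact mul_le_mul_of_nonneg_right
          (le_invNext hb.mono (fun j hj => hb.mu_pos hκ hj) hj) (sq_nonneg _)
    _ ≤ invNext (M.cellDim K) mu m * qForm ρ (M.elems K) b b := by
        rw [← Finset.mul_sum]
        exact mul_le_mul_of_nonneg_left hbes hnn
    _ ≤ _ := by
        refine mul_le_mul_of_nonneg_left ?_ hnn
        rw [qForm_apply, qInner_eq]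
        refine Finset.sum_le_sum fun τ _ => ?_
        refine le_trans (le_of_eq ?_) (sq_integral_div_le hρ hf (continuous_pressure _ _ τ) τ)
        have := hR τ
        simp only [hbdef, hG]
        field_simp

end Reference

/-! ### The expansion on one coarse element -/

open Classical in
/-- The edges of the coarse element `K`. -/
noncomputable def cellEdges (K : M.Cell) : Finset (Sym2 Plane) :=
  M.coarseEdges.filter fun E => K ∈ M.patch E

theorem mem_cellEdges {K : M.Cell} {E : Sym2 Plane} :
    E ∈ cellEdges K ↔ E ∈ M.coarseEdges ∧ K ∈ M.patch E := by
  simp [cellEdges]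

theorem exists_of_mem_cellEdges {K : M.Cell} {E : Sym2 Plane} (h : E ∈ cellEdges K) :
    ∃ k, M.cellSide K k = E :=
  mem_patch.1 (mem_cellEdges.1 h).2

theorem cellSide_mem_cellEdges (K : M.Cell) (k : Fin 3) : M.cellSide K k ∈ cellEdges K :=
  mem_cellEdges.2 ⟨cellSide_mem_coarseEdges K k, mem_patch_cellSide K k⟩

theorem card_cellEdges_le (K : M.Cell) : (cellEdges K).card ≤ 3 := by
  classical
  have : cellEdges K ⊆ Finset.univ.image (M.cellSide K) := by
    intro E hE
    obtain ⟨k, rfl⟩ := exists_of_mem_cellEdges hE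
    exact Finset.mem_image_of_mem _ (Finset.mem_univ k)
  exact (Finset.card_le_card this).trans (Finset.card_image_le.trans (by simp))

section Local

variable {κ ρ : Plane → ℝ}

theorem SolvesLocal.orthogonal {n : Plane} {K : M.Cell} {E : Sym2 Plane} {c : ℝ}
    {δ : Sym2 Plane → ℝ} {ψ : M.VField} (h : SolvesLocal κ n K E c δ ψ) {w : M.VField}
    (hw : IsLocalZero K w) (hdiv : ∀ τ ∈ M.elems K, rtDiv (w τ) = 0) :
    vInner κ (M.elems K) ψ w = 0 := by
  obtain ⟨q, hq⟩ := h.eq_v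
  have := hq w hw
  rwa [divPair_eq_zero hdiv, sub_zero] at this

theorem SolvesLocal.divPair_eq_zero {n : Plane} {K : M.Cell} {E : Sym2 Plane} {c : ℝ}
    {δ : Sym2 Plane → ℝ} {ψ : M.VField} (h : SolvesLocal κ n K E c δ ψ) {q : M.QField}
    (hq : qIntegral (M.elems K) q = 0) : divPair (M.elems K) q ψ = 0 := by
  rw [h.eq_div, qIntegral_eq, ← mul_zero c, ← hq, qIntegral_eq, Finset.mul_sum]
  exact Finset.sum_congr rfl fun τ _ => by ring

theorem SolvesLocal.flow_off {n : Plane} {K : M.Cell} {E : Sym2 Plane} {c : ℝ}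
    {δ : Sym2 Plane → ℝ} {ψ : M.VField} (h : SolvesLocal κ n K E c δ ψ) {k : Fin 3}
    (hk : M.cellSide K k ≠ E) {τi : M.Elem × Fin 3} (hτi : τi ∈ M.sidesOn K (M.cellSide K k)) :
    flow ψ τi = 0 :=
  h.normal_off k hk τi hτi _ (mid_mem_seg _ _)

variable {n : Sym2 Plane → Plane} {φ₁ : Sym2 Plane → M.VField} {lam : Sym2 Plane → ℕ → ℝ}
  {φ₂ : Sym2 Plane → ℕ → M.VField}

/-- The part of the expansion on the coarse element `K` that belongs to its edges. -/
noncomputable def edgePart (n : Sym2 Plane → Plane) (φ₁ : Sym2 Plane → M.VField)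
    (φ₂ : Sym2 Plane → ℕ → M.VField) (nE : Sym2 Plane → ℕ) (v : M.VField) (K : M.Cell) :
    M.VField :=
  ∑ E ∈ cellEdges K, (averageCoeff (n E) v K E • φ₁ E +
    ∑ j ∈ Finset.range (nE E), edgeCoeff (n E) v K E (φ₂ E j) • φ₂ E j)

/-- The edge part has the same flow through the boundary of `K` as the field itself. -/
theorem flow_edgePart (hn : M.IsEdgeNormal n)
    (h₁ : ∀ E ∈ M.coarseEdges, IsFirstBasis κ (n E) E (φ₁ E))
    (h₂ : ∀ E ∈ M.coarseEdges, IsEdgeEigenbasis κ (n E) E (lam E) (φ₂ E))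
    (v : M.VField) {K : M.Cell} {k : Fin 3} {τi : M.Elem × Fin 3}
    (hτi : τi ∈ M.sidesOn K (M.cellSide K k)) :
    flow (edgePart n φ₁ φ₂ M.edgeDim v K) τi = flow v τi := by
  classical
  have hE : M.cellSide K k ∈ M.coarseEdges := cellSide_mem_coarseEdges K k
  obtain ⟨s, -, hs⟩ := exists_normalComp_eq (hn _ hE).1 (hn _ hE).2
  obtain ⟨t, ht⟩ := exists_hasTrace (hn _ hE).1 (hn _ hE).2 v
  obtain ⟨δ, hδ⟩ := (h₂ _ hE).exists_trace
  have hfl : ∀ (u : M.VField) (c : Sym2 Plane → ℝ), HasTrace (n (M.cellSide K k)) u K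
      (M.cellSide K k) c → flow u τi = s * c (M.elemSide τi.1 τi.2) := fun u c hu => by
    rw [← hu τi hτi _ (mid_mem_seg _ _)]
    exact hs u τi hτi _
  rw [← flowL_apply, edgePart, map_sum, Finset.sum_eq_single (M.cellSide K k)]
  · have hex := (h₂ _ hE).trace_expansion (fun j hj => (hδ j hj).1)
      (fun j hj => ((hδ j hj).2 K (mem_patch_cellSide K k)).normal_on) ht (M.elemSide τi.1 τi.2) (by
        simp only [fineEdges, Finset.mem_filter, Finset.mem_image, Finset.mem_univ, true_and]
        exact ⟨⟨τi, rfl⟩, (mem_sidesOn.1 hτi).2⟩)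
    rw [hfl v t ht, hex, map_add, map_smul, map_sum, flowL_apply,
      hfl _ (fun _ => 1) ((h₁ _ hE).2 K k rfl).normal_on, mul_add, Finset.mul_sum, smul_eq_mul]
    congr 1
    · ring
    · refine Finset.sum_congr rfl fun j hj => ?_
      rw [map_smul, flowL_apply,
        hfl _ _ ((hδ j (Finset.mem_range.1 hj)).2 K (mem_patch_cellSide K k)).normal_on,
        smul_eq_mul]
      ring
  · intro E hEK hne
    obtain ⟨l, rfl⟩ := exists_of_mem_cellEdges hEK
    have hE' : M.cellSide K l ∈ M.coarseEdges := cellSide_mem_coarseEdges K l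
    obtain ⟨δ', hδ'⟩ := (h₂ _ hE').exists_trace
    rw [map_add, map_smul, map_sum, flowL_apply,
      ((h₁ _ hE').2 K l rfl).flow_off hne.symm hτi, smul_zero, zero_add]
    refine Finset.sum_eq_zero fun j hj => ?_
    rw [map_smul, flowL_apply,
      ((hδ' j (Finset.mem_range.1 hj)).2 K (mem_patch_cellSide K l)).flow_off hne.symm hτi,
      smul_zero]
  · intro hE'
    exact absurd (cellSide_mem_cellEdges K k) hE'

/-- A linear condition that holds for all basis functions of the edges of `K` holds for the edge
part. -/
theorem edgePart_mem (h₁ : ∀ E ∈ M.coarseEdges, IsFirstBasis κ (n E) E (φ₁ E))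
    (h₂ : ∀ E ∈ M.coarseEdges, IsEdgeEigenbasis κ (n E) E (lam E) (φ₂ E))
    (v : M.VField) {K : M.Cell} (W : Submodule ℝ M.VField)
    (hW : ∀ m E c δ ψ, SolvesLocal κ m K E c δ ψ → ψ ∈ W) :
    edgePart n φ₁ φ₂ M.edgeDim v K ∈ W := by
  refine Submodule.sum_mem _ fun E hEK => ?_
  obtain ⟨k, rfl⟩ := exists_of_mem_cellEdges hEK
  have hE : M.cellSide K k ∈ M.coarseEdges := cellSide_mem_coarseEdges K k
  obtain ⟨δ, hδ⟩ := (h₂ _ hE).exists_trace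
  refine W.add_mem (W.smul_mem _ (hW _ _ _ _ _ ((h₁ _ hE).2 K k rfl)))
    (Submodule.sum_mem _ fun j hj => W.smul_mem _ ?_)
  exact hW _ _ _ _ _ ((hδ j (Finset.mem_range.1 hj)).2 K (mem_patch_cellSide K k))

/-- The full expansion on one coarse element. -/
theorem local_expansion (hκ : M.IsCoefficient κ) (hn : M.IsEdgeNormal n)
    (h₁ : ∀ E ∈ M.coarseEdges, IsFirstBasis κ (n E) E (φ₁ E))
    (h₂ : ∀ E ∈ M.coarseEdges, IsEdgeEigenbasis κ (n E) E (lam E) (φ₂ E))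
    {K : M.Cell} {mu : ℕ → ℝ} {φ₃ : ℕ → M.VField} {p : ℕ → M.QField}
    (h₃ : IsCellEigenbasis κ ρ K mu φ₃ p) {v : M.VField} (hv : IsLocal K v)
    (horth : ∀ w, IsLocalZero K w → (∀ τ ∈ M.elems K, rtDiv (w τ) = 0) →
      vInner κ (M.elems K) v w = 0) :
    ∀ τ ∈ M.elems K, v τ = edgePart n φ₁ φ₂ M.edgeDim v K τ +
      ∑ j ∈ Finset.range (M.cellDim K),
        ((mu j)⁻¹ * divPair (M.elems K) (p j) v) • φ₃ j τ := by
  classical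
  set S := edgePart n φ₁ φ₂ M.edgeDim v K with hS
  set r : M.VField := fun τ => if τ ∈ M.elems K then (v - S) τ else 0 with hr
  have hrK : ∀ τ ∈ M.elems K, r τ = (v - S) τ := fun τ hτ => by rw [hr]; exact if_pos hτ
  have hSloc : IsLocal K S :=
    edgePart_mem h₁ h₂ v (M.localSubmodule K) fun _ _ _ _ _ h => h.isLocal
  have hr0 : IsLocalZero K r := by
    refine isLocalZero_iff.2 ⟨?_, fun τ hτ => by rw [hr]; exact if_neg hτ, fun k τi hτi => ?_⟩
    · exact isLocal_congr (fun τ hτ => (hrK τ hτ).symm) ((M.localSubmodule K).sub_mem hv hSloc)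
    · rw [flow_congr (hrK _ (mem_sidesOn.1 hτi).1), ← flowL_apply, map_sub, flowL_apply,
        flowL_apply, hS, flow_edgePart hn h₁ h₂ v hτi, sub_self]
  have hrorth : ∀ w, IsLocalZero K w → (∀ τ ∈ M.elems K, rtDiv (w τ) = 0) →
      vInner κ (M.elems K) r w = 0 := by
    intro w hw hdiv
    have hSw : S ∈ LinearMap.ker ((vForm hκ (M.elems K)).flip w) :=
      edgePart_mem h₁ h₂ v _ fun _ _ _ _ _ h => h.orthogonal hw hdiv
    have hSw : vForm hκ (M.elems K) S w = 0 := hSw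
    rw [vInner_congr (w' := w) hrK fun _ _ => rfl, ← vForm_apply hκ, map_sub, LinearMap.sub_apply,
      hSw, vForm_apply, horth w hw hdiv, sub_zero]
  have hdivr : ∀ j < M.cellDim K, divPair (M.elems K) (p j) r = divPair (M.elems K) (p j) v := by
    intro j hj
    have hSp : S ∈ LinearMap.ker (divForm (M.elems K) (p j)) :=
      edgePart_mem h₁ h₂ v _ fun _ _ _ _ _ h => h.divPair_eq_zero (h₃.mean_zero j hj)
    have hSp : divForm (M.elems K) (p j) S = 0 := hSp
    have h1 : divPair (M.elems K) (p j) r = divPair (M.elems K) (p j) (v - S) :=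
      Finset.sum_congr rfl fun τ hτ => by rw [hrK τ hτ]
    rw [h1, ← divForm_apply, map_sub, hSp, sub_zero, divForm_apply]
  intro τ hτ
  have h := h₃.expansion hκ hr0 hrorth τ hτ
  rw [hrK τ hτ, Pi.sub_apply, sub_eq_iff_eq_add, add_comm] at h
  rw [h]
  congr 1
  exact Finset.sum_congr rfl fun j hj => by rw [hdivr j (Finset.mem_range.1 hj)]

/-- The value of the expansion on a fine element only involves its coarse element. -/
theorem expansion_apply (n : Sym2 Plane → Plane) (φ₁ : Sym2 Plane → M.VField)
    (φ₂ : Sym2 Plane → ℕ → M.VField) (φ₃ : M.Cell → ℕ → M.VField) (nE : Sym2 Plane → ℕ)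
    (mK : M.Cell → ℕ) (v : M.VField) (d : M.Cell → ℕ → ℝ) {K : M.Cell} {τ : M.Elem}
    (hτ : τ ∈ M.elems K) :
    expansion n φ₁ φ₂ φ₃ nE mK v d τ =
      edgePart n φ₁ φ₂ nE v K τ + ∑ j ∈ Finset.range (mK K), d K j • φ₃ K j τ := by
  classical
  unfold expansion
  rw [Finset.sum_eq_single K]
  · simp only [edgePart, cellEdges, Finset.sum_apply, Pi.add_apply, Pi.smul_apply]
  · intro K' hK' hne
    exact absurd (cell_unique (Finset.mem_filter.1 hK').2 hτ) hne
  · intro h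
    exact absurd (by simpa using hτ) h

theorem sum_univ_eq_sum_elems (X : M.Elem → ℝ) : ∑ τ, X τ = ∑ K, ∑ τ ∈ M.elems K, X τ := by
  classical
  have : (Finset.univ : Finset M.Elem) = Finset.univ.biUnion M.elems := by
    ext τ
    obtain ⟨K, hK⟩ := exists_mem_elems τ
    simp only [Finset.mem_univ, Finset.mem_biUnion, true_and, true_iff]
    exact ⟨K, hK⟩
  rw [this, Finset.sum_biUnion]
  intro K _ K' _ hne
  exact Finset.disjoint_left.2 fun τ h h' => hne (cell_unique h h')

theorem edgeIntegral_sq_nonneg (m : Plane) (v : M.VField) (K : M.Cell) (E : Sym2 Plane) :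
    0 ≤ M.edgeIntegral K E fun τ x => normalComp m v τ x ^ 2 :=
  Finset.sum_nonneg fun _ _ => mul_nonneg dist_nonneg
    (intervalIntegral.integral_nonneg zero_le_one fun _ _ => sq_nonneg _)

/-- The one-sided energies add up to at most twice their mean. -/
theorem sum_edgeIntegral_le (m : Plane) (v : M.VField) (E : Sym2 Plane) :
    ∑ K ∈ M.patch E, M.edgeIntegral K E (fun τ x => normalComp m v τ x ^ 2) ≤
      2 * edgeEnergy m v E := by
  set X := ∑ K ∈ M.patch E, M.edgeIntegral K E (fun τ x => normalComp m v τ x ^ 2) with hX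
  have hX0 : 0 ≤ X := Finset.sum_nonneg fun K _ => edgeIntegral_sq_nonneg m v K E
  have hen : edgeEnergy m v E = ((M.patch E).card : ℝ)⁻¹ * X := rfl
  rcases (M.patch E).eq_empty_or_nonempty with h | h
  · have : X = 0 := by rw [hX, h, Finset.sum_empty]
    rw [hen, this]; simp
  · have h1 : (0 : ℝ) < (M.patch E).card := by exact_mod_cast h.card_pos
    have h2 : ((M.patch E).card : ℝ) ≤ 2 := by exact_mod_cast card_patch_le E
    rw [hen, ← mul_assoc]
    have h3 : 1 ≤ 2 * ((M.patch E).card : ℝ)⁻¹ := by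
      rw [← div_eq_mul_inv, le_div_iff₀ h1]; linarith
    nlinarith

end Local

end Mesh

end MixedGMsFEM

theorem mainTheorem3 :
    ∃ C : ℝ, 0 < C ∧
      ∀ (M : Mesh) (κ ρ : Plane → ℝ) (_ : M.IsCoefficient κ) (_ : M.IsCoefficient ρ)
        (T : ℝ) (_ : 0 < T) (f : ℝ → Plane → ℝ)
        (_ : ∀ t ∈ Icc 0 T, MemLp (f t) 2 (volume.restrict M.domain))
        (v v' : ℝ → M.VField) (pI pI' : ℝ → M.QField) (pB pB' : ℝ → M.BField)
        (_ : Mesh.IsReferenceSolution κ ρ f T v v' pI pI' pB pB')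
        (n : Sym2 Plane → Plane) (_ : M.IsEdgeNormal n)
        (φ₁ : Sym2 Plane → M.VField)
        (_ : ∀ E ∈ M.coarseEdges, Mesh.IsFirstBasis κ (n E) E (φ₁ E))
        (lam : Sym2 Plane → ℕ → ℝ) (φ₂ : Sym2 Plane → ℕ → M.VField)
        (_ : ∀ E ∈ M.coarseEdges, Mesh.IsEdgeEigenbasis κ (n E) E (lam E) (φ₂ E))
        (mu : M.Cell → ℕ → ℝ) (φ₃ : M.Cell → ℕ → M.VField) (p₃ : M.Cell → ℕ → M.QField)
        (_ : ∀ K, Mesh.IsCellEigenbasis κ ρ K (mu K) (φ₃ K) (p₃ K))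
        (nE : Sym2 Plane → ℕ) (_ : ∀ E ∈ M.coarseEdges, nE E ≤ M.edgeDim E)
        (mK : M.Cell → ℕ) (_ : ∀ K, mK K ≤ M.cellDim K),
        ∀ t ∈ Icc 0 T, ∃ d : M.Cell → ℕ → ℝ,
          v t = Mesh.expansion n φ₁ φ₂ φ₃ M.edgeDim M.cellDim (v t) d ∧
          (∀ d' : M.Cell → ℕ → ℝ,
            v t = Mesh.expansion n φ₁ φ₂ φ₃ M.edgeDim M.cellDim (v t) d' →
              ∀ K, ∀ j < M.cellDim K, d' K j = d K j) ∧
          Mesh.vInner κ Finset.univ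
              (v t - Mesh.expansion n φ₁ φ₂ φ₃ nE mK (v t) d)
              (v t - Mesh.expansion n φ₁ φ₂ φ₃ nE mK (v t) d) ≤
            C * ((⨆ E : M.coarseEdges, invNext (M.edgeDim E) (lam E) (nE E)) *
                  ∑ E ∈ M.coarseEdges, Mesh.edgeEnergy (n E) (v t) E +
                (⨆ K : M.Cell, invNext (M.cellDim K) (mu K) (mK K)) *
                  ∑ τ, ∫ x in M.tri τ,
                    ρ x * ((ρ x)⁻¹ * f t x - Mesh.pressure (pI' t) (pB' t) τ x) ^ 2) := by
  classical
  -- `12 = 2 * 3 * 2`: the error on a coarse element splits into an element part and an edge part,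
  -- the latter has three terms, and an edge has up to two sides, over which its energy is averaged
  refine ⟨12, by norm_num, ?_⟩
  intro M κ ρ hκ hρ T hT f hf v v' pI pI' pB pB' hsol n hn φ₁ h₁ lam φ₂ h₂ mu φ₃ p₃ h₃ nE hnE mK hmK
    t ht
  set d : M.Cell → ℕ → ℝ := fun K j =>
    (mu K j)⁻¹ * Mesh.divPair (M.elems K) (p₃ K j) (v t) with hd
  have hexp : v t = Mesh.expansion n φ₁ φ₂ φ₃ M.edgeDim M.cellDim (v t) d := by
    funext τ
    obtain ⟨K, hK⟩ := Mesh.exists_mem_elems τ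
    rw [Mesh.expansion_apply _ _ _ _ _ _ _ _ hK]
    exact Mesh.local_expansion hκ hn h₁ h₂ (h₃ K) ((hsol.velocity t ht).isLocal K)
      (fun w hw hdiv => hsol.orthogonal hκ hT hw hdiv ht) τ hK
  refine ⟨d, hexp, ?_, ?_⟩
  · intro d' hexp' K i hi
    -- the eigenfunctions of `K` are orthogonal with squared norms `mu K i > 0`
    have hzero : ∀ τ ∈ M.elems K,
        (∑ j ∈ Finset.range (M.cellDim K), (d' K j - d K j) • φ₃ K j) τ = 0 := by
      intro τ hτ
      have h := congrFun (hexp'.symm.trans hexp) τ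
      rw [Mesh.expansion_apply _ _ _ _ _ _ _ _ hτ, Mesh.expansion_apply _ _ _ _ _ _ _ _ hτ,
        add_right_inj, ← sub_eq_zero, ← Finset.sum_sub_distrib] at h
      rw [Finset.sum_apply, ← h]
      exact Finset.sum_congr rfl fun j _ => by rw [Pi.smul_apply, sub_smul]
    have h := Mesh.vInner_congr (κ := κ) (w := φ₃ K i) (w' := φ₃ K i) (v' := 0) hzero
      fun _ _ => rfl
    rw [← Mesh.vForm_apply hκ, ← Mesh.vForm_apply hκ, map_zero, LinearMap.zero_apply, map_sum,
      LinearMap.sum_apply, Finset.sum_eq_single i] at h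
    · rw [map_smul, LinearMap.smul_apply, Mesh.vForm_apply, (h₃ K).vInner_eq hi hi, if_pos rfl,
        smul_eq_mul] at h
      exact sub_eq_zero.1 ((mul_eq_zero.1 h).resolve_right ((h₃ K).mu_pos hκ hi).ne')
    · intro j hj hji
      rw [map_smul, LinearMap.smul_apply, Mesh.vForm_apply,
        (h₃ K).vInner_eq (Finset.mem_range.1 hj) hi, if_neg hji, smul_zero]
    · intro hi'
      exact absurd (Finset.mem_range.2 hi) hi'
  · set L := ⨆ E : M.coarseEdges, invNext (M.edgeDim E) (lam E) (nE E) with hL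
    set U := ⨆ K : M.Cell, invNext (M.cellDim K) (mu K) (mK K) with hU
    set err := v t - Mesh.expansion n φ₁ φ₂ φ₃ nE mK (v t) d with herr
    set X : M.Elem → ℝ := fun τ => ∫ x in M.tri τ,
      ρ x * ((ρ x)⁻¹ * f t x - Mesh.pressure (pI' t) (pB' t) τ x) ^ 2 with hX
    set I : M.Cell → Sym2 Plane → ℝ := fun K E =>
      M.edgeIntegral K E fun τ x => Mesh.normalComp (n E) (v t) τ x ^ 2 with hI
    have hX0 : ∀ τ, 0 ≤ X τ := by
      intro τ
      obtain ⟨-, a, b, ha, hab⟩ := hρ.tri τ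
      refine integral_nonneg_of_ae ?_
      filter_upwards [hab] with x hx
      exact mul_nonneg (ha.le.trans hx.1) (sq_nonneg _)
    have hI0 : ∀ K E, 0 ≤ I K E := fun K E => Mesh.edgeIntegral_sq_nonneg _ _ _ _
    -- the two parts of the error on one coarse element
    set edgeTail : Sym2 Plane → M.Cell → M.VField := fun E K =>
      ∑ j ∈ Finset.Ico (nE E) (M.edgeDim E),
        Mesh.edgeCoeff (n E) (v t) K E (φ₂ E j) • φ₂ E j with hET
    set cellTail : M.Cell → M.VField := fun K =>
      ∑ j ∈ Finset.Ico (mK K) (M.cellDim K), d K j • φ₃ K j with hCT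
    have herrK : ∀ K, ∀ τ ∈ M.elems K,
        err τ = (∑ E ∈ Mesh.cellEdges K, edgeTail E K + cellTail K) τ := by
      intro K τ hτ
      have h1 := congrFun hexp τ
      rw [Mesh.expansion_apply _ _ _ _ _ _ _ _ hτ] at h1
      rw [herr, Pi.sub_apply, Mesh.expansion_apply _ _ _ _ _ _ _ _ hτ]
      conv_lhs => rw [h1]
      rw [add_sub_add_comm, ← Pi.sub_apply, Mesh.edgePart, Mesh.edgePart,
        ← Finset.sum_sub_distrib, Pi.add_apply]
      congr 1
      · refine congrFun (Finset.sum_congr rfl fun E hE => ?_) τ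
        rw [add_sub_add_left_eq_sub,
          ← Finset.sum_Ico_eq_sub _ (hnE E (Mesh.mem_cellEdges.1 hE).1)]
      · rw [← Finset.sum_Ico_eq_sub _ (hmK K)]
        simp only [hCT, Finset.sum_apply, Pi.smul_apply]
    have hcell : ∀ K, Mesh.vInner κ (M.elems K) err err ≤
        6 * (L * ∑ E ∈ Mesh.cellEdges K, I K E) + 2 * (U * ∑ τ ∈ M.elems K, X τ) := by
      intro K
      rw [Mesh.vInner_congr (herrK K) (herrK K), ← Mesh.vForm_apply hκ]
      have hsymm := Mesh.vForm_comm hκ (M.elems K)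
      have hpos := Mesh.vInner_nonneg hκ (M.elems K)
      refine (form_add_le hsymm hpos _ _).trans ?_
      have hE : ∀ E ∈ Mesh.cellEdges K,
          Mesh.vForm hκ (M.elems K) (edgeTail E K) (edgeTail E K) ≤ L * I K E := by
        intro E hEK
        obtain ⟨k, rfl⟩ := Mesh.exists_of_mem_cellEdges hEK
        have hE := Mesh.cellSide_mem_coarseEdges K k
        refine ((h₂ _ hE).tail_le hκ (hn _ hE).1 (hn _ hE).2 (v t) (nE _)).trans ?_
        refine mul_le_mul_of_nonneg_right ?_ (hI0 _ _)
        exact le_ciSup (f := fun E : M.coarseEdges => invNext (M.edgeDim E) (lam E) (nE E))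
          (Set.finite_range _).bddAbove ⟨M.cellSide K k, hE⟩
      have hsum : Mesh.vForm hκ (M.elems K) (∑ E ∈ Mesh.cellEdges K, edgeTail E K)
          (∑ E ∈ Mesh.cellEdges K, edgeTail E K) ≤ 3 * (L * ∑ E ∈ Mesh.cellEdges K, I K E) := by
        refine (form_sum_le hsymm hpos _ _).trans ?_
        have hcard : ((Mesh.cellEdges K).card : ℝ) ≤ 3 := by
          exact_mod_cast Mesh.card_cellEdges_le K
        refine mul_le_mul hcard ?_ (Finset.sum_nonneg fun E _ => hpos _) (by norm_num)
        rw [Finset.mul_sum]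
        exact Finset.sum_le_sum hE
      have hC : Mesh.vForm hκ (M.elems K) (cellTail K) (cellTail K) ≤
          U * ∑ τ ∈ M.elems K, X τ := by
        refine ((h₃ K).tail_le hκ hρ hsol ht (hf t ht) (mK K)).trans ?_
        refine mul_le_mul_of_nonneg_right ?_ (Finset.sum_nonneg fun τ _ => hX0 τ)
        exact le_ciSup (f := fun K : M.Cell => invNext (M.cellDim K) (mu K) (mK K))
          (Set.finite_range _).bddAbove K
      linarith
    have hL0 : 0 ≤ L := Real.iSup_nonneg fun E => by
      obtain ⟨K, k, hKk⟩ : ∃ K k, M.cellSide K k = E := by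
        have := E.2
        simp only [Mesh.coarseEdges, Finset.mem_image, Finset.mem_univ, true_and] at this
        obtain ⟨Kk, h⟩ := this
        exact ⟨Kk.1, Kk.2, h⟩
      have hb := h₂ E E.2
      rw [← hKk] at hb ⊢
      exact invNext_nonneg fun j hj => hb.lam_pos hκ hj
    have hedge : ∑ K, ∑ E ∈ Mesh.cellEdges K, I K E ≤
        2 * ∑ E ∈ M.coarseEdges, Mesh.edgeEnergy (n E) (v t) E := by
      rw [Finset.sum_comm' (s' := M.patch) (t' := M.coarseEdges) fun K E => by
        simp [Mesh.mem_cellEdges, and_comm], Finset.mul_sum]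
      exact Finset.sum_le_sum fun E _ => Mesh.sum_edgeIntegral_le _ _ _
    calc Mesh.vInner κ Finset.univ err err
        = ∑ K, Mesh.vInner κ (M.elems K) err err := Mesh.sum_univ_eq_sum_elems _
      _ ≤ ∑ K, (6 * (L * ∑ E ∈ Mesh.cellEdges K, I K E) + 2 * (U * ∑ τ ∈ M.elems K, X τ)) :=
          Finset.sum_le_sum fun K _ => hcell K
      _ = 6 * (L * ∑ K, ∑ E ∈ Mesh.cellEdges K, I K E) + 2 * (U * ∑ τ, X τ) := by
          rw [Mesh.sum_univ_eq_sum_elems X, Finset.sum_add_distrib, ← Finset.mul_sum,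
            ← Finset.mul_sum, ← Finset.mul_sum, ← Finset.mul_sum]
      _ ≤ 12 * (L * ∑ E ∈ M.coarseEdges, Mesh.edgeEnergy (n E) (v t) E + U * ∑ τ, X τ) := by
          have h1 := mul_le_mul_of_nonneg_left hedge hL0
          have h2 : 0 ≤ U * ∑ τ, X τ :=
            mul_nonneg (Real.iSup_nonneg fun K => invNext_nonneg fun j hj => (h₃ K).mu_pos hκ hj)
              (Finset.sum_nonneg fun τ _ => hX0 τ)
          linarith
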